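/- A robot is a bounded convex region $Z\subset\mathbb R^2$ with non-empty interior and $Z=-Z$; $Z[z]=z+Z$ is its placement at $z$. Let $\mathbb A,\mathbb B$ be robots and let $\mathbb A+\mathbb B$ be their Minkowski sum. The reach of a set $S$ is $r_S(\theta)=\sup\{x\cos\theta+y\sin\theta:(x,y)\in S\}$. A configuration $(\mathbb A[A],\mathbb B[B])$ is viable if the interiors of the two placements are disjoint (contact is allowed); an orientation of it is an angle $\theta$ maximizing the separation $r_{\mathbb A[A]}(\theta)-r_{\mathbb B[B]}(\theta)-2r_{\mathbb A}(\theta)$. Let $(\mathbb A[A_0],\mathbb B[B_0])$ and $(\mathbb A[A_1],\mathbb B[B_1])$ be viable configurations with orientations $\theta_0,\theta_1$ (any choice, if not unique), and let $[\theta_0,\theta_1]$ be the range of angles met when turning counter-clockwise from $\theta_0$ to $\theta_1$. A co-motion is a pair $(\xi_{\mathbb A},\xi_{\mathbb B})$ of continuous rectifiable curves on $[0,1]$ from $A_0$ to $A_1$ and from $B_0$ to $B_1$. It is collision-free if every configuration $(\mathbb A[\xi_{\mathbb A}(t)],\mathbb B[\xi_{\mathbb B}(t)])$ is viable, and net counter-clockwise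 if every angle of $[\theta_0,\theta_1]$ is an orientation of one of these configurations. A counter-clockwise oriented shortest path from $p$ to $q$ avoiding a region $K$ centred at $c$ is a path from $p$ to $q$ outside the interior of $c+K$ that either is a straight segment, or makes a net turn in $[0,2\pi)$ counter-clockwise around $c$ and is shortest among all such paths. The co-motion has standard form (with $\mathbb A$ moving first) if, for some point $A_{\rm int}$, it consists of three consecutive, possibly degenerate, steps: (1) $\mathbb A$ moves from $A_0$ to $A_{\rm int}$ while $\mathbb B$ rests at $B_0$; (2) $\mathbb B$ moves from $B_0$ to $B_1$ while $\mathbb A$ rests at $A_{\rm int}$; (3) $\mathbb A$ moves from $A_{\rm int}$ to $A_1$ while $\mathbb B$ rests at $B_1$; each step along a counter-clockwise oriented shortest path avoiding $\mathbb A+\mathbb B$ centred at the position of the resting robot. Let $\widehat\xi$ denote the boundary of the convex hull of the trace of $\xi$, and put $s(\theta)=r_{\overline{A_0A_1}}(\theta)+r_{\overline{B_0B_1}}(\pi+\theta)$. The pair $(\widehat{\xi_{\mathbb A}},\widehat{\xi_{\mathbb B}})$ is counter-clockwise tight if, for all $\theta$, $r_{\widehat{\xi_{\mathbb A}}}(\theta)+r_{\widehat{\xi_{\mathbb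 B}}}(\pi+\theta)$ equals $\max\big(s(\theta),r_{\mathbb A+\mathbb B}(\theta)\big)$ if $\theta\in[\theta_0,\theta_1]$, and equals $s(\theta)$ otherwise. Let $\mathrm{corr}(P,Q)$ be the interior of $\overline{PQ}+(\mathbb A+\mathbb B)$, and assume that the two robots cannot simply be translated straight to their goals one after the other, i.e. that neither [$A_0\notin\mathrm{corr}(B_0,B_1)$ and $B_1\notin\mathrm{corr}(A_0,A_1)$] nor [$A_1\notin\mathrm{corr}(B_0,B_1)$ and $B_0\notin\mathrm{corr}(A_0,A_1)$] holds. **Lemma.** After exchanging the roles of $\mathbb A$ and $\mathbb B$ in the definition of standard form if necessary, there is a collision-free, net counter-clockwise co-motion of standard form for which the pair $(\widehat{\xi_{\mathbb A}},\widehat{\xi_{\mathbb B}})$ is counter-clockwise tight. The exchange is not necessary (that is, $\mathbb A$ can be taken to move first) if $A_0,A_1\in\mathrm{corr}(B_0,B_1)$, or if $B_0,B_1$ do not both lie in $\mathrm{corr}(A_0,A_1)$. -/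

import Mathlib

open Set
open scoped Pointwise

noncomputable section

/-- The Euclidean plane. -/
abbrev Plane : Type := EuclideanSpace ℝ (Fin 2)

/-- The unit vector at angle `θ`. -/
def unitDir (θ : ℝ) : Plane := !₂[Real.cos θ, Real.sin θ]

/-- The reach (support function) of a planar set in direction `θ`. -/
def reach (S : Set Plane) (θ : ℝ) : ℝ :=
  sSup ((fun p : Plane => p 0 * Real.cos θ + p 1 * Real.sin θ) '' S)

/-- A convex centrally-symmetric (CCS) robot in standard placement: a bounded convex
centrally-symmetric region of the plane. No choice is made about which boundary points belong
to the robot. -/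
structure IsRobot (Z : Set Plane) : Prop where
  convex : Convex ℝ Z
  symmetric : ∀ p ∈ Z, -p ∈ Z
  bounded : Bornology.IsBounded Z
  interior_nonempty : (interior Z).Nonempty

/-- The placement of the robot `Z` with centre `z`. -/
def placement (Z : Set Plane) (z : Plane) : Set Plane := (fun x => z + x) '' Z

/-- A configuration is viable if the two placed robots do not overlap; boundary contact is
allowed. -/
def IsViable (A B : Set Plane) (a b : Plane) : Prop :=
  Disjoint (interior (placement A a)) (interior (placement B b))

/-- The separation of `A` placed at `a` from `B` placed at `b` in direction `θ`. -/
def separation (A B : Set Plane) (a b : Plane) (θ : ℝ) : ℝ :=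
  reach (placement A a) θ - reach (placement B b) θ - 2 * reach A θ

/-- `θ` is an orientation of the configuration: a direction of maximal separation. It is unique
modulo `2 * π` unless the robots are in contact, when there may be several. -/
def IsOrientation (A B : Set Plane) (a b : Plane) (θ : ℝ) : Prop :=
  ∀ φ : ℝ, separation A B a b φ ≤ separation A B a b θ

/-- The angles met when turning counter-clockwise from `θ₀` to `θ₁` (by less than a full turn),
as a `2 * π`-periodic set of real numbers. -/
def ccwRange (θ₀ θ₁ : ℝ) : Set ℝ :=
  {θ | toIcoMod Real.two_pi_pos 0 (θ - θ₀) ≤ toIcoMod Real.two_pi_pos 0 (θ₁ - θ₀)}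

/-- `ξ`, restricted to `[0, 1]`, is a motion from `p` to `q`: a continuous rectifiable curve. -/
structure IsMotion (ξ : ℝ → Plane) (p q : Plane) : Prop where
  continuousOn : ContinuousOn ξ (Icc 0 1)
  rectifiable : eVariationOn ξ (Icc 0 1) ≠ ⊤
  start : ξ 0 = p
  finish : ξ 1 = q

/-- The trace of a motion. -/
def trace (ξ : ℝ → Plane) : Set Plane := ξ '' Icc 0 1

/-- The boundary of the convex hull of the trace of a motion. -/
def hullBoundary (ξ : ℝ → Plane) : Set Plane := frontier (convexHull ℝ (trace ξ))

/-- The configuration is viable at all times. -/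
def IsCollisionFree (A B : Set Plane) (ξA ξB : ℝ → Plane) : Prop :=
  ∀ t ∈ Icc (0 : ℝ) 1, IsViable A B (ξA t) (ξB t)

/-- Every angle in the counter-clockwise range from `θ₀` to `θ₁` is an orientation of some
configuration of the co-motion. -/
def IsNetCcw (A B : Set Plane) (ξA ξB : ℝ → Plane) (θ₀ θ₁ : ℝ) : Prop :=
  ∀ θ ∈ ccwRange θ₀ θ₁, ∃ t ∈ Icc (0 : ℝ) 1, IsOrientation A B (ξA t) (ξB t) θ

/-- The sum of the reach of the segment `A₀A₁` in direction `θ` and of the segment `B₀B₁` in the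
opposite direction. -/
def segmentReach (A₀ A₁ B₀ B₁ : Plane) (θ : ℝ) : ℝ :=
  reach (segment ℝ A₀ A₁) θ + reach (segment ℝ B₀ B₁) (Real.pi + θ)

open Classical in
/-- Counter-clockwise tightness of the pair of convex-hull boundaries. The reach of `A + B` enters
the maximum for directions in the range from `θ₀` to `θ₁` only. -/
def IsCcwTight (A B : Set Plane) (A₀ A₁ B₀ B₁ : Plane) (θ₀ θ₁ : ℝ) (ξA ξB : ℝ → Plane) : Prop :=
  ∀ θ : ℝ, reach (hullBoundary ξA) θ + reach (hullBoundary ξB) (Real.pi + θ) =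
    if θ ∈ ccwRange θ₀ θ₁ then max (segmentReach A₀ A₁ B₀ B₁ θ) (reach (A + B) θ)
    else segmentReach A₀ A₁ B₀ B₁ θ

/-- On the time interval `[a, b]` the curve `ξ` stays out of the interior of `K` centred
at `c`. -/
def AvoidsOn (K : Set Plane) (c : Plane) (ξ : ℝ → Plane) (a b : ℝ) : Prop :=
  ∀ t ∈ Icc a b, ξ t - c ∉ interior K

/-- Along `ξ` on `[a, b]`, the direction seen from `c`, followed continuously, makes a
counter-clockwise net turn of less than a full turn. -/
def TurnsCcwOn (c : Plane) (ξ : ℝ → Plane) (a b : ℝ) : Prop :=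
  ∃ ρ φ : ℝ → ℝ, ContinuousOn φ (Icc a b) ∧
    (∀ t ∈ Icc a b, 0 < ρ t ∧ ξ t = c + ρ t • unitDir (φ t)) ∧
    φ a ≤ φ b ∧ φ b < φ a + 2 * Real.pi

/-- On `[a, b]` the curve `ξ` is a counter-clockwise oriented shortest path avoiding `K` centred at
`c`: it avoids the interior of `K` and either is straight (its length is the distance between its
end points), or turns counter-clockwise around `c` and is shortest among all curves with these
properties and the same end points. -/
def IsCcwShortestOn (K : Set Plane) (c : Plane) (ξ : ℝ → Plane) (a b : ℝ) : Prop :=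
  AvoidsOn K c ξ a b ∧
    (eVariationOn ξ (Icc a b) = edist (ξ a) (ξ b) ∨
      (TurnsCcwOn c ξ a b ∧
        ∀ η : ℝ → Plane, ContinuousOn η (Icc a b) → η a = ξ a → η b = ξ b →
          AvoidsOn K c η a b → TurnsCcwOn c η a b →
          eVariationOn ξ (Icc a b) ≤ eVariationOn η (Icc a b)))

/-- Standard form (any step may be degenerate): during `[0, s]` only the first robot moves, from its
initial position to the intermediate position `ξA s`, around the resting second robot; during
`[s, t]` only the second robot moves, from its initial to its final position, around the first robot
resting at `ξA s`; during `[t, 1]` only the first robot moves, to its final position. Each step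
is a counter-clockwise oriented shortest path avoiding the resting robot. -/
def IsStandardForm (A B : Set Plane) (ξA ξB : ℝ → Plane) : Prop :=
  ∃ s t : ℝ, 0 ≤ s ∧ s ≤ t ∧ t ≤ 1 ∧
    (∀ τ ∈ Icc 0 s, ξB τ = ξB 0) ∧
    (∀ τ ∈ Icc s t, ξA τ = ξA s) ∧
    (∀ τ ∈ Icc t 1, ξB τ = ξB 1) ∧
    IsCcwShortestOn (A + B) (ξB 0) ξA 0 s ∧
    IsCcwShortestOn (A + B) (ξA s) ξB s t ∧
    IsCcwShortestOn (A + B) (ξB 1) ξA t 1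

/-- The open `K`-corridor between `p` and `q`: the positions at which a resting robot is hit when
`K` is swept along the segment from `p` to `q`. -/
def openCorridor (K : Set Plane) (p q : Plane) : Set Plane := interior (segment ℝ p q + K)

/-- One of the robots can be translated straight to its goal first, and then the other one,
without a collision. -/
def StraightLineFeasible (A B : Set Plane) (A₀ A₁ B₀ B₁ : Plane) : Prop :=
  (A₀ ∉ openCorridor (A + B) B₀ B₁ ∧ B₁ ∉ openCorridor (A + B) A₀ A₁) ∨
    (A₁ ∉ openCorridor (A + B) B₀ B₁ ∧ B₀ ∉ openCorridor (A + B) A₀ A₁)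

/-- `(ξA, ξB)` is a collision-free co-motion between the given configurations that is net
counter-clockwise and counter-clockwise tight. -/
structure IsTightCcwCoMotion (A B : Set Plane) (A₀ A₁ B₀ B₁ : Plane) (θ₀ θ₁ : ℝ)
    (ξA ξB : ℝ → Plane) : Prop where
  motionA : IsMotion ξA A₀ A₁
  motionB : IsMotion ξB B₀ B₁
  collisionFree : IsCollisionFree A B ξA ξB
  netCcw : IsNetCcw A B ξA ξB θ₀ θ₁
  tight : IsCcwTight A B A₀ A₁ B₀ B₁ θ₀ θ₁ ξA ξB

end

/-!
Let `K = A + B`, `p = A₀ - B₀`, `q = A₁ - B₁`, `d = B₀ - B₁`. A configuration is viable if and only if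
the relative position of the robots is outside `interior K` (`isViable_iff`), and its orientations are
the directions in which the relative position is separated most from `K` (`isOrientation_iff`). A
co-motion in standard form is a relative path `p → y → y + d → q` whose three pieces go around the
obstacle `interior K`, where `y` encodes the intermediate position; the middle piece is traversed by
the second robot.

*Steps* (`exists_isCcwShortestOn`). If the segment from `p` to `q` meets the obstacle at `m`, then a
curve around the obstacle makes a net turn in `[0, 2π)` as seen from the origin if and only if it
makes half a turn as seen from `m` (`IsBlocked.net_turn`). Hence it can be cut off, without becoming
longer, so that it stays to the right of the line through `p` and `q` (`IsBlocked.exists_cut`), where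
a shortest curve exists by compactness (`exists_shortest_curve`) and lies in the hull of `p`, `q` and
the right part of the obstacle, by projection onto that hull.

*Intermediate position* (`exists_lowest_chord`). Let `v` be `d` turned by a quarter turn, and let `C`
be the closed convex hull of the obstacle and of `p`, `p + d`, `q - d`, `q`. Among the chords of `C`
with displacement `d`, the chord from `y` to `y + d` is lowest with respect to `v`; its end points
are boundary points of `C` and so have outer normals.

*Bounds* (`IsThreeStep.bound`). Let `a` and `b` be outer normals of the obstacle that separate it from
`p` and from `q`, with `a · d < 0 < b · d`. The path gets beyond its corner points only in directions
of the arc from `a` over `-v` to `b`. In such a direction it gets at most as far as the obstacle, and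
not more than one of the three steps gains anything (`HalfData.confined_dichotomy`,
`HalfData.inner_le_of_lt`). Therefore the sum of the reaches of the two hulls is bounded by the
segment reach, or by the reach of `K` in directions of the arc.

*Orientations.* A path that never gets beyond the obstacle in a direction `σ` sweeps all the
orientations between its first and last one, on the circle cut open at `σ`
(`exists_isDirection_of_mem_uIcc`). With both positions of `A` in the corridor of `B`, the normals
`a` and `b` are the given orientations and `σ` is the direction of `v`, so that the arc is the range
of orientations. If `B₁` is not in the corridor of `A`, then `b` is a normal that separates the whole
segment from `p + d` to `q`; the first two steps are cut open at `v` and the last one at `a`, and in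
the part of the arc beyond the range the point `q` is as far as the obstacle
(`hasTightThreeStep_of_free_right`). The case of `B₀` not in the corridor is the mirror image
(`hasTightThreeStep_of_free_left`), and the remaining case is reduced to the first one by exchanging
the robots (`IsTightCcwCoMotion.swap`).

The lower bound in the tightness equation holds for every net counter-clockwise motion
(`isCcwTight_of_le`), as each orientation occurs in a viable configuration.
-/

noncomputable section

open Filter Topology
open scoped NNReal ENNReal

/-! ### Shortest curves in closed sets -/

theorem continuousOn_variationOnFromTo {E : Type*} [PseudoMetricSpace E] {f : ℝ → E} {a b : ℝ}
    (hab : a ≤ b) (hf : ContinuousOn f (Icc a b)) (hv : eVariationOn f (Icc a b) ≠ ⊤) :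
    ContinuousOn (variationOnFromTo f (Icc a b) a) (Icc a b) := by
  have hloc : LocallyBoundedVariationOn f (Icc a b) :=
    BoundedVariationOn.locallyBoundedVariationOn hv
  have ha : a ∈ Icc a b := left_mem_Icc.2 hab
  intro t ht
  have h₁ := variationOnFromTo.tendsto_left (l := f t) ha ht hloc
    ((hf t ht).mono_left (nhdsWithin_mono _ inter_subset_left))
  have h₂ := variationOnFromTo.tendsto_right (l := f t) ha ht hloc
    ((hf t ht).mono_left (nhdsWithin_mono _ inter_subset_left))
  rw [dist_self, sub_zero] at h₁
  rw [dist_self, add_zero] at h₂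
  have hunion : Icc a b ⊆ Icc a b ∩ Iio t ∪ (Icc a b ∩ Ioi t ∪ {t}) := by
    intro s hs
    rcases lt_trichotomy s t with h | h | h
    · exact Or.inl ⟨hs, h⟩
    · exact Or.inr (Or.inr h)
    · exact Or.inr (Or.inl ⟨hs, h⟩)
  refine Tendsto.mono_left ?_ (nhdsWithin_mono t hunion)
  rw [nhdsWithin_union, nhdsWithin_union, nhdsWithin_singleton]
  exact h₁.sup (h₂.sup (tendsto_pure_nhds _ _))

/-- Parametrization proportional to arc length. The new curve is `f ∘ τ`, where `τ s` is a time up to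
which `f` has covered the proportion of its length that `s` marks in `[a, b]`; it is Lipschitz. -/
theorem exists_lipschitz_reparametrization {E : Type*} [MetricSpace E] {f : ℝ → E} {a b : ℝ}
    (hab : a < b) (hf : ContinuousOn f (Icc a b)) {L : ℝ}
    (hL0 : 0 ≤ L) (hv : eVariationOn f (Icc a b) ≤ ENNReal.ofReal L) :
    ∃ g : ℝ → E, (∀ s ∈ Icc a b, ∀ t ∈ Icc a b, dist (g s) (g t) ≤ L / (b - a) * |s - t|) ∧
      g a = f a ∧ g b = f b ∧ MapsTo g (Icc a b) (f '' Icc a b) ∧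
      eVariationOn g (Icc a b) ≤ eVariationOn f (Icc a b) := by
  have hv' : eVariationOn f (Icc a b) ≠ ⊤ := ne_top_of_le_ne_top ENNReal.ofReal_ne_top hv
  have hloc : LocallyBoundedVariationOn f (Icc a b) :=
    BoundedVariationOn.locallyBoundedVariationOn hv'
  have ha : a ∈ Icc a b := left_mem_Icc.2 hab.le
  have hb : b ∈ Icc a b := right_mem_Icc.2 hab.le
  set V := variationOnFromTo f (Icc a b) a with hV
  have hVc : ContinuousOn V (Icc a b) := continuousOn_variationOnFromTo hab.le hf hv'
  have hVa : V a = 0 := variationOnFromTo.self _ _ _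
  set l := V b with hl
  have hl' : l = (eVariationOn f (Icc a b)).toReal := by
    rw [hl, hV, variationOnFromTo.eq_of_le _ _ hab.le, inter_self]
  have hl0 : 0 ≤ l := by rw [hl']; exact ENNReal.toReal_nonneg
  have hba : 0 < b - a := sub_pos.2 hab
  have hdist : ∀ s ∈ Icc a b, ∀ t ∈ Icc a b, dist (f s) (f t) ≤ |V s - V t| := by
    have key : ∀ s ∈ Icc a b, ∀ t ∈ Icc a b, s ≤ t → dist (f s) (f t) ≤ |V s - V t| := by
      intro s hs t ht hst
      have h1 : V t - V s = variationOnFromTo f (Icc a b) s t :=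
        variationOnFromTo.sub_right hloc ha ht hs
      rw [abs_sub_comm, h1, variationOnFromTo.eq_of_le _ _ hst,
        abs_of_nonneg ENNReal.toReal_nonneg]
      exact (BoundedVariationOn.mono (f := f) hv' inter_subset_left).dist_le
        ⟨hs, left_mem_Icc.2 hst⟩ ⟨ht, right_mem_Icc.2 hst⟩
    intro s hs t ht
    rcases le_total s t with h | h
    · exact key s hs t ht h
    · rw [dist_comm, abs_sub_comm]; exact key t ht s hs h
  have hex : ∀ s : ℝ, ∃ t, s ∈ Icc a b → t ∈ Icc a b ∧ V t = (s - a) / (b - a) * l := by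
    intro s
    by_cases hs : s ∈ Icc a b
    · have hmem : (s - a) / (b - a) * l ∈ Icc (V a) (V b) := by
        rw [hVa, ← hl]
        have h1 : 0 ≤ (s - a) / (b - a) := div_nonneg (sub_nonneg.2 hs.1) hba.le
        have h2 : (s - a) / (b - a) ≤ 1 := (div_le_one hba).2 (by linarith [hs.2])
        exact ⟨mul_nonneg h1 hl0, mul_le_of_le_one_left hl0 h2⟩
      obtain ⟨t, ht, hVt⟩ := intermediate_value_Icc hab.le hVc hmem
      exact ⟨t, fun _ => ⟨ht, hVt⟩⟩
    · exact ⟨a, fun h => absurd h hs⟩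
  choose τ hτ using hex
  have hlip : ∀ s ∈ Icc a b, ∀ t ∈ Icc a b,
      dist (f (τ s)) (f (τ t)) ≤ l / (b - a) * |s - t| := by
    intro s hs t ht
    refine (hdist _ (hτ s hs).1 _ (hτ t ht).1).trans (le_of_eq ?_)
    rw [(hτ s hs).2, (hτ t ht).2, ← sub_mul, ← sub_div, abs_mul, abs_div, abs_of_pos hba,
      abs_of_nonneg hl0]
    rw [show s - a - (t - a) = s - t by ring]
    ring
  have hlL : l ≤ L := by
    rw [hl']
    exact ENNReal.toReal_le_of_le_ofReal hL0 hv
  have hend : ∀ t ∈ Icc a b, ∀ s ∈ Icc a b, V t = V s → f t = f s := by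
    intro t ht s hs h
    have := hdist t ht s hs
    rw [h, sub_self, abs_zero] at this
    exact dist_le_zero.1 this
  refine ⟨fun s => f (τ s), ?_, ?_, ?_, ?_, ?_⟩
  · intro s hs t ht
    refine (hlip s hs t ht).trans ?_
    gcongr
  · exact hend _ (hτ a ha).1 _ ha (by rw [(hτ a ha).2, hVa]; simp)
  · refine hend _ (hτ b hb).1 _ hb ?_
    rw [(hτ b hb).2, div_self hba.ne', one_mul]
  · intro s hs
    exact mem_image_of_mem _ (hτ s hs).1
  · have hL : LipschitzOnWith (Real.toNNReal (l / (b - a))) (fun s => f (τ s)) (Icc a b) := by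
      refine LipschitzOnWith.of_dist_le_mul fun s hs t ht => ?_
      rw [Real.coe_toNNReal _ (div_nonneg hl0 hba.le), Real.dist_eq]
      exact hlip s hs t ht
    have h1 := hL.comp_eVariationOn_le (g := id) (s := Icc a b) (fun x hx => hx)
    rw [Function.comp_id, eVariationOn_id_Icc] at h1
    refine h1.trans (le_of_eq ?_)
    have h2 : eVariationOn f (Icc a b) = ENNReal.ofReal l := by
      rw [hl', ENNReal.ofReal_toReal hv']
    rw [h2]
    change ENNReal.ofReal _ * ENNReal.ofReal _ = _
    rw [← ENNReal.ofReal_mul (div_nonneg hl0 hba.le), div_mul_cancel₀ _ hba.ne']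

/-- In a closed subset of a proper metric space, two points that are joined by a rectifiable curve
are joined by a shortest one. Curves of a minimizing sequence are parametrized proportionally to arc
length; their pointwise limit along an ultrafilter is a shortest curve, because the length is lower
semicontinuous for pointwise convergence. -/
theorem exists_shortest_curve {E : Type*} [MetricSpace E] [ProperSpace E] {S : Set E}
    (hS : IsClosed S) {a b : ℝ} (hab : a < b) {p q : E}
    (hex : ∃ f : ℝ → E, ContinuousOn f (Icc a b) ∧ eVariationOn f (Icc a b) ≠ ⊤ ∧
      MapsTo f (Icc a b) S ∧ f a = p ∧ f b = q) :
    ∃ f : ℝ → E, ContinuousOn f (Icc a b) ∧ eVariationOn f (Icc a b) ≠ ⊤ ∧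
      MapsTo f (Icc a b) S ∧ f a = p ∧ f b = q ∧
      ∀ g : ℝ → E, ContinuousOn g (Icc a b) → MapsTo g (Icc a b) S → g a = p → g b = q →
        eVariationOn f (Icc a b) ≤ eVariationOn g (Icc a b) := by
  have ha : a ∈ Icc a b := left_mem_Icc.2 hab.le
  have hb : b ∈ Icc a b := right_mem_Icc.2 hab.le
  let T : Set (ℝ → E) := {f | ContinuousOn f (Icc a b) ∧ MapsTo f (Icc a b) S ∧ f a = p ∧ f b = q}
  let l : ℝ≥0∞ := ⨅ f ∈ T, eVariationOn f (Icc a b)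
  have hlle : ∀ f ∈ T, l ≤ eVariationOn f (Icc a b) := fun f hf => iInf₂_le f hf
  have hltop : l ≠ ⊤ := by
    obtain ⟨f, h1, h2, h3, h4, h5⟩ := hex
    exact ne_top_of_le_ne_top h2 (hlle f ⟨h1, h3, h4, h5⟩)
  have hseq : ∀ n : ℕ, ∃ f ∈ T, eVariationOn f (Icc a b) < l + ((n : ℝ≥0∞) + 1)⁻¹ := by
    intro n
    have hlt : l < l + ((n : ℝ≥0∞) + 1)⁻¹ := ENNReal.lt_add_right hltop (by simp)
    obtain ⟨f, hf⟩ := iInf_lt_iff.1 hlt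
    obtain ⟨hfT, hf⟩ := iInf_lt_iff.1 hf
    exact ⟨f, hfT, hf⟩
  choose f hfT hfl using hseq
  set L : ℝ := l.toReal + 1 with hL
  have hL0 : 0 ≤ L := by positivity
  have hfL : ∀ n, eVariationOn (f n) (Icc a b) ≤ ENNReal.ofReal L := by
    intro n
    refine (hfl n).le.trans ?_
    rw [hL, ENNReal.ofReal_add ENNReal.toReal_nonneg zero_le_one, ENNReal.ofReal_toReal hltop,
      ENNReal.ofReal_one]
    gcongr
    exact ENNReal.inv_le_one.2 le_add_self
  choose g hgd hga hgb hgS hgv using fun n =>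
    exists_lipschitz_reparametrization hab (hfT n).1 hL0 (hfL n)
  have hga' : ∀ n, g n a = p := fun n => (hga n).trans (hfT n).2.2.1
  have hgb' : ∀ n, g n b = q := fun n => (hgb n).trans (hfT n).2.2.2
  have hgS' : ∀ n, ∀ t ∈ Icc a b, g n t ∈ S := by
    intro n t ht
    obtain ⟨s, hs, h⟩ := hgS n ht
    rw [← h]
    exact (hfT n).2.1 hs
  have hba : 0 < b - a := sub_pos.2 hab
  let U : Ultrafilter ℕ := Filter.hyperfilter ℕ
  -- all curves start at `p`, so each point of time has its images in a compact ball
  have hlim : ∀ t : ℝ, ∃ x : E, t ∈ Icc a b → Tendsto (fun n => g n t) U (𝓝 x) := by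
    intro t
    by_cases ht : t ∈ Icc a b
    · have hc : IsCompact (Metric.closedBall p (L / (b - a) * |t - a|)) :=
        isCompact_closedBall _ _
      have hmem : ∀ n, g n t ∈ Metric.closedBall p (L / (b - a) * |t - a|) := by
        intro n
        rw [Metric.mem_closedBall, ← hga' n]
        exact hgd n t ht a ha
      obtain ⟨x, -, hx⟩ := hc.ultrafilter_le_nhds (U.map fun n => g n t)
        (by
          rw [Ultrafilter.coe_map, le_principal_iff, mem_map]
          exact Filter.univ_mem' hmem)
      exact ⟨x, fun _ => hx⟩
    · exact ⟨p, fun h => absurd h ht⟩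
  choose F hF using hlim
  have hFd : ∀ s ∈ Icc a b, ∀ t ∈ Icc a b, dist (F s) (F t) ≤ L / (b - a) * |s - t| :=
    fun s hs t ht => le_of_tendsto ((hF s hs).dist (hF t ht))
      (Eventually.of_forall fun n => hgd n s hs t ht)
  have hFl : eVariationOn F (Icc a b) ≤ l := by
    refine le_of_forall_gt_imp_ge_of_dense fun v hv => ?_
    by_contra hlt
    have h1 := eVariationOn.lowerSemicontinuous_aux hF (not_le.1 hlt)
    have h2 : Tendsto (fun n : ℕ => l + ((n : ℝ≥0∞) + 1)⁻¹) U (𝓝 (l + 0)) := by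
      refine Tendsto.const_add _ ?_
      have h3 : Tendsto (fun n : ℕ => (((n + 1 : ℕ) : ℝ≥0∞))⁻¹) atTop (𝓝 0) :=
        ENNReal.tendsto_inv_nat_nhds_zero.comp (tendsto_add_atTop_nat 1)
      simp only [Nat.cast_add, Nat.cast_one] at h3
      exact h3.mono_left Nat.hyperfilter_le_atTop
    rw [add_zero] at h2
    obtain ⟨n, hn1, hn2⟩ := (h1.and (h2.eventually_lt_const hv)).exists
    exact absurd (hn1.trans_le ((hgv n).trans (hfl n).le)) hn2.not_gt
  refine ⟨F, ?_, ne_top_of_le_ne_top hltop hFl, ?_, ?_, ?_, ?_⟩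
  · have hLip : LipschitzOnWith (Real.toNNReal (L / (b - a))) F (Icc a b) := by
      refine LipschitzOnWith.of_dist_le_mul fun s hs t ht => ?_
      rw [Real.coe_toNNReal _ (div_nonneg hL0 hba.le), Real.dist_eq]
      exact hFd s hs t ht
    exact hLip.continuousOn
  · intro t ht
    exact hS.mem_of_tendsto (hF t ht) (Eventually.of_forall fun n => hgS' n t ht)
  · refine tendsto_nhds_unique (hF a ha) ?_
    simp only [hga']
    exact tendsto_const_nhds
  · refine tendsto_nhds_unique (hF b hb) ?_
    simp only [hgb']
    exact tendsto_const_nhds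
  · intro η h1 h2 h3 h4
    exact hFl.trans (hlle η ⟨h1, h2, h3, h4⟩)

/-! ### Plane vectors and support functions -/

/-- The determinant of two plane vectors. -/
def cross (x y : Plane) : ℝ := x 0 * y 1 - x 1 * y 0

/-- Rotation by a quarter turn counter-clockwise. -/
def rot (x : Plane) : Plane := !₂[-x 1, x 0]

@[simp] theorem rot_zero_apply (x : Plane) : rot x 0 = -x 1 := rfl
@[simp] theorem rot_one_apply (x : Plane) : rot x 1 = x 0 := rfl
@[simp] theorem unitDir_zero_apply (θ : ℝ) : unitDir θ 0 = Real.cos θ := rfl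
@[simp] theorem unitDir_one_apply (θ : ℝ) : unitDir θ 1 = Real.sin θ := rfl

theorem plane_ext {x y : Plane} (h0 : x 0 = y 0) (h1 : x 1 = y 1) : x = y := by
  ext i
  fin_cases i
  · exact h0
  · exact h1

theorem plane_inner (x y : Plane) : inner ℝ x y = x 0 * y 0 + x 1 * y 1 := by
  simp [PiLp.inner_apply, Fin.sum_univ_two]
  ring

theorem unitDir_add_pi (θ : ℝ) : unitDir (θ + Real.pi) = -unitDir θ :=
  plane_ext (by simp) (by simp)

theorem unitDir_pi_add (θ : ℝ) : unitDir (Real.pi + θ) = -unitDir θ := by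
  rw [add_comm, unitDir_add_pi]

theorem unitDir_add_two_pi_mul_int (θ : ℝ) (n : ℤ) :
    unitDir (θ + n * (2 * Real.pi)) = unitDir θ :=
  plane_ext (by simp [Real.cos_add_int_mul_two_pi]) (by simp [Real.sin_add_int_mul_two_pi])

theorem unitDir_add_two_pi (θ : ℝ) : unitDir (θ + 2 * Real.pi) = unitDir θ := by
  have := unitDir_add_two_pi_mul_int θ 1
  rwa [Int.cast_one, one_mul] at this

theorem inner_unitDir_unitDir (a b : ℝ) : inner ℝ (unitDir a) (unitDir b) = Real.cos (b - a) := by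
  rw [plane_inner, Real.cos_sub]
  simp
  ring

theorem cross_unitDir_unitDir (a b : ℝ) : cross (unitDir a) (unitDir b) = Real.sin (b - a) := by
  rw [cross, Real.sin_sub]
  simp
  ring

theorem rot_unitDir (a : ℝ) : rot (unitDir a) = unitDir (a + Real.pi / 2) :=
  plane_ext (by simp [Real.cos_add_pi_div_two]) (by simp [Real.sin_add_pi_div_two])

theorem unitDir_ne_zero (θ : ℝ) : unitDir θ ≠ 0 := by
  intro h
  have h0 : Real.cos θ = 0 := by simpa using congrArg (fun v : Plane => v 0) h
  have h1 : Real.sin θ = 0 := by simpa using congrArg (fun v : Plane => v 1) h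
  have := Real.sin_sq_add_cos_sq θ
  rw [h0, h1] at this
  norm_num at this

theorem continuous_unitDir : Continuous unitDir := by
  have h : Continuous fun θ : ℝ => (![Real.cos θ, Real.sin θ] : Fin 2 → ℝ) := by
    refine continuous_pi fun i => ?_
    fin_cases i
    · exact Real.continuous_cos
    · exact Real.continuous_sin
  exact (PiLp.continuous_toLp 2 _).comp h

theorem exists_add_int_mul_two_pi_mem_Ico (θ c : ℝ) :
    ∃ θ' : ℝ, c ≤ θ' ∧ θ' < c + 2 * Real.pi ∧ ∃ n : ℤ, θ' = θ + n * (2 * Real.pi) := by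
  have hm := toIcoMod_mem_Ico Real.two_pi_pos c θ
  refine ⟨toIcoMod Real.two_pi_pos c θ, hm.1, hm.2, -toIcoDiv Real.two_pi_pos c θ, ?_⟩
  rw [← self_sub_toIcoDiv_zsmul Real.two_pi_pos c θ, zsmul_eq_mul]
  push_cast
  ring

theorem exists_unitDir_mem_Ico (v : Plane) (hv : v ≠ 0) (c : ℝ) :
    ∃ r θ : ℝ, 0 < r ∧ c ≤ θ ∧ θ < c + 2 * Real.pi ∧ v = r • unitDir θ := by
  let z : ℂ := ⟨v 0, v 1⟩
  have hz : z ≠ 0 := by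
    intro h
    apply hv
    exact plane_ext (by simpa [z] using congrArg Complex.re h)
      (by simpa [z] using congrArg Complex.im h)
  have hc : ‖z‖ * Real.cos z.arg = v 0 := Complex.norm_mul_cos_arg z
  have hs : ‖z‖ * Real.sin z.arg = v 1 := Complex.norm_mul_sin_arg z
  obtain ⟨θ, h1, h2, n, rfl⟩ := exists_add_int_mul_two_pi_mem_Ico z.arg c
  refine ⟨‖z‖, _, norm_pos_iff.2 hz, h1, h2, ?_⟩
  rw [unitDir_add_two_pi_mul_int]
  exact plane_ext (by simp [hc]) (by simp [hs])

theorem reach_eq (S : Set Plane) (θ : ℝ) :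
    reach S θ = sSup ((fun p : Plane => inner ℝ p (unitDir θ)) '' S) := by
  simp only [reach, plane_inner, unitDir_zero_apply, unitDir_one_apply]

theorem reach_le {S : Set Plane} (hS : S.Nonempty) {θ c : ℝ}
    (h : ∀ x ∈ S, inner ℝ x (unitDir θ) ≤ c) : reach S θ ≤ c := by
  rw [reach_eq]
  refine csSup_le (hS.image _) ?_
  rintro _ ⟨x, hx, rfl⟩
  exact h x hx

theorem bddAbove_inner_image {S : Set Plane} (hS : Bornology.IsBounded S) (u : Plane) :
    BddAbove ((fun p : Plane => inner ℝ p u) '' S) := by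
  obtain ⟨R, hR⟩ := hS.exists_norm_le
  refine ⟨R * ‖u‖, ?_⟩
  rintro _ ⟨x, hx, rfl⟩
  exact (real_inner_le_norm x u).trans (mul_le_mul_of_nonneg_right (hR x hx) (norm_nonneg _))

theorem inner_le_reach {S : Set Plane} (hS : Bornology.IsBounded S) {x : Plane} (hx : x ∈ S)
    (θ : ℝ) : inner ℝ x (unitDir θ) ≤ reach S θ := by
  rw [reach_eq]
  exact le_csSup (bddAbove_inner_image hS _) ⟨x, hx, rfl⟩

theorem reach_congr_angle (S : Set Plane) {θ φ : ℝ} (h : unitDir θ = unitDir φ) :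
    reach S θ = reach S φ := by
  rw [reach_eq, reach_eq, h]

theorem reach_add {S T : Set Plane} (hS : S.Nonempty) (hT : T.Nonempty)
    (hSb : Bornology.IsBounded S) (hTb : Bornology.IsBounded T) (θ : ℝ) :
    reach (S + T) θ = reach S θ + reach T θ := by
  refine le_antisymm (reach_le (hS.add hT) ?_) ?_
  · rintro _ ⟨x, hx, y, hy, rfl⟩
    rw [inner_add_left]
    exact add_le_add (inner_le_reach hSb hx θ) (inner_le_reach hTb hy θ)
  · rw [← le_sub_iff_add_le]
    refine reach_le hS fun x hx => ?_
    rw [le_sub_comm]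
    refine reach_le hT fun y hy => ?_
    rw [le_sub_iff_add_le, add_comm, ← inner_add_left]
    exact inner_le_reach (hSb.add hTb) (add_mem_add hx hy) θ

theorem reach_placement {S : Set Plane} (hS : S.Nonempty) (hSb : Bornology.IsBounded S)
    (z : Plane) (θ : ℝ) : reach (placement S z) θ = inner ℝ z (unitDir θ) + reach S θ := by
  have h : placement S z = {z} + S := by rw [placement, singleton_add]
  have h1 : reach {z} θ = inner ℝ z (unitDir θ) := by rw [reach_eq]; simp
  rw [h, reach_add (singleton_nonempty z) hS Bornology.isBounded_singleton hSb, h1]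

theorem inner_segment_le {p q x u : Plane} (hx : x ∈ segment ℝ p q) :
    inner ℝ x u ≤ max (inner ℝ p u) (inner ℝ q u) := by
  obtain ⟨a, b, ha, hb, hab, rfl⟩ := hx
  rw [inner_add_left, real_inner_smul_left, real_inner_smul_left]
  have h1 := mul_le_mul_of_nonneg_left (le_max_left (inner ℝ p u) (inner ℝ q u)) ha
  have h2 := mul_le_mul_of_nonneg_left (le_max_right (inner ℝ p u) (inner ℝ q u)) hb
  calc _ ≤ (a + b) * max (inner ℝ p u) (inner ℝ q u) := by linarith
    _ = _ := by rw [hab, one_mul]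

theorem isBounded_segment (p q : Plane) : Bornology.IsBounded (segment ℝ p q) := by
  rw [← convexHull_pair]
  exact isBounded_convexHull.2 (Set.toFinite _).isBounded

theorem reach_segment (p q : Plane) (θ : ℝ) : reach (segment ℝ p q) θ =
    max (inner ℝ p (unitDir θ)) (inner ℝ q (unitDir θ)) := by
  refine le_antisymm (reach_le ⟨p, left_mem_segment ℝ p q⟩ fun x hx => inner_segment_le hx) ?_
  exact max_le (inner_le_reach (isBounded_segment p q) (left_mem_segment ℝ p q) θ)
    (inner_le_reach (isBounded_segment p q) (right_mem_segment ℝ p q) θ)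

/-- A nonzero linear functional attains no maximum in the interior of a set. -/
theorem inner_lt_of_mem_interior {S : Set Plane} {u : Plane} (hu : u ≠ 0) {c : ℝ}
    (h : ∀ x ∈ S, inner ℝ x u ≤ c) {x : Plane} (hx : x ∈ interior S) : inner ℝ x u < c := by
  have h1 : Tendsto (fun t : ℝ => x + t • u) (𝓝[>] 0) (𝓝 x) := by
    have : Tendsto (fun t : ℝ => x + t • u) (𝓝 0) (𝓝 (x + (0 : ℝ) • u)) :=
      (Continuous.tendsto (by fun_prop) 0)
    rw [zero_smul, add_zero] at this
    exact this.mono_left nhdsWithin_le_nhds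
  obtain ⟨t, ht, ht0⟩ := ((h1.eventually_mem (mem_interior_iff_mem_nhds.1 hx)).and
    self_mem_nhdsWithin).exists
  have h2 := h _ ht
  rw [inner_add_left, real_inner_smul_left] at h2
  have h3 : 0 < inner ℝ u u := real_inner_self_pos.2 hu
  have h4 : 0 < t * inner ℝ u u := mul_pos ht0 h3
  linarith

/-- Passing to the boundary of the convex hull does not change the support function: a point of the
set where the functional is maximal lies on the boundary. -/
theorem reach_frontier_convexHull {S : Set Plane} (hS : IsCompact S) (hne : S.Nonempty) (θ : ℝ) :
    reach (frontier (convexHull ℝ S)) θ = reach S θ := by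
  have hb : Bornology.IsBounded (convexHull ℝ S) := isBounded_convexHull.2 hS.isBounded
  have hle : ∀ x ∈ convexHull ℝ S, inner ℝ x (unitDir θ) ≤ reach S θ := by
    have hc : Convex ℝ {x : Plane | inner ℝ x (unitDir θ) ≤ reach S θ} := by
      intro x hx y hy a b ha hb hab
      exact (inner_segment_le ⟨a, b, ha, hb, hab, rfl⟩).trans (max_le hx hy)
    exact convexHull_min (fun x hx => inner_le_reach hS.isBounded hx θ) hc
  obtain ⟨x, hx, hmax⟩ := hS.exists_isMaxOn hne
    (f := fun x : Plane => inner ℝ x (unitDir θ)) (by fun_prop)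
  have hxr : reach S θ ≤ inner ℝ x (unitDir θ) := reach_le hne fun y hy => hmax hy
  have hxf : x ∈ frontier (convexHull ℝ S) := by
    refine ⟨subset_closure (subset_convexHull ℝ S hx), fun hxi => ?_⟩
    exact absurd (inner_lt_of_mem_interior (unitDir_ne_zero θ) hle hxi) (not_lt.2 hxr)
  refine le_antisymm (reach_le ⟨x, hxf⟩ fun y hy => ?_)
    (hxr.trans (inner_le_reach (hb.closure.subset frontier_subset_closure) hxf θ))
  have hcl : IsClosed {x : Plane | inner ℝ x (unitDir θ) ≤ reach S θ} :=
    isClosed_le (by fun_prop) continuous_const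
  exact closure_minimal hle hcl hy.1

/-! ### Robots, viability and corridors -/

namespace IsRobot

variable {A B : Set Plane}

theorem nonempty (hA : IsRobot A) : A.Nonempty := hA.interior_nonempty.mono interior_subset

theorem neg_eq (hA : IsRobot A) : -A = A := by
  ext x
  rw [Set.mem_neg]
  exact ⟨fun h => by simpa using hA.symmetric _ h, hA.symmetric x⟩

theorem neg_mem_interior (hA : IsRobot A) {x : Plane} (hx : x ∈ interior A) : -x ∈ interior A := by
  have h : interior (-A) = -interior A := ((Homeomorph.neg Plane).preimage_interior A).symm
  rw [hA.neg_eq] at h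
  rw [h]
  simpa using hx

theorem zero_mem_interior (hA : IsRobot A) : (0 : Plane) ∈ interior A := by
  obtain ⟨x, hx⟩ := hA.interior_nonempty
  have := hA.convex.interior hx (hA.neg_mem_interior hx) (a := 1 / 2) (b := 1 / 2)
    (by norm_num) (by norm_num) (by norm_num)
  simpa using this

theorem add (hA : IsRobot A) (hB : IsRobot B) : IsRobot (A + B) where
  convex := hA.convex.add hB.convex
  symmetric := by
    rintro _ ⟨a, ha, b, hb, rfl⟩
    exact ⟨-a, hA.symmetric a ha, -b, hB.symmetric b hb, by simp [add_comm]⟩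
  bounded := hA.bounded.add hB.bounded
  interior_nonempty := by
    obtain ⟨b, hb⟩ := hB.nonempty
    obtain ⟨a, ha⟩ := hA.interior_nonempty
    exact ⟨a + b, (isOpen_interior.add_right (t := B)).subset_interior_iff.2
      (add_subset_add_right interior_subset) (add_mem_add ha hb)⟩

theorem subset_closure_interior (hA : IsRobot A) : A ⊆ closure (interior A) := by
  rw [hA.convex.closure_interior_eq_closure_of_nonempty_interior hA.interior_nonempty]
  exact subset_closure

end IsRobot

theorem closure_add_closure_subset (S T : Set Plane) : closure S + closure T ⊆ closure (S + T) := by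
  rintro _ ⟨x, hx, y, hy, rfl⟩
  exact map_mem_closure₂ continuous_add hx hy fun a ha b hb => add_mem_add ha hb

/-- If `T` lies in the closure of an open convex set, its interior lies in that set. -/
theorem interior_subset_of_subset_closure {T U : Set Plane} (hU : IsOpen U) (hc : Convex ℝ U)
    (hne : U.Nonempty) (h : T ⊆ closure U) : interior T ⊆ U := by
  refine (interior_mono h).trans ?_
  rw [hc.interior_closure_eq_interior_of_nonempty_interior (by rwa [hU.interior_eq]),
    hU.interior_eq]

theorem interior_add_eq {A B : Set Plane} (hA : IsRobot A) (hB : IsRobot B) :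
    interior (A + B) = interior A + interior B := by
  refine Subset.antisymm ?_ ?_
  · refine interior_subset_of_subset_closure isOpen_interior.add_right
      (hA.convex.interior.add hB.convex.interior)
      (hA.interior_nonempty.add hB.interior_nonempty) ?_
    exact (add_subset_add hA.subset_closure_interior hB.subset_closure_interior).trans
      (closure_add_closure_subset _ _)
  · exact isOpen_interior.add_right.subset_interior_iff.2
      (add_subset_add interior_subset interior_subset)

theorem interior_placement (A : Set Plane) (a : Plane) :
    interior (placement A a) = (fun x => a + x) '' interior A :=
  ((Homeomorph.addLeft a).image_interior A).symm

theorem isViable_iff {A B : Set Plane} (hA : IsRobot A) (hB : IsRobot B) (a b : Plane) :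
    IsViable A B a b ↔ a - b ∉ interior (A + B) := by
  rw [IsViable, interior_placement, interior_placement, interior_add_eq hA hB,
    Set.disjoint_left]
  constructor
  · rintro h ⟨x, hx, y, hy, hxy⟩
    refine h ⟨-x, hA.neg_mem_interior hx, rfl⟩ ⟨y, hy, ?_⟩
    have : x + y = a - b := hxy
    change b + y = a + -x
    rw [show a = b + (x + y) by rw [this]; abel]
    abel
  · rintro h _ ⟨x, hx, rfl⟩ ⟨y, hy, hxy⟩
    refine h ⟨-x, hA.neg_mem_interior hx, y, hy, ?_⟩
    have : b + y = a + x := hxy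
    change -x + y = a - b
    rw [show a = b + y - x by rw [this]; abel]
    abel

theorem mem_openCorridor_iff {K : Set Plane} (hK : IsRobot K) (p q x : Plane) :
    x ∈ openCorridor K p q ↔ ∃ z ∈ segment ℝ p q, x - z ∈ interior K := by
  constructor
  · intro h
    have : interior (segment ℝ p q + K) ⊆ segment ℝ p q + interior K := by
      refine interior_subset_of_subset_closure isOpen_interior.add_left
        ((convex_segment p q).add hK.convex.interior)
        (Set.Nonempty.add ⟨p, left_mem_segment ℝ p q⟩ hK.interior_nonempty) ?_
      exact (add_subset_add subset_closure hK.subset_closure_interior).trans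
        (closure_add_closure_subset _ _)
    obtain ⟨z, hz, k, hk, rfl⟩ := this h
    exact ⟨z, hz, by simpa using hk⟩
  · rintro ⟨z, hz, hk⟩
    refine (isOpen_interior.add_left (s := segment ℝ p q)).subset_interior_iff.2
      (add_subset_add_left interior_subset) ⟨z, hz, x - z, hk, by simp⟩

/-- The directions in which a point is separated most from a robot. -/
def IsDirection (K : Set Plane) (x : Plane) (θ : ℝ) : Prop :=
  ∀ φ : ℝ, inner ℝ x (unitDir φ) - reach K φ ≤ inner ℝ x (unitDir θ) - reach K θ

theorem isOrientation_iff {A B : Set Plane} (hA : IsRobot A) (hB : IsRobot B) (a b : Plane)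
    (θ : ℝ) : IsOrientation A B a b θ ↔ IsDirection (A + B) (a - b) θ := by
  have h : ∀ φ, separation A B a b φ = inner ℝ (a - b) (unitDir φ) - reach (A + B) φ := by
    intro φ
    rw [separation, reach_placement hA.nonempty hA.bounded,
      reach_placement hB.nonempty hB.bounded,
      reach_add hA.nonempty hB.nonempty hA.bounded hB.bounded, inner_sub_left]
    ring
  simp only [IsOrientation, IsDirection, h]

/-! ### Directions of maximal separation along a curve -/

theorem continuous_reach {K : Set Plane} (hK : Bornology.IsBounded K) (hne : K.Nonempty) :
    Continuous (reach K) := by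
  obtain ⟨R, hR⟩ := hK.exists_norm_le
  have key : ∀ θ φ, reach K θ ≤ reach K φ + R * ‖unitDir θ - unitDir φ‖ := by
    intro θ φ
    refine reach_le hne fun x hx => ?_
    have h1 : inner ℝ x (unitDir θ) =
        inner ℝ x (unitDir φ) + inner ℝ x (unitDir θ - unitDir φ) := by
      rw [inner_sub_right]; ring
    rw [h1]
    refine add_le_add (inner_le_reach hK hx φ) ((real_inner_le_norm _ _).trans ?_)
    exact mul_le_mul_of_nonneg_right (hR x hx) (norm_nonneg _)
  rw [continuous_iff_continuousAt]
  intro φ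
  have h0 : Tendsto (fun θ => R * ‖unitDir θ - unitDir φ‖) (𝓝 φ) (𝓝 0) := by
    have : Tendsto (fun θ => R * ‖unitDir θ - unitDir φ‖) (𝓝 φ)
        (𝓝 (R * ‖unitDir φ - unitDir φ‖)) :=
      Continuous.tendsto (continuous_const.mul (continuous_unitDir.sub continuous_const).norm) φ
    simpa using this
  have h1 : Tendsto (fun θ => reach K φ + R * ‖unitDir θ - unitDir φ‖) (𝓝 φ) (𝓝 (reach K φ)) := by
    simpa using tendsto_const_nhds.add h0
  have h2 : Tendsto (fun θ => reach K φ - R * ‖unitDir θ - unitDir φ‖) (𝓝 φ) (𝓝 (reach K φ)) := by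
    simpa using tendsto_const_nhds.sub h0
  refine tendsto_of_tendsto_of_tendsto_of_le_of_le h2 h1 (fun θ => ?_) (fun θ => key θ φ)
  have := key φ θ
  rw [norm_sub_rev] at this
  simp only
  linarith

theorem IsDirection.congr {K : Set Plane} {x : Plane} {θ φ : ℝ} (h : IsDirection K x θ)
    (hθ : unitDir θ = unitDir φ) : IsDirection K x φ := by
  intro ψ
  have := h ψ
  rwa [hθ, reach_congr_angle K hθ] at this

theorem exists_isDirection_mem_Ico {K : Set Plane} (hK : Bornology.IsBounded K) (hne : K.Nonempty)
    (x : Plane) (c : ℝ) : ∃ θ, c ≤ θ ∧ θ < c + 2 * Real.pi ∧ IsDirection K x θ := by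
  have hcont : Continuous fun θ => inner ℝ x (unitDir θ) - reach K θ :=
    (continuous_const.inner continuous_unitDir).sub (continuous_reach hK hne)
  obtain ⟨θ, -, hθ⟩ := (isCompact_Icc (a := c) (b := c + 2 * Real.pi)).exists_isMaxOn
    ⟨c, left_mem_Icc.2 (by linarith [Real.pi_pos])⟩ hcont.continuousOn
  have hdir : IsDirection K x θ := by
    intro φ
    obtain ⟨φ', h1, h2, n, rfl⟩ := exists_add_int_mul_two_pi_mem_Ico φ c
    have h3 := hθ ⟨h1, h2.le⟩
    simp only [mem_ofPred_eq] at h3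
    rw [unitDir_add_two_pi_mul_int,
      reach_congr_angle K (unitDir_add_two_pi_mul_int φ n)] at h3
    exact h3
  obtain ⟨θ', h1, h2, n, rfl⟩ := exists_add_int_mul_two_pi_mem_Ico θ c
  exact ⟨_, h1, h2, hdir.congr (unitDir_add_two_pi_mul_int θ n).symm⟩

theorem exists_separating {O : Set Plane} (hO : IsOpen O) (hc : Convex ℝ O) (hne : O.Nonempty)
    {x : Plane} (hx : x ∉ O) : ∃ n : Plane, n ≠ 0 ∧ ∀ k ∈ O, inner ℝ k n ≤ inner ℝ x n := by
  obtain ⟨f, hf⟩ := geometric_hahn_banach_open_point hc hO hx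
  have hfi : ∀ y, f y = inner ℝ y ((InnerProductSpace.toDual ℝ Plane).symm f) := by
    intro y
    rw [real_inner_comm, InnerProductSpace.toDual_symm_apply]
  refine ⟨(InnerProductSpace.toDual ℝ Plane).symm f, ?_, fun k hk => ?_⟩
  · rintro h
    obtain ⟨k, hk⟩ := hne
    have := hf k hk
    rw [hfi, hfi, h] at this
    simp at this
  · rw [← hfi, ← hfi]
    exact (hf k hk).le

theorem reach_le_of_forall_interior {K : Set Plane} (hK : IsRobot K) {θ c : ℝ}
    (h : ∀ k ∈ interior K, inner ℝ k (unitDir θ) ≤ c) : reach K θ ≤ c := by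
  refine reach_le hK.nonempty fun x hx => ?_
  have hcl : IsClosed {x : Plane | inner ℝ x (unitDir θ) ≤ c} :=
    isClosed_le (by fun_prop) continuous_const
  exact closure_minimal h hcl (hK.subset_closure_interior hx)

theorem inner_lt_reach {K : Set Plane} (hK : IsRobot K) {x : Plane} (hx : x ∈ interior K)
    (θ : ℝ) : inner ℝ x (unitDir θ) < reach K θ :=
  inner_lt_of_mem_interior (unitDir_ne_zero θ) (fun _ hy => inner_le_reach hK.bounded hy θ) hx

theorem reach_pos {K : Set Plane} (hK : IsRobot K) (θ : ℝ) : 0 < reach K θ := by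
  have := inner_lt_reach hK hK.zero_mem_interior θ
  rwa [inner_zero_left] at this

theorem IsDirection.reach_le {K : Set Plane} (hK : IsRobot K) {x : Plane} (hx : x ∉ interior K)
    {θ : ℝ} (h : IsDirection K x θ) : reach K θ ≤ inner ℝ x (unitDir θ) := by
  obtain ⟨n, hn, hsep⟩ :=
    exists_separating isOpen_interior hK.convex.interior hK.interior_nonempty hx
  obtain ⟨r, φ, hr, -, -, rfl⟩ := exists_unitDir_mem_Ico n hn 0
  have h1 : reach K φ ≤ inner ℝ x (unitDir φ) := by
    refine reach_le_of_forall_interior hK fun k hk => ?_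
    have := hsep k hk
    rw [real_inner_smul_right, real_inner_smul_right] at this
    exact le_of_mul_le_mul_left this hr
  have := h φ
  linarith

/-- A unit vector between two directions less than a half turn apart, as a combination. -/
theorem sin_smul_unitDir (α β γ : ℝ) : Real.sin (γ - α) • unitDir β =
    Real.sin (γ - β) • unitDir α + Real.sin (β - α) • unitDir γ := by
  refine plane_ext ?_ ?_
  · simp only [PiLp.smul_apply, PiLp.add_apply, unitDir_zero_apply, smul_eq_mul, Real.sin_sub]
    ring
  · simp only [PiLp.smul_apply, PiLp.add_apply, unitDir_one_apply, smul_eq_mul, Real.sin_sub]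
    ring

theorem sin_mul_reach_le {K : Set Plane} (hK : Bornology.IsBounded K) (hne : K.Nonempty)
    {α β γ : ℝ} (h0 : 0 < Real.sin (γ - α)) (h1 : 0 ≤ Real.sin (γ - β))
    (h2 : 0 ≤ Real.sin (β - α)) : Real.sin (γ - α) * reach K β ≤
      Real.sin (γ - β) * reach K α + Real.sin (β - α) * reach K γ := by
  rw [← le_div_iff₀' h0]
  refine reach_le hne fun x hx => ?_
  rw [le_div_iff₀' h0, ← real_inner_smul_right, sin_smul_unitDir α β γ, inner_add_right,
    real_inner_smul_right, real_inner_smul_right]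
  exact add_le_add (mul_le_mul_of_nonneg_left (inner_le_reach hK hx α) h1)
    (mul_le_mul_of_nonneg_left (inner_le_reach hK hx γ) h2)

theorem sin_mul_inner (x : Plane) (α β γ : ℝ) : Real.sin (γ - α) * inner ℝ x (unitDir β) =
    Real.sin (γ - β) * inner ℝ x (unitDir α) + Real.sin (β - α) * inner ℝ x (unitDir γ) := by
  rw [← real_inner_smul_right, sin_smul_unitDir α β γ, inner_add_right,
    real_inner_smul_right, real_inner_smul_right]

/-- The directions in which a point is separated from a robot form a convex cone. -/
theorem reach_le_inner_of_between {K : Set Plane} (hK : IsRobot K) {x : Plane} {α β γ : ℝ}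
    (hαβ : α ≤ β) (hβγ : β ≤ γ) (hγ : γ < α + Real.pi)
    (hα : reach K α ≤ inner ℝ x (unitDir α)) (hγ' : reach K γ ≤ inner ℝ x (unitDir γ)) :
    reach K β ≤ inner ℝ x (unitDir β) := by
  rcases hαβ.eq_or_lt with rfl | h1
  · exact hα
  rcases hβγ.eq_or_lt with rfl | h2
  · exact hγ'
  have s0 : 0 < Real.sin (γ - α) := Real.sin_pos_of_pos_of_lt_pi (by linarith) (by linarith)
  have s1 : 0 < Real.sin (γ - β) := Real.sin_pos_of_pos_of_lt_pi (by linarith) (by linarith)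
  have s2 : 0 < Real.sin (β - α) := Real.sin_pos_of_pos_of_lt_pi (by linarith) (by linarith)
  have h3 := sin_mul_reach_le hK.bounded hK.nonempty s0 s1.le s2.le
  have h4 := sin_mul_inner x α β γ
  nlinarith [mul_le_mul_of_nonneg_left hα s1.le, mul_le_mul_of_nonneg_left hγ' s2.le]

/-- For a point outside the interior of a robot, the directions of maximal separation form a convex
cone: the separation is concave and nonnegative there. -/
theorem IsDirection.between {K : Set Plane} (hK : IsRobot K) {x : Plane} (hx : x ∉ interior K)
    {α β γ : ℝ} (hαβ : α ≤ β) (hβγ : β ≤ γ) (hγ : γ < α + Real.pi)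
    (hα : IsDirection K x α) (hγ' : IsDirection K x γ) : IsDirection K x β := by
  rcases hαβ.eq_or_lt with rfl | h1
  · exact hα
  rcases hβγ.eq_or_lt with rfl | h2
  · exact hγ'
  have s0 : 0 < Real.sin (γ - α) := Real.sin_pos_of_pos_of_lt_pi (by linarith) (by linarith)
  have s1 : 0 < Real.sin (γ - β) := Real.sin_pos_of_pos_of_lt_pi (by linarith) (by linarith)
  have s2 : 0 < Real.sin (β - α) := Real.sin_pos_of_pos_of_lt_pi (by linarith) (by linarith)
  have h3 := sin_mul_reach_le hK.bounded hK.nonempty s0 s1.le s2.le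
  have h4 := sin_mul_inner x α β γ
  have hm := hα.reach_le hK hx
  set m := inner ℝ x (unitDir α) - reach K α with hmdef
  have hm' : inner ℝ x (unitDir γ) - reach K γ = m := le_antisymm (hα γ) (hγ' α)
  have hs : Real.sin (γ - α) ≤ Real.sin (γ - β) + Real.sin (β - α) := by
    have : Real.sin (γ - α) = Real.sin (γ - β) * Real.cos (β - α) +
        Real.cos (γ - β) * Real.sin (β - α) := by
      rw [← Real.sin_add]; congr 1; ring
    rw [this]
    nlinarith [Real.cos_le_one (β - α), Real.cos_le_one (γ - β)]
  have h5 : m ≤ inner ℝ x (unitDir β) - reach K β := by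
    have h6 : Real.sin (γ - α) * m ≤
        Real.sin (γ - α) * (inner ℝ x (unitDir β) - reach K β) := by
      have e1 : inner ℝ x (unitDir α) = m + reach K α := by rw [hmdef]; ring
      have e2 : inner ℝ x (unitDir γ) = m + reach K γ := by rw [← hm']; ring
      rw [e1, e2] at h4
      have hm0 : 0 ≤ m := by rw [hmdef]; linarith
      nlinarith [mul_le_mul_of_nonneg_right hs hm0]
    exact le_of_mul_le_mul_left h6 s0
  intro φ
  exact (hα φ).trans h5

/-- An intermediate value theorem for the directions of maximal separation along a curve outside the
interior of the robot. A curve that never gets beyond the robot in the direction `σ` does not have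
the direction `σ`, so the circle of directions can be cut open there, and all directions between the
first and the last one occur. The set of times with a direction in a given interval is closed;
as the interval of times is connected, some time has directions on both sides of `θ`, and then it has
`θ` by convexity. -/
theorem exists_isDirection_of_mem_uIcc {K : Set Plane} (hK : IsRobot K) {x : ℝ → Plane} {a b : ℝ}
    (hab : a ≤ b) (hx : ContinuousOn x (Icc a b)) (hout : ∀ t ∈ Icc a b, x t ∉ interior K)
    {σ : ℝ} (hσ : ∀ t ∈ Icc a b, inner ℝ (x t) (unitDir σ) < reach K σ) {θa θb θ : ℝ}
    (hθa : IsDirection K (x a) θa) (hθb : IsDirection K (x b) θb)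
    (ha : σ < θa ∧ θa < σ + 2 * Real.pi) (hb : σ < θb ∧ θb < σ + 2 * Real.pi)
    (hθ : θ ∈ uIcc θa θb) : ∃ t ∈ Icc a b, IsDirection K (x t) θ := by
  have hcont : ContinuousOn (fun z : ℝ × ℝ => inner ℝ (x z.1) (unitDir z.2) - reach K z.2)
      (Icc a b ×ˢ univ) := by
    refine ContinuousOn.sub (ContinuousOn.inner ?_ ?_) ?_
    · exact hx.comp continuousOn_fst fun z hz => hz.1
    · exact (continuous_unitDir.comp continuous_snd).continuousOn
    · exact ((continuous_reach hK.bounded hK.nonempty).comp continuous_snd).continuousOn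
  have hclosed : ∀ c d : ℝ, IsClosed {t | t ∈ Icc a b ∧ ∃ ψ ∈ Icc c d, IsDirection K (x t) ψ} := by
    intro c d
    have hset : IsCompact {z : ℝ × ℝ | z ∈ Icc a b ×ˢ Icc c d ∧ IsDirection K (x z.1) z.2} := by
      have hcomp : IsCompact (Icc a b ×ˢ Icc c d) := isCompact_Icc.prod isCompact_Icc
      refine hcomp.of_isClosed_subset ?_ fun z hz => hz.1
      have : {z : ℝ × ℝ | z ∈ Icc a b ×ˢ Icc c d ∧ IsDirection K (x z.1) z.2} =
          ⋂ φ : ℝ, {z : ℝ × ℝ | z ∈ Icc a b ×ˢ Icc c d ∧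
            inner ℝ (x z.1) (unitDir φ) - reach K φ ≤
              inner ℝ (x z.1) (unitDir z.2) - reach K z.2} := by
        ext z
        simp only [mem_ofPred_eq, mem_iInter]
        exact ⟨fun h φ => ⟨h.1, h.2 φ⟩, fun h => ⟨(h 0).1, fun φ => (h φ).2⟩⟩
      rw [this]
      refine isClosed_iInter fun φ => ?_
      have hc1 : ContinuousOn (fun z : ℝ × ℝ => inner ℝ (x z.1) (unitDir φ) - reach K φ)
          (Icc a b ×ˢ Icc c d) :=
        ContinuousOn.sub (ContinuousOn.inner (hx.comp continuousOn_fst fun z hz => hz.1)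
          continuousOn_const) continuousOn_const
      exact hcomp.isClosed.isClosed_le hc1
        (hcont.mono (prod_mono_right (subset_univ _)))
    have himg : {t | t ∈ Icc a b ∧ ∃ ψ ∈ Icc c d, IsDirection K (x t) ψ} =
        Prod.fst '' {z : ℝ × ℝ | z ∈ Icc a b ×ˢ Icc c d ∧ IsDirection K (x z.1) z.2} := by
      ext t
      constructor
      · rintro ⟨ht, ψ, hψ, h⟩
        exact ⟨(t, ψ), ⟨⟨ht, hψ⟩, h⟩, rfl⟩
      · rintro ⟨⟨t', ψ⟩, ⟨⟨ht, hψ⟩, h⟩, rfl⟩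
        exact ⟨ht, ψ, hψ, h⟩
    rw [himg]
    exact (hset.image continuous_fst).isClosed
  have hne : ∀ t ∈ Icc a b, ∀ ψ, IsDirection K (x t) ψ → unitDir ψ ≠ unitDir σ := by
    intro t ht ψ h he
    exact absurd ((h.congr he).reach_le hK (hout t ht)) (not_le.2 (hσ t ht))
  have hπ := Real.pi_pos
  have hθσ : σ < θ ∧ θ < σ + 2 * Real.pi := by
    rcases mem_uIcc.1 hθ with h | h
    · exact ⟨ha.1.trans_le h.1, h.2.trans_lt hb.2⟩
    · exact ⟨hb.1.trans_le h.1, h.2.trans_lt ha.2⟩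
  have hcover : Icc a b ⊆ {t | t ∈ Icc a b ∧ ∃ ψ ∈ Icc σ θ, IsDirection K (x t) ψ} ∪
      {t | t ∈ Icc a b ∧ ∃ ψ ∈ Icc θ (σ + 2 * Real.pi), IsDirection K (x t) ψ} := by
    intro t ht
    obtain ⟨ψ, h1, h2, h3⟩ := exists_isDirection_mem_Ico hK.bounded hK.nonempty (x t) σ
    rcases le_total ψ θ with h | h
    · exact Or.inl ⟨ht, ψ, ⟨h1, h⟩, h3⟩
    · exact Or.inr ⟨ht, ψ, ⟨h, h2.le⟩, h3⟩
  have haI := left_mem_Icc.2 hab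
  have hbI := right_mem_Icc.2 hab
  have hboth : (Icc a b ∩ ({t | t ∈ Icc a b ∧ ∃ ψ ∈ Icc σ θ, IsDirection K (x t) ψ} ∩
      {t | t ∈ Icc a b ∧ ∃ ψ ∈ Icc θ (σ + 2 * Real.pi), IsDirection K (x t) ψ})).Nonempty := by
    refine isPreconnected_closed_iff.1 isPreconnected_Icc _ _ (hclosed _ _) (hclosed _ _) hcover
      ?_ ?_
    · rcases mem_uIcc.1 hθ with h | h
      · exact ⟨a, haI, haI, θa, ⟨ha.1.le, h.1⟩, hθa⟩
      · exact ⟨b, hbI, hbI, θb, ⟨hb.1.le, h.1⟩, hθb⟩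
    · rcases mem_uIcc.1 hθ with h | h
      · exact ⟨b, hbI, hbI, θb, ⟨h.2, hb.2.le⟩, hθb⟩
      · exact ⟨a, haI, haI, θa, ⟨h.2, ha.2.le⟩, hθa⟩
  obtain ⟨t, ht, ⟨-, ψ, hψ, h1⟩, -, χ, hχ, h2⟩ := hboth
  refine ⟨t, ht, ?_⟩
  have r1 := h1.reach_le hK (hout t ht)
  have r2 := h2.reach_le hK (hout t ht)
  rcases lt_trichotomy χ (ψ + Real.pi) with h | h | h
  · exact IsDirection.between hK (hout t ht) hψ.2 hχ.1 h h1 h2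
  · rw [h, unitDir_add_pi, inner_neg_right] at r2
    have p1 := reach_pos hK ψ
    have p2 := reach_pos hK (ψ + Real.pi)
    linarith
  · exfalso
    -- the directions on the two sides are less than a half turn apart on the side of `σ`
    have e1 := unitDir_add_two_pi ψ
    have e2 := unitDir_add_two_pi σ
    have := reach_le_inner_of_between hK (x := x t) (α := χ) (β := σ + 2 * Real.pi)
      (γ := ψ + 2 * Real.pi) hχ.2 (by linarith [hψ.1]) (by linarith) r2
      (by rw [e1, reach_congr_angle K e1]; exact r1)
    rw [e2, reach_congr_angle K e2] at this
    exact absurd this (not_le.2 (hσ t ht))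

/-! ### Gluing curves -/

/-- The curve that follows `f` up to the time `c` and `g` afterwards. -/
def glue (c : ℝ) (f g : ℝ → Plane) (t : ℝ) : Plane := if t ≤ c then f t else g t

theorem glue_of_le {c t : ℝ} (f g : ℝ → Plane) (h : t ≤ c) : glue c f g t = f t := if_pos h

theorem glue_of_ge {c t : ℝ} {f g : ℝ → Plane} (hfg : f c = g c) (h : c ≤ t) :
    glue c f g t = g t := by
  rcases h.eq_or_lt with rfl | h
  · rw [glue_of_le f g le_rfl, hfg]
  · exact if_neg h.not_ge

theorem continuousOn_glue {a b c : ℝ} {f g : ℝ → Plane} (hac : a ≤ c) (hcb : c ≤ b)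
    (hfg : f c = g c) (hf : ContinuousOn f (Icc a c)) (hg : ContinuousOn g (Icc c b)) :
    ContinuousOn (glue c f g) (Icc a b) := by
  rw [← Icc_union_Icc_eq_Icc hac hcb]
  refine ContinuousOn.union_of_isClosed ?_ ?_ isClosed_Icc isClosed_Icc
  · exact hf.congr fun t ht => glue_of_le f g ht.2
  · exact hg.congr fun t ht => glue_of_ge hfg ht.1

theorem eVariationOn_glue {a b c : ℝ} {f g : ℝ → Plane} (hac : a ≤ c) (hcb : c ≤ b)
    (hfg : f c = g c) : eVariationOn (glue c f g) (Icc a b) =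
      eVariationOn f (Icc a c) + eVariationOn g (Icc c b) := by
  have h := eVariationOn.Icc_add_Icc (glue c f g) (s := univ) hac hcb (mem_univ c)
  simp only [univ_inter] at h
  rw [← h]
  congr 1
  · exact eVariationOn.congr fun t ht => glue_of_le f g ht.2
  · exact eVariationOn.congr fun t ht => glue_of_ge hfg ht.1

/-- A straight motion. -/
theorem exists_straight {a b : ℝ} {p q : Plane} (hab : a < b ∨ a = b ∧ p = q) :
    ∃ f : ℝ → Plane, ContinuousOn f (Icc a b) ∧ f a = p ∧ f b = q ∧
      (∀ t ∈ Icc a b, f t ∈ segment ℝ p q) ∧ eVariationOn f (Icc a b) = edist p q := by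
  rcases hab with hab | ⟨rfl, rfl⟩
  · have hba : 0 < b - a := sub_pos.2 hab
    let f : ℝ → Plane := fun t => AffineMap.lineMap p q ((t - a) / (b - a))
    have hfa : f a = p := by simp [f]
    have hfb : f b = q := by simp [f, hba.ne']
    have hdist : ∀ s t, dist (f s) (f t) = dist p q / (b - a) * |s - t| := by
      intro s t
      simp only [f]
      rw [dist_lineMap_lineMap, Real.dist_eq, ← sub_div, abs_div, abs_of_pos hba]
      rw [show s - a - (t - a) = s - t by ring]
      ring
    have hd : 0 ≤ dist p q / (b - a) := div_nonneg dist_nonneg hba.le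
    have hL : LipschitzOnWith (Real.toNNReal (dist p q / (b - a))) f (Icc a b) := by
      refine LipschitzOnWith.of_dist_le_mul fun s hs t ht => ?_
      rw [Real.coe_toNNReal _ hd, Real.dist_eq]
      exact (hdist s t).le
    refine ⟨f, hL.continuousOn, hfa, hfb, fun t ht => ?_, le_antisymm ?_ ?_⟩
    · rw [segment_eq_image_lineMap]
      exact ⟨_, ⟨div_nonneg (by linarith [ht.1]) hba.le,
        (div_le_one hba).2 (by linarith [ht.2])⟩, rfl⟩
    · have h1 := hL.comp_eVariationOn_le (g := id) (s := Icc a b) (fun x hx => hx)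
      rw [Function.comp_id, eVariationOn_id_Icc] at h1
      refine h1.trans (le_of_eq ?_)
      change ENNReal.ofReal _ * ENNReal.ofReal _ = _
      rw [← ENNReal.ofReal_mul hd, div_mul_cancel₀ _ hba.ne', edist_dist]
    · have := eVariationOn.edist_le f (left_mem_Icc.2 hab.le) (right_mem_Icc.2 hab.le)
      rwa [hfa, hfb] at this
  · refine ⟨fun _ => p, continuousOn_const, rfl, rfl, fun t _ => left_mem_segment ℝ p p, ?_⟩
    rw [edist_self]
    exact eVariationOn.constant_on (by rintro _ ⟨_, _, rfl⟩ _ ⟨_, _, rfl⟩; rfl)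

/-- Two points are joined by a rectifiable curve in a set, on each time interval. -/
def RectJoined (S : Set Plane) (p q : Plane) : Prop :=
  ∀ a b : ℝ, a < b → ∃ f : ℝ → Plane, ContinuousOn f (Icc a b) ∧ eVariationOn f (Icc a b) ≠ ⊤ ∧
    MapsTo f (Icc a b) S ∧ f a = p ∧ f b = q

theorem RectJoined.trans {S : Set Plane} {p q r : Plane} (h₁ : RectJoined S p q)
    (h₂ : RectJoined S q r) : RectJoined S p r := by
  intro a b hab
  have h1 : a < (a + b) / 2 := by linarith
  have h2 : (a + b) / 2 < b := by linarith
  obtain ⟨f, hf1, hf2, hf3, hf4, hf5⟩ := h₁ _ _ h1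
  obtain ⟨g, hg1, hg2, hg3, hg4, hg5⟩ := h₂ _ _ h2
  have hfg : f ((a + b) / 2) = g ((a + b) / 2) := hf5.trans hg4.symm
  refine ⟨glue ((a + b) / 2) f g, continuousOn_glue h1.le h2.le hfg hf1 hg1, ?_, ?_, ?_, ?_⟩
  · rw [eVariationOn_glue h1.le h2.le hfg]
    exact ENNReal.add_ne_top.2 ⟨hf2, hg2⟩
  · intro t ht
    rcases le_total t ((a + b) / 2) with h | h
    · rw [glue_of_le f g h]; exact hf3 ⟨ht.1, h⟩
    · rw [glue_of_ge hfg h]; exact hg3 ⟨h, ht.2⟩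
  · rw [glue_of_le f g h1.le, hf4]
  · rw [glue_of_ge hfg h2.le, hg5]

theorem rectJoined_of_segment_subset {S : Set Plane} {p q : Plane} (h : segment ℝ p q ⊆ S) :
    RectJoined S p q := by
  intro a b hab
  obtain ⟨f, h1, h2, h3, h4, h5⟩ := exists_straight (p := p) (q := q) (Or.inl hab)
  exact ⟨f, h1, by rw [h5]; exact edist_ne_top _ _, fun t ht => h (h4 t ht), h2, h3⟩

/-! ### Following the angle along a curve from different poles -/

/-- The oriented angle from `w` to `v`, in `(-π, π]`. -/
def turnAngle (w v : Plane) : ℝ := Complex.arg ⟨inner ℝ w v, cross w v⟩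

/-- If `w` has the angle `φ`, then `v` has the angle `φ + turnAngle w v`. -/
theorem exists_eq_smul_unitDir_add_turnAngle {w v : Plane} {ρ φ : ℝ} (hρ : 0 < ρ)
    (hw : w = ρ • unitDir φ) (hv : v ≠ 0) :
    ∃ r : ℝ, 0 < r ∧ v = r • unitDir (φ + turnAngle w v) := by
  set z : ℂ := ⟨inner ℝ w v, cross w v⟩ with hz
  have hre : ‖z‖ * Real.cos (turnAngle w v) = inner ℝ w v := Complex.norm_mul_cos_arg z
  have him : ‖z‖ * Real.sin (turnAngle w v) = cross w v := Complex.norm_mul_sin_arg z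
  rw [plane_inner, hw] at hre
  rw [cross, hw] at him
  simp only [PiLp.smul_apply, unitDir_zero_apply, unitDir_one_apply, smul_eq_mul] at hre him
  rw [← hw] at hre him
  have hsq := Real.sin_sq_add_cos_sq φ
  have e0 : ‖z‖ / ρ * Real.cos (φ + turnAngle w v) = v 0 := by
    rw [Real.cos_add, div_mul_eq_mul_div, div_eq_iff hρ.ne']
    linear_combination Real.cos φ * hre - Real.sin φ * him + ρ * v 0 * hsq
  have e1 : ‖z‖ / ρ * Real.sin (φ + turnAngle w v) = v 1 := by
    rw [Real.sin_add, div_mul_eq_mul_div, div_eq_iff hρ.ne']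
    linear_combination Real.sin φ * hre + Real.cos φ * him + ρ * v 1 * hsq
  have hz0 : z ≠ 0 := by
    intro h
    rw [h, norm_zero, zero_div, zero_mul] at e0 e1
    exact hv (plane_ext (by simpa using e0.symm) (by simpa using e1.symm))
  exact ⟨‖z‖ / ρ, div_pos (norm_pos_iff.2 hz0) hρ, plane_ext (by simp [e0]) (by simp [e1])⟩

theorem turnAngle_pos {w v : Plane} (h : 0 < cross w v) : 0 < turnAngle w v := by
  have h1 : 0 ≤ turnAngle w v := Complex.arg_nonneg_iff.2 h.le
  refine h1.lt_of_ne fun h0 => ?_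
  have := (Complex.arg_eq_zero_iff.1 h0.symm).2
  simp only at this
  exact h.ne' this

theorem turnAngle_neg {w v : Plane} (h : cross w v < 0) : turnAngle w v < 0 :=
  Complex.arg_neg_iff.2 h

theorem turnAngle_lt_pi {w v : Plane} (h : cross w v ≠ 0) : turnAngle w v < Real.pi := by
  refine (Complex.arg_le_pi _).lt_of_ne fun h0 => ?_
  exact h (Complex.arg_eq_pi_iff.1 h0).2

theorem neg_pi_lt_turnAngle (w v : Plane) : -Real.pi < turnAngle w v := Complex.neg_pi_lt_arg _

theorem turnAngle_self (v : Plane) : turnAngle v v = 0 := by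
  rw [turnAngle, Complex.arg_eq_zero_iff]
  refine ⟨real_inner_self_nonneg, ?_⟩
  simp only [cross]
  ring

/-- The angle of a curve with respect to one pole yields its angle with respect to another pole, if
the curve does not meet the segment between the two poles. -/
theorem continuousOn_turnAngle {S : Set ℝ} {w v : ℝ → Plane} (hw : ContinuousOn w S)
    (hv : ContinuousOn v S)
    (h : ∀ t ∈ S, cross (w t) (v t) = 0 → 0 < inner ℝ (w t) (v t)) :
    ContinuousOn (fun t => turnAngle (w t) (v t)) S := by
  have hcoord : ∀ i : Fin 2, ∀ f : ℝ → Plane, ContinuousOn f S → ContinuousOn (fun t => f t i) S :=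
    fun i f hf => (EuclideanSpace.proj i).continuous.comp_continuousOn hf
  have hc : ContinuousOn (fun t => cross (w t) (v t)) S :=
    ((hcoord 0 w hw).mul (hcoord 1 v hv)).sub ((hcoord 1 w hw).mul (hcoord 0 v hv))
  have hz : ContinuousOn (fun t => (⟨inner ℝ (w t) (v t), cross (w t) (v t)⟩ : ℂ)) S := by
    have h1 : ContinuousOn (fun t => ((inner ℝ (w t) (v t) : ℝ) : ℂ) +
        ((cross (w t) (v t) : ℝ) : ℂ) * Complex.I) S :=
      (Complex.continuous_ofReal.comp_continuousOn (hw.inner hv)).add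
        ((Complex.continuous_ofReal.comp_continuousOn hc).mul continuousOn_const)
    refine h1.congr fun t _ => ?_
    exact Complex.ext (by simp) (by simp)
  intro t ht
  refine ContinuousAt.comp_continuousWithinAt (Complex.continuousAt_arg ?_) (hz t ht)
  rw [Complex.mem_slitPlane_iff]
  by_cases h0 : cross (w t) (v t) = 0
  · exact Or.inl (h t ht h0)
  · exact Or.inr h0

/-! ### Counter-clockwise shortest paths around a convex obstacle -/

/-- A continuous real function passes from an initial to a larger final value within a
subinterval on which it stays between the two values. -/
theorem exists_subinterval_mapsTo_Icc {φ : ℝ → ℝ} {a b : ℝ} (hab : a ≤ b)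
    (hφ : ContinuousOn φ (Icc a b)) (hle : φ a ≤ φ b) :
    ∃ s t, a ≤ s ∧ s ≤ t ∧ t ≤ b ∧ φ s = φ a ∧ φ t = φ b ∧
      ∀ r ∈ Icc s t, φ a ≤ φ r ∧ φ r ≤ φ b := by
  have hclosed : ∀ (c d v : ℝ), Icc c d ⊆ Icc a b → IsCompact {r | r ∈ Icc c d ∧ φ r = v} := by
    intro c d v hcd
    refine isCompact_Icc.of_isClosed_subset ?_ fun r hr => hr.1
    exact (hφ.mono hcd).preimage_isClosed_of_isClosed isClosed_Icc (isClosed_singleton (x := v))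
  obtain ⟨t, ⟨ht, htb⟩, htmin⟩ := (hclosed a b (φ b) le_rfl).exists_isLeast
    ⟨b, right_mem_Icc.2 hab, rfl⟩
  obtain ⟨s, ⟨hs, hsa⟩, hsmax⟩ := (hclosed a t (φ a) (Icc_subset_Icc_right ht.2)).exists_isGreatest
    ⟨a, left_mem_Icc.2 ht.1, rfl⟩
  refine ⟨s, t, hs.1, hs.2, ht.2, hsa, htb, fun r hr => ⟨?_, ?_⟩⟩
  · by_contra! hlt
    have hcont : ContinuousOn φ (Icc r t) := hφ.mono (Icc_subset_Icc (hs.1.trans hr.1) ht.2)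
    obtain ⟨r', hr', h⟩ := intermediate_value_Icc hr.2 hcont ⟨hlt.le, hle.trans htb.ge⟩
    have h1 := hsmax ⟨⟨hs.1.trans (hr.1.trans hr'.1), hr'.2⟩, h⟩
    have h2 : r' = r := le_antisymm (h1.trans hr.1) hr'.1
    rw [h2] at h
    exact hlt.ne h
  · by_contra! hlt
    have hra : a ≤ r := hs.1.trans hr.1
    have hcont : ContinuousOn φ (Icc a r) := hφ.mono (Icc_subset_Icc_right (hr.2.trans ht.2))
    obtain ⟨r', hr', h⟩ := intermediate_value_Icc hra hcont ⟨hle, hlt.le⟩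
    have h1 := htmin ⟨⟨hr'.1, hr'.2.trans (hr.2.trans ht.2)⟩, h⟩
    have h2 : r' = r := le_antisymm hr'.2 (hr.2.trans h1)
    rw [h2] at h
    exact hlt.ne' h

theorem inner_rot_eq_cross (w x : Plane) : inner ℝ x (rot w) = cross w x := by
  rw [plane_inner, cross]
  simp
  ring

theorem inner_self_rot (w : Plane) : inner ℝ w (rot w) = 0 := by
  rw [plane_inner]
  simp
  ring

theorem inner_rot_rot (w : Plane) : inner ℝ (rot w) (rot w) = inner ℝ w w := by
  rw [plane_inner, plane_inner]
  simp
  ring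

/-- The set of points outside `O` that lie to the right of, or on, the directed line through `p`
with direction `w`. -/
def rightRegion (O : Set Plane) (p w : Plane) : Set Plane :=
  {x | x ∉ O ∧ inner ℝ x (rot w) ≤ inner ℝ p (rot w)}

theorem isClosed_rightRegion {O : Set Plane} (hO : IsOpen O) (p w : Plane) :
    IsClosed (rightRegion O p w) := by
  have h : IsClosed {x : Plane | inner ℝ x (rot w) ≤ inner ℝ p (rot w)} :=
    isClosed_le (by fun_prop) continuous_const
  exact hO.isClosed_compl.inter h

/-- Two points `p`, `q` whose connecting segment meets the obstacle `O` at `m`. -/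
structure IsBlocked (O : Set Plane) (p q m : Plane) (α β : ℝ) : Prop where
  isOpen : IsOpen O
  convex : Convex ℝ O
  bounded : Bornology.IsBounded O
  zero_mem : (0 : Plane) ∈ O
  left_notMem : p ∉ O
  right_notMem : q ∉ O
  mem : m ∈ O
  pos_left : 0 < α
  pos_right : 0 < β
  left_eq : p = m - α • (q - p)
  right_eq : q = m + β • (q - p)
  eq_zero : cross (q - p) m = 0 → m = 0

namespace IsBlocked

variable {O : Set Plane} {p q m : Plane} {α β : ℝ}

theorem ray_left (h : IsBlocked O p q m α β) {s : ℝ} (hs : α ≤ s) : m - s • (q - p) ∉ O := by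
  intro hmem
  have hs0 : 0 < s := h.pos_left.trans_le hs
  have := h.convex h.mem hmem (a := 1 - α / s) (b := α / s)
    (sub_nonneg.2 ((div_le_one hs0).2 hs)) (div_nonneg h.pos_left.le hs0.le) (by ring)
  apply h.left_notMem
  have e : (1 - α / s) • m + (α / s) • (m - s • (q - p)) = m - (α / s * s) • (q - p) := by module
  rw [e, div_mul_cancel₀ _ hs0.ne', ← h.left_eq] at this
  exact this

theorem ray_right (h : IsBlocked O p q m α β) {s : ℝ} (hs : β ≤ s) : m + s • (q - p) ∉ O := by
  intro hmem
  have hs0 : 0 < s := h.pos_right.trans_le hs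
  have := h.convex h.mem hmem (a := 1 - β / s) (b := β / s)
    (sub_nonneg.2 ((div_le_one hs0).2 hs)) (div_nonneg h.pos_right.le hs0.le) (by ring)
  apply h.right_notMem
  have e : (1 - β / s) • m + (β / s) • (m + s • (q - p)) = m + (β / s * s) • (q - p) := by module
  rw [e, div_mul_cancel₀ _ hs0.ne', ← h.right_eq] at this
  exact this

theorem sub_ne_zero (h : IsBlocked O p q m α β) : q - p ≠ 0 := by
  intro h0
  apply h.left_notMem
  rw [h.left_eq, h0]
  simpa using h.mem

theorem inner_rot_left (h : IsBlocked O p q m α β) :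
    inner ℝ p (rot (q - p)) = inner ℝ m (rot (q - p)) := by
  have : inner ℝ p (rot (q - p)) = inner ℝ (m - α • (q - p)) (rot (q - p)) := by rw [← h.left_eq]
  rw [this, inner_sub_left, real_inner_smul_left, inner_self_rot, mul_zero,
    sub_zero]

theorem inner_rot_right (h : IsBlocked O p q m α β) :
    inner ℝ q (rot (q - p)) = inner ℝ m (rot (q - p)) := by
  have : inner ℝ q (rot (q - p)) = inner ℝ (m + β • (q - p)) (rot (q - p)) := by
    rw [← h.right_eq]
  rw [this, inner_add_left, real_inner_smul_left, inner_self_rot, mul_zero,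
    add_zero]

/-- The detour in the right region consists of five segments: back along the line, out to the
right, parallel to the line, back to the line, and along it. -/
theorem rectJoined (h : IsBlocked O p q m α β) :
    RectJoined (rightRegion O p (q - p)) p q := by
  set w := q - p with hw
  have hw2 : 0 < inner ℝ w w := real_inner_self_pos.2 h.sub_ne_zero
  have hj2 : inner ℝ (rot w) (rot w) = inner ℝ w w := inner_rot_rot w
  have hwj : inner ℝ w (rot w) = 0 := inner_self_rot w
  have hjw : inner ℝ (rot w) w = 0 := by rw [real_inner_comm, hwj]
  obtain ⟨R, hR⟩ := h.bounded.exists_norm_le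
  have hR0 : 0 ≤ R := (norm_nonneg _).trans (hR 0 h.zero_mem)
  -- far enough from `m` along the line and across it, all points are outside `O`
  obtain ⟨s, hs0, hsα, hsβ, hs⟩ : ∃ s : ℝ, 0 < s ∧ α ≤ s ∧ β ≤ s ∧
      2 * R * ‖w‖ < s * inner ℝ w w := by
    refine ⟨α + β + (2 * R * ‖w‖ + 1) / inner ℝ w w, ?_, ?_, ?_, ?_⟩
    · have := h.pos_left; have := h.pos_right; positivity
    · have : 0 ≤ (2 * R * ‖w‖ + 1) / inner ℝ w w := by positivity
      linarith [h.pos_right]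
    · have : 0 ≤ (2 * R * ‖w‖ + 1) / inner ℝ w w := by positivity
      linarith [h.pos_left]
    · rw [add_mul, div_mul_cancel₀ _ hw2.ne']
      have := h.pos_left; have := h.pos_right
      have : 0 < (α + β) * inner ℝ w w := by positivity
      linarith
  have hnj : ‖rot w‖ = ‖w‖ := by
    rw [← Real.sqrt_sq (norm_nonneg (rot w)), ← Real.sqrt_sq (norm_nonneg w),
      ← real_inner_self_eq_norm_sq, ← real_inner_self_eq_norm_sq, hj2]
  have hmR : ∀ k ∈ O, |inner ℝ k w| ≤ R * ‖w‖ ∧ |inner ℝ k (rot w)| ≤ R * ‖w‖ := by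
    intro k hk
    refine ⟨(abs_real_inner_le_norm k w).trans ?_, (abs_real_inner_le_norm k (rot w)).trans ?_⟩
    · exact mul_le_mul_of_nonneg_right (hR k hk) (norm_nonneg _)
    · rw [hnj]; exact mul_le_mul_of_nonneg_right (hR k hk) (norm_nonneg _)
  -- points are described by their coordinates along `w` and `rot w`, relative to `m`
  have hseg : ∀ x₁ y₁ x₂ y₂ : ℝ, y₁ ≤ 0 → y₂ ≤ 0 →
      (∀ x y : ℝ, min x₁ x₂ ≤ x → x ≤ max x₁ x₂ → min y₁ y₂ ≤ y → y ≤ max y₁ y₂ →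
        m + x • w + y • rot w ∉ O) →
      RectJoined (rightRegion O p w) (m + x₁ • w + y₁ • rot w) (m + x₂ • w + y₂ • rot w) := by
    intro x₁ y₁ x₂ y₂ hy₁ hy₂ hO
    refine rectJoined_of_segment_subset ?_
    rintro _ ⟨c, d, hc, hd, hcd, rfl⟩
    have hd' : d = 1 - c := by linarith
    subst hd'
    have e : c • (m + x₁ • w + y₁ • rot w) + (1 - c) • (m + x₂ • w + y₂ • rot w) =
        m + (c * x₁ + (1 - c) * x₂) • w + (c * y₁ + (1 - c) * y₂) • rot w := by module
    rw [e]
    have bound : ∀ u v : ℝ, min u v ≤ c * u + (1 - c) * v ∧ c * u + (1 - c) * v ≤ max u v := by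
      intro u v
      constructor
      · nlinarith [min_le_left u v, min_le_right u v]
      · nlinarith [le_max_left u v, le_max_right u v]
    refine ⟨hO _ _ (bound x₁ x₂).1 (bound x₁ x₂).2 (bound y₁ y₂).1 (bound y₁ y₂).2, ?_⟩
    rw [h.inner_rot_left, inner_add_left, inner_add_left, real_inner_smul_left,
      real_inner_smul_left, ← hw, hwj, hj2]
    have : c * y₁ + (1 - c) * y₂ ≤ 0 := ((bound y₁ y₂).2).trans (max_le hy₁ hy₂)
    nlinarith
  have hxout : ∀ x y : ℝ, s ≤ |x| → m + x • w + y • rot w ∉ O := by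
    intro x y hx hmem
    have h1 := (hmR _ hmem).1
    have h2 := (hmR m h.mem).1
    rw [inner_add_left, inner_add_left, real_inner_smul_left, real_inner_smul_left, hjw,
      mul_zero, add_zero] at h1
    have h3 : |x * inner ℝ w w| ≤ 2 * R * ‖w‖ := by
      have : x * inner ℝ w w = (inner ℝ m w + x * inner ℝ w w) - inner ℝ m w := by ring
      rw [this]
      refine (abs_sub _ _).trans ?_
      linarith
    rw [abs_mul, abs_of_pos hw2] at h3
    nlinarith
  have hyout : ∀ x y : ℝ, y = -s → m + x • w + y • rot w ∉ O := by
    intro x y hy hmem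
    have h1 := (hmR _ hmem).2
    have h2 := (hmR m h.mem).2
    rw [inner_add_left, inner_add_left, real_inner_smul_left, real_inner_smul_left, hwj,
      mul_zero, add_zero, hj2, hy] at h1
    have := abs_le.1 h1
    have := abs_le.1 h2
    nlinarith
  have e1 : p = m + (-α) • w + (0 : ℝ) • rot w := by
    have := h.left_eq
    rw [← hw] at this
    rw [this]; module
  have e2 : q = m + β • w + (0 : ℝ) • rot w := by
    have := h.right_eq
    rw [← hw] at this
    rw [this]; module
  have r1 : RectJoined (rightRegion O p w) (m + (-α) • w + (0 : ℝ) • rot w)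
      (m + (-s) • w + (0 : ℝ) • rot w) := by
    refine hseg _ _ _ _ le_rfl le_rfl fun x y hx1 hx2 hy1 hy2 => ?_
    rw [min_self] at hy1
    rw [max_self] at hy2
    rw [max_eq_left (by linarith)] at hx2
    have := h.ray_left (s := -x) (by linarith)
    rw [le_antisymm hy2 hy1, show m + x • w + (0 : ℝ) • rot w = m - (-x) • w by module]
    exact this
  have r2 : RectJoined (rightRegion O p w) (m + (-s) • w + (0 : ℝ) • rot w)
      (m + (-s) • w + (-s) • rot w) := by
    refine hseg _ _ _ _ le_rfl (by linarith) fun x y hx1 hx2 hy1 hy2 => ?_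
    rw [min_self] at hx1
    rw [max_self] at hx2
    refine hxout x y ?_
    rw [le_antisymm hx2 hx1, abs_neg]
    exact le_abs_self s
  have r3 : RectJoined (rightRegion O p w) (m + (-s) • w + (-s) • rot w)
      (m + s • w + (-s) • rot w) := by
    refine hseg _ _ _ _ (by linarith) (by linarith) fun x y hx1 hx2 hy1 hy2 => ?_
    rw [min_self] at hy1
    rw [max_self] at hy2
    exact hyout x y (le_antisymm hy2 hy1)
  have r4 : RectJoined (rightRegion O p w) (m + s • w + (-s) • rot w)
      (m + s • w + (0 : ℝ) • rot w) := by
    refine hseg _ _ _ _ (by linarith) le_rfl fun x y hx1 hx2 hy1 hy2 => ?_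
    rw [min_self] at hx1
    rw [max_self] at hx2
    refine hxout x y ?_
    rw [le_antisymm hx2 hx1]
    exact le_abs_self s
  have r5 : RectJoined (rightRegion O p w) (m + s • w + (0 : ℝ) • rot w)
      (m + β • w + (0 : ℝ) • rot w) := by
    refine hseg _ _ _ _ le_rfl le_rfl fun x y hx1 hx2 hy1 hy2 => ?_
    rw [min_self] at hy1
    rw [max_self] at hy2
    rw [min_eq_right (by linarith)] at hx1
    have := h.ray_right hx1
    rw [le_antisymm hy2 hy1, show m + x • w + (0 : ℝ) • rot w = m + x • w by module]
    exact this
  have := (((r1.trans r2).trans r3).trans r4).trans r5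
  rwa [← e1, ← e2] at this

end IsBlocked

/-- A blocked segment has a point in the obstacle that satisfies the normalization of
`IsBlocked`. -/
theorem exists_isBlocked {O : Set Plane} {p q : Plane} (hO : IsOpen O) (hc : Convex ℝ O)
    (hb : Bornology.IsBounded O) (h0 : (0 : Plane) ∈ O) (hp : p ∉ O) (hq : q ∉ O)
    {m : Plane} (hm : m ∈ segment ℝ p q) (hmO : m ∈ O) :
    ∃ m' α β, IsBlocked O p q m' α β := by
  have key : ∀ s : ℝ, 0 < s → s < 1 → p + s • (q - p) ∈ O →
      (cross (q - p) (p + s • (q - p)) = 0 → p + s • (q - p) = 0) →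
      ∃ m' α β, IsBlocked O p q m' α β := by
    intro s hs0 hs1 hs he
    exact ⟨p + s • (q - p), s, 1 - s, hO, hc, hb, h0, hp, hq, hs, hs0, by linarith, by simp,
      by module, he⟩
  obtain ⟨s, ⟨hs0, hs1⟩, rfl⟩ : ∃ s : ℝ, s ∈ Ioo 0 1 ∧ p + s • (q - p) = m := by
    obtain ⟨a, b, ha, hb, hab, rfl⟩ := hm
    have ha' : a = 1 - b := by linarith
    subst ha'
    refine ⟨b, ⟨hb.lt_of_ne ?_, (by linarith : b ≤ 1).lt_of_ne ?_⟩, by module⟩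
    · rintro rfl
      apply hp
      simpa using hmO
    · rintro rfl
      apply hq
      simpa using hmO
  by_cases hcr : cross (q - p) (p + s • (q - p)) = 0
  · -- the line through `p` and `q` contains the origin, which lies between them
    have hw : q - p ≠ 0 := by
      intro h
      rw [h] at hmO
      exact hp (by simpa using hmO)
    have hw2 : 0 < inner ℝ (q - p) (q - p) := real_inner_self_pos.2 hw
    set w := q - p with hwdef
    have hcp : cross w p = 0 := by
      rw [← hcr]
      simp only [cross, PiLp.add_apply, PiLp.smul_apply, smul_eq_mul]
      ring
    set r := -inner ℝ p w / inner ℝ w w with hr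
    have hr0 : p + r • w = 0 := by
      have e : r * inner ℝ w w = -inner ℝ p w := by rw [hr, div_mul_cancel₀ _ hw2.ne']
      rw [plane_inner, plane_inner] at e
      rw [plane_inner] at hw2
      simp only [cross] at hcp
      refine plane_ext ?_ ?_
      · simp only [PiLp.add_apply, PiLp.smul_apply, smul_eq_mul, PiLp.zero_apply]
        have : (w 0 * w 0 + w 1 * w 1) * (p 0 + r * w 0) = 0 := by
          linear_combination w 0 * e - w 1 * hcp
        exact (mul_eq_zero.1 this).resolve_left hw2.ne'
      · simp only [PiLp.add_apply, PiLp.smul_apply, smul_eq_mul, PiLp.zero_apply]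
        have : (w 0 * w 0 + w 1 * w 1) * (p 1 + r * w 1) = 0 := by
          linear_combination w 1 * e + w 0 * hcp
        exact (mul_eq_zero.1 this).resolve_left hw2.ne'
    have hrO : p + r • w ∈ O := by rw [hr0]; exact h0
    have hr1 : 0 < r := by
      by_contra! hle
      apply hp
      have hsr : 0 < s - r := by linarith
      have := hc hmO hrO (a := -r / (s - r)) (b := s / (s - r)) (div_nonneg (by linarith) hsr.le)
        (div_nonneg hs0.le hsr.le) (by field_simp; ring)
      convert this using 1
      have : -r / (s - r) = 1 - s / (s - r) := by field_simp; ring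
      rw [this]
      have h3 : (1 - s / (s - r)) * s + s / (s - r) * r = 0 := by field_simp; ring
      calc p = p + (0 : ℝ) • w := by simp
        _ = p + ((1 - s / (s - r)) * s + s / (s - r) * r) • w := by rw [h3]
        _ = _ := by module
    have hr2 : r < 1 := by
      by_contra! hle
      apply hq
      have hsr : 0 < r - s := by linarith
      have := hc hmO hrO (a := (r - 1) / (r - s)) (b := (1 - s) / (r - s))
        (div_nonneg (by linarith) hsr.le) (div_nonneg (by linarith) hsr.le) (by field_simp; ring)
      convert this using 1
      have h2 : (r - 1) / (r - s) = 1 - (1 - s) / (r - s) := by field_simp; ring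
      rw [h2]
      have h3 : (1 - (1 - s) / (r - s)) * s + (1 - s) / (r - s) * r = 1 := by field_simp; ring
      calc q = p + (1 : ℝ) • w := by rw [hwdef]; module
        _ = p + ((1 - (1 - s) / (r - s)) * s + (1 - s) / (r - s) * r) • w := by rw [h3]
        _ = _ := by module
    exact key r hr1 hr2 hrO fun _ => hr0
  · exact key s hs0 hs1 hmO fun h => absurd h hcr

theorem unitDir_eq_iff {θ φ : ℝ} (h : unitDir θ = unitDir φ) :
    ∃ n : ℤ, θ = φ + n * (2 * Real.pi) := by
  have hc : Real.cos θ = Real.cos φ := by simpa using congrArg (fun v : Plane => v 0) h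
  have hs : Real.sin θ = Real.sin φ := by simpa using congrArg (fun v : Plane => v 1) h
  have h1 : Real.cos (θ - φ) = 1 := by
    rw [Real.cos_sub, hc, hs, ← sq, ← sq, Real.cos_sq_add_sin_sq]
  obtain ⟨n, hn⟩ := (Real.cos_eq_one_iff _).1 h1
  exact ⟨n, by linarith⟩

theorem unitDir_eq_of_smul_eq {r s θ φ : ℝ} (hr : 0 < r) (hs : 0 < s)
    (h : r • unitDir θ = s • unitDir φ) : unitDir θ = unitDir φ := by
  have hn : ∀ ψ, inner ℝ (unitDir ψ) (unitDir ψ) = (1 : ℝ) := fun ψ => by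
    rw [inner_unitDir_unitDir, sub_self, Real.cos_zero]
  have h1 : r * r = s * s := by
    have : inner ℝ (r • unitDir θ) (r • unitDir θ) = inner ℝ (s • unitDir φ) (s • unitDir φ) := by
      rw [h]
    simpa only [real_inner_smul_left, real_inner_smul_right, hn, mul_one] using this
  have h2 : r = s := by nlinarith
  rw [h2] at h
  exact smul_right_injective _ hs.ne' h

theorem turnAngle_swap {v w : Plane} (h : turnAngle w v ≠ Real.pi) :
    turnAngle v w = -turnAngle w v := by
  have e : (⟨inner ℝ v w, cross v w⟩ : ℂ) =
      (starRingEnd ℂ) (⟨inner ℝ w v, cross w v⟩ : ℂ) := by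
    refine Complex.ext ?_ ?_
    · simp [real_inner_comm]
    · simp [cross]
      ring
  rw [turnAngle, e, Complex.arg_conj]
  exact if_neg h

namespace IsBlocked

variable {O : Set Plane} {p q m : Plane} {α β : ℝ}

/-- A point outside the obstacle does not lie between the two poles `0` and `m`. -/
theorem inner_pos_of_cross_eq_zero (h : IsBlocked O p q m α β) {x : Plane} (hx : x ∉ O)
    (hc : cross x (x - m) = 0) : 0 < inner ℝ x (x - m) := by
  by_contra! hle
  apply hx
  have hx0 : x ≠ 0 := fun h0 => hx (h0 ▸ h.zero_mem)
  have hx2 : 0 < inner ℝ x x := real_inner_self_pos.2 hx0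
  have hm : inner ℝ x x ≤ inner ℝ x m := by rw [inner_sub_right] at hle; linarith
  have hm2 : 0 < inner ℝ x m := hx2.trans_le hm
  have e : x = (1 - inner ℝ x x / inner ℝ x m) • (0 : Plane) +
      (inner ℝ x x / inner ℝ x m) • m := by
    rw [smul_zero, zero_add]
    have hc' : x 0 * m 1 - x 1 * m 0 = 0 := by
      simp only [cross, PiLp.sub_apply] at hc
      linarith
    refine plane_ext ?_ ?_
    · rw [PiLp.smul_apply, smul_eq_mul, div_mul_eq_mul_div, eq_div_iff hm2.ne', plane_inner,
        plane_inner]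
      linear_combination x 1 * hc'
    · rw [PiLp.smul_apply, smul_eq_mul, div_mul_eq_mul_div, eq_div_iff hm2.ne', plane_inner,
        plane_inner]
      linear_combination -x 0 * hc'
  rw [e]
  exact h.convex h.zero_mem h.mem (sub_nonneg.2 ((div_le_one hm2).2 hm))
    (div_nonneg hx2.le hm2.le) (by ring)

theorem cross_eq (h : IsBlocked O p q m α β) :
    cross p (p - m) = α * cross (q - p) m ∧ cross q (q - m) = -(β * cross (q - p) m) ∧
      cross p q = -((α + β) * cross (q - p) m) := by
  set w := q - p with hw
  have hl := h.left_eq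
  have hr := h.right_eq
  rw [← hw] at hl hr
  rw [hr, hl]
  simp only [cross, PiLp.sub_apply, PiLp.add_apply, PiLp.smul_apply, smul_eq_mul]
  refine ⟨by ring, by ring, by ring⟩

/-- Going around the obstacle once less than fully as seen from the origin is the same as making
half a turn as seen from the pole `m`. -/
theorem net_turn (h : IsBlocked O p q m α β) {ρ r φ ψ : ℝ} (hρ : 0 < ρ) (hr : 0 < r)
    (hp : p = ρ • unitDir φ) (hq : q = r • unitDir ψ) :
    (φ ≤ ψ ∧ ψ < φ + 2 * Real.pi) ↔
      ψ + turnAngle q (q - m) = φ + turnAngle p (p - m) + Real.pi := by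
  obtain ⟨c1, c2, c3⟩ := h.cross_eq
  have hα := h.pos_left
  have hβ := h.pos_right
  have hw := h.sub_ne_zero
  have hπ := Real.pi_pos
  -- up to full turns the angle from `p` to `q` seen from `m` is a half turn
  have hmod : ∃ n : ℤ, ψ + turnAngle q (q - m) =
      φ + turnAngle p (p - m) + Real.pi + n * (2 * Real.pi) := by
    have hpm : p - m ≠ 0 := by
      intro h0
      apply h.left_notMem
      rw [sub_eq_zero.1 h0]
      exact h.mem
    have hqm : q - m ≠ 0 := by
      intro h0
      apply h.right_notMem
      rw [sub_eq_zero.1 h0]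
      exact h.mem
    obtain ⟨s, hs, e1⟩ := exists_eq_smul_unitDir_add_turnAngle hρ hp hpm
    obtain ⟨t, ht, e2⟩ := exists_eq_smul_unitDir_add_turnAngle hr hq hqm
    apply unitDir_eq_iff
    refine unitDir_eq_of_smul_eq (r := α * t) (s := β * s) (by positivity) (by positivity) ?_
    rw [unitDir_add_pi, smul_neg, mul_smul, mul_smul, ← e1, ← e2]
    have hl : p - m = -(α • (q - p)) := by
      have := h.left_eq
      rw [sub_eq_iff_eq_add, neg_add_eq_sub]
      exact this
    have hr : q - m = β • (q - p) := by
      have := h.right_eq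
      rw [sub_eq_iff_eq_add, add_comm]
      exact this
    rw [hl, hr, smul_neg, neg_neg, smul_smul, smul_smul, mul_comm]
  have hsin : ρ * r * Real.sin (ψ - φ) = -((α + β) * cross (q - p) m) := by
    rw [← c3, ← cross_unitDir_unitDir, hp, hq]
    simp only [cross, PiLp.smul_apply, smul_eq_mul]
    ring
  have hρr : 0 < ρ * r := mul_pos hρ hr
  obtain ⟨n, hn⟩ := hmod
  rcases lt_trichotomy (cross (q - p) m) 0 with hl | hl | hl
  · have a1 := turnAngle_neg (w := p) (v := p - m) (by rw [c1]; nlinarith)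
    have a2 := neg_pi_lt_turnAngle p (p - m)
    have b1 := turnAngle_pos (w := q) (v := q - m) (by rw [c2]; nlinarith)
    have b2 := turnAngle_lt_pi (w := q) (v := q - m) (by rw [c2]; nlinarith)
    have hs : 0 < Real.sin (ψ - φ) := by
      by_contra! hle
      nlinarith
    constructor
    · rintro ⟨h1, h2⟩
      have h3 : ψ - φ < Real.pi := by
        by_contra! hle
        have := Real.sin_nonneg_of_nonneg_of_le_pi (x := ψ - φ - Real.pi) (by linarith)
          (by linarith)
        rw [Real.sin_sub_pi] at this
        linarith
      have hn1 : n < 1 := by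
        by_contra! hle
        have : (1 : ℝ) ≤ n := by exact_mod_cast hle
        nlinarith
      have hn2 : -1 < n := by
        by_contra! hle
        have : (n : ℝ) ≤ -1 := by exact_mod_cast hle
        nlinarith
      have hn0 : n = 0 := by omega
      rw [hn, hn0]
      simp
    · intro he
      refine ⟨?_, by linarith⟩
      by_contra! hlt
      have := Real.sin_nonpos_of_nonpos_of_neg_pi_le (x := ψ - φ) (by linarith) (by linarith)
      linarith
  · have hm := h.eq_zero hl
    rw [hm, sub_zero, sub_zero, turnAngle_self, turnAngle_self] at hn ⊢
    constructor
    · rintro ⟨h1, h2⟩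
      have hn1 : n < 1 := by
        by_contra! hle
        have : (1 : ℝ) ≤ n := by exact_mod_cast hle
        nlinarith
      have hn2 : -1 < n := by
        by_contra! hle
        have : (n : ℝ) ≤ -1 := by exact_mod_cast hle
        nlinarith
      have hn0 : n = 0 := by omega
      rw [hn, hn0]
      simp
    · intro he
      constructor <;> linarith
  · have a1 := turnAngle_pos (w := p) (v := p - m) (by rw [c1]; nlinarith)
    have a2 := turnAngle_lt_pi (w := p) (v := p - m) (by rw [c1]; nlinarith)
    have b1 := turnAngle_neg (w := q) (v := q - m) (by rw [c2]; nlinarith)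
    have b2 := neg_pi_lt_turnAngle q (q - m)
    have hs : Real.sin (ψ - φ) < 0 := by
      by_contra! hle
      nlinarith
    constructor
    · rintro ⟨h1, h2⟩
      have h3 : Real.pi < ψ - φ := by
        by_contra! hle
        have := Real.sin_nonneg_of_nonneg_of_le_pi (x := ψ - φ) (by linarith) (by linarith)
        linarith
      have hn1 : n < 1 := by
        by_contra! hle
        have : (1 : ℝ) ≤ n := by exact_mod_cast hle
        nlinarith
      have hn2 : -1 < n := by
        by_contra! hle
        have : (n : ℝ) ≤ -1 := by exact_mod_cast hle
        nlinarith
      have hn0 : n = 0 := by omega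
      rw [hn, hn0]
      simp
    · intro he
      refine ⟨by linarith, ?_⟩
      by_contra! hlt
      have := Real.sin_nonneg_of_nonneg_of_le_pi (x := ψ - φ - 2 * Real.pi) (by linarith)
        (by linarith)
      rw [Real.sin_sub_two_pi] at this
      linarith

/-- A curve in the right region turns counter-clockwise around the origin. -/
theorem turnsCcwOn (h : IsBlocked O p q m α β) {a b : ℝ} (hab : a ≤ b) {ξ : ℝ → Plane}
    (hξ : ContinuousOn ξ (Icc a b)) (hmem : MapsTo ξ (Icc a b) (rightRegion O p (q - p)))
    (ha : ξ a = p) (hb : ξ b = q) : TurnsCcwOn 0 ξ a b := by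
  set w := q - p with hw
  have haI := left_mem_Icc.2 hab
  have hbI := right_mem_Icc.2 hab
  have hw2 : 0 < inner ℝ w w := real_inner_self_pos.2 h.sub_ne_zero
  have hne : ∀ t ∈ Icc a b, ξ t ≠ 0 := fun t ht h0 => (hmem ht).1 (h0 ▸ h.zero_mem)
  have hnem : ∀ t ∈ Icc a b, ξ t - m ≠ 0 := fun t ht h0 =>
    (hmem ht).1 (by rw [sub_eq_zero.1 h0]; exact h.mem)
  have hcr : ∀ x : Plane, cross (-rot w) x = inner ℝ x w := by
    intro x
    simp only [cross, plane_inner, PiLp.neg_apply, rot_zero_apply, rot_one_apply]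
    ring
  have hin : ∀ x : Plane, inner ℝ (-rot w) x = -inner ℝ x (rot w) := by
    intro x
    rw [inner_neg_left, real_inner_comm]
  -- the angle seen from `m`, measured from the direction pointing to the right of the line
  have hrot0 : -rot w ≠ 0 := by
    intro h0
    have h1 : rot w = 0 := neg_eq_zero.1 h0
    rw [← inner_rot_rot, h1, inner_zero_left] at hw2
    exact lt_irrefl _ hw2
  obtain ⟨r, τ, hr, -, -, hτ⟩ := exists_unitDir_mem_Ico (-rot w) hrot0 0
  have hslit : ∀ t ∈ Icc a b, cross (-rot w) (ξ t - m) = 0 → 0 < inner ℝ (-rot w) (ξ t - m) := by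
    intro t ht h0
    have h1 := (hmem ht).2
    rw [h.inner_rot_left, ← hw, ← sub_nonpos, ← inner_sub_left] at h1
    rw [hcr] at h0
    rw [hin, neg_pos]
    refine h1.lt_of_ne fun h2 => hnem t ht ?_
    rw [plane_inner] at h0 h2 hw2
    simp only [rot_zero_apply, rot_one_apply] at h2
    refine plane_ext ?_ ?_
    · have : (w 0 * w 0 + w 1 * w 1) * (ξ t - m) 0 = 0 := by
        linear_combination w 0 * h0 - w 1 * h2
      exact (mul_eq_zero.1 this).resolve_left hw2.ne'
    · have : (w 0 * w 0 + w 1 * w 1) * (ξ t - m) 1 = 0 := by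
        linear_combination w 1 * h0 + w 0 * h2
      exact (mul_eq_zero.1 this).resolve_left hw2.ne'
  have hξm : ContinuousOn (fun t => ξ t - m) (Icc a b) := hξ.sub continuousOn_const
  have hψ := continuousOn_turnAngle (w := fun _ => -rot w) continuousOn_const hξm hslit
  -- back to the angle seen from the origin
  have hback : ∀ t ∈ Icc a b, cross (ξ t - m) (ξ t) = 0 → 0 < inner ℝ (ξ t - m) (ξ t) := by
    intro t ht h0
    rw [real_inner_comm]
    refine h.inner_pos_of_cross_eq_zero (hmem ht).1 ?_
    have : cross (ξ t) (ξ t - m) = -cross (ξ t - m) (ξ t) := by simp only [cross]; ring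
    rw [this, h0, neg_zero]
  have hδ := continuousOn_turnAngle hξm hξ hback
  have hex : ∀ t ∈ Icc a b, ∃ s : ℝ, 0 < s ∧
      ξ t - m = s • unitDir (τ + turnAngle (-rot w) (ξ t - m)) :=
    fun t ht => exists_eq_smul_unitDir_add_turnAngle hr hτ (hnem t ht)
  have hex2 : ∀ t, ∃ s : ℝ, t ∈ Icc a b → 0 < s ∧
      ξ t = s • unitDir (τ + turnAngle (-rot w) (ξ t - m) + turnAngle (ξ t - m) (ξ t)) := by
    intro t
    by_cases ht : t ∈ Icc a b
    · obtain ⟨s, hs, he⟩ := hex t ht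
      obtain ⟨s', hs', he'⟩ := exists_eq_smul_unitDir_add_turnAngle hs he (hne t ht)
      exact ⟨s', fun _ => ⟨hs', he'⟩⟩
    · exact ⟨0, fun h' => absurd h' ht⟩
  choose ρ hρ using hex2
  refine ⟨ρ, fun t => τ + turnAngle (-rot w) (ξ t - m) + turnAngle (ξ t - m) (ξ t),
    (continuousOn_const.add hψ).add hδ, fun t ht => ⟨(hρ t ht).1, ?_⟩, ?_⟩
  · rw [zero_add]; exact (hρ t ht).2
  have hta : turnAngle (-rot w) (p - m) = -(Real.pi / 2) := by
    have hl : p - m = -(α • w) := by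
      have := h.left_eq
      rw [sub_eq_iff_eq_add, neg_add_eq_sub]
      exact this
    rw [turnAngle, Complex.arg_eq_neg_pi_div_two_iff, hin, hcr, hl, inner_neg_left,
      inner_neg_left, real_inner_smul_left, real_inner_smul_left, inner_self_rot]
    have := mul_pos h.pos_left hw2
    exact ⟨by simp, by simpa using this⟩
  have htb : turnAngle (-rot w) (q - m) = Real.pi / 2 := by
    have hr : q - m = β • w := by
      have := h.right_eq
      rw [sub_eq_iff_eq_add, add_comm]
      exact this
    rw [turnAngle, Complex.arg_eq_pi_div_two_iff, hin, hcr, hr,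
      real_inner_smul_left, real_inner_smul_left, inner_self_rot]
    have := mul_pos h.pos_right hw2
    exact ⟨by simp, by simpa using this⟩
  have hrev : ∀ t ∈ Icc a b, turnAngle (ξ t - m) (ξ t) = -turnAngle (ξ t) (ξ t - m) := by
    intro t ht
    refine turnAngle_swap fun hπ => ?_
    have h1 := Complex.arg_eq_pi_iff.1 hπ
    exact absurd (h.inner_pos_of_cross_eq_zero (hmem ht).1 h1.2) (not_lt.2 h1.1.le)
  refine (h.net_turn (hρ a haI).1 (hρ b hbI).1 ?_ ?_).2 ?_
  · rw [← (hρ a haI).2, ha]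
  · rw [← (hρ b hbI).2, hb]
  · beta_reduce
    rw [hrev a haI, hrev b hbI, ha, hb, hta, htb]
    ring

end IsBlocked

/-- A ray that has left a convex set does not enter it again. -/
theorem notMem_of_ray {O : Set Plane} (hc : Convex ℝ O) {m v : Plane} (hm : m ∈ O) {s x : ℝ}
    (hs0 : 0 < s) (hs : m + s • v ∉ O) (hx : s ≤ x) : m + x • v ∉ O := by
  intro hmem
  have hx0 : 0 < x := hs0.trans_le hx
  have := hc hm hmem (a := 1 - s / x) (b := s / x)
    (sub_nonneg.2 ((div_le_one hx0).2 hx)) (div_nonneg hs0.le hx0.le) (by ring)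
  apply hs
  have e : (1 - s / x) • m + (s / x) • (m + x • v) = m + (s / x * x) • v := by module
  rwa [e, div_mul_cancel₀ _ hx0.ne'] at this

/-- The part of a ray from inside a convex set between two points outside lies outside. -/
theorem segment_ray_notMem {O : Set Plane} (hc : Convex ℝ O) {m v : Plane} (hm : m ∈ O) {s t : ℝ}
    (hs0 : 0 < s) (ht0 : 0 < t) (hs : m + s • v ∉ O) (ht : m + t • v ∉ O) :
    ∀ x ∈ segment ℝ (m + s • v) (m + t • v), ∃ r : ℝ, x = m + r • v ∧ x ∉ O := by
  rintro _ ⟨c, d, hc0, hd0, hcd, rfl⟩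
  have hc' : c = 1 - d := by linarith
  subst hc'
  have e : (1 - d) • (m + s • v) + d • (m + t • v) = m + ((1 - d) * s + d * t) • v := by module
  rw [e]
  refine ⟨_, rfl, ?_⟩
  rcases le_total s t with h | h
  · exact notMem_of_ray hc hm hs0 hs (by nlinarith)
  · exact notMem_of_ray hc hm ht0 ht (by nlinarith)

namespace IsBlocked

variable {O : Set Plane} {p q m : Plane} {α β : ℝ}

/-- A curve that turns counter-clockwise around the origin can be cut off along the line through
its end points, without becoming longer, so that it lies in the right region: as seen from `m` it
makes half a turn, hence contains an arc whose directions are just those of the right half-plane. -/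
theorem exists_cut (h : IsBlocked O p q m α β) {a b : ℝ} (hab : a ≤ b) {η : ℝ → Plane}
    (hη : ContinuousOn η (Icc a b)) (hout : ∀ t ∈ Icc a b, η t ∉ O) (ha : η a = p) (hb : η b = q)
    (hturn : TurnsCcwOn 0 η a b) :
    ∃ ζ : ℝ → Plane, ContinuousOn ζ (Icc a b) ∧ MapsTo ζ (Icc a b) (rightRegion O p (q - p)) ∧
      ζ a = p ∧ ζ b = q ∧ eVariationOn ζ (Icc a b) ≤ eVariationOn η (Icc a b) := by
  obtain ⟨ρ, φ, hφ, hρφ, h1, h2⟩ := hturn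
  have haI := left_mem_Icc.2 hab
  have hbI := right_mem_Icc.2 hab
  have hnem : ∀ t ∈ Icc a b, η t - m ≠ 0 := fun t ht h0 =>
    hout t ht (by rw [sub_eq_zero.1 h0]; exact h.mem)
  have hηm : ContinuousOn (fun t => η t - m) (Icc a b) := hη.sub continuousOn_const
  have hδ := continuousOn_turnAngle hη hηm fun t ht h0 =>
    h.inner_pos_of_cross_eq_zero (hout t ht) h0
  set Φ : ℝ → ℝ := fun t => φ t + turnAngle (η t) (η t - m) with hΦ
  have hΦc : ContinuousOn Φ (Icc a b) := hφ.add hδ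
  have hlift : ∀ t ∈ Icc a b, ∃ s : ℝ, 0 < s ∧ η t - m = s • unitDir (Φ t) := by
    intro t ht
    obtain ⟨hr, he⟩ := hρφ t ht
    rw [zero_add] at he
    exact exists_eq_smul_unitDir_add_turnAngle hr he (hnem t ht)
  have hnet : Φ b = Φ a + Real.pi := by
    have e1 := (hρφ a haI).2
    have e2 := (hρφ b hbI).2
    rw [zero_add, ha] at e1
    rw [zero_add, hb] at e2
    have := (h.net_turn (hρφ a haI).1 (hρφ b hbI).1 e1 e2).1 ⟨h1, h2⟩
    simp only [hΦ, ha, hb]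
    exact this
  obtain ⟨s, t, has, hst, htb, hΦs, hΦt, hbtw⟩ :=
    exists_subinterval_mapsTo_Icc hab hΦc (by linarith [Real.pi_pos])
  set w := q - p with hw
  obtain ⟨σ, hσ, hσe⟩ := hlift a haI
  rw [ha] at hσe
  have hα := h.pos_left
  have hβ := h.pos_right
  -- the direction of the line in terms of the initial angle
  have hwe : unitDir (Φ a) = -((α / σ) • w) := by
    have hl : p - m = -(α • w) := by
      have := h.left_eq
      rw [sub_eq_iff_eq_add, neg_add_eq_sub]
      exact this
    rw [hl] at hσe
    have := congrArg (fun v => σ⁻¹ • v) hσe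
    simp only [smul_smul, smul_neg, inv_mul_cancel₀ hσ.ne', one_smul] at this
    rw [← this, div_eq_inv_mul]
  have hwu : w = -((σ / α) • unitDir (Φ a)) := by
    rw [hwe, smul_neg, neg_neg, smul_smul, div_mul_div_cancel₀ hα.ne', div_self hσ.ne', one_smul]
  have hsI : s ∈ Icc a b := ⟨has, hst.trans htb⟩
  have htI : t ∈ Icc a b := ⟨has.trans hst, htb⟩
  obtain ⟨x, hx, hxe⟩ := hlift s hsI
  obtain ⟨y, hy, hye⟩ := hlift t htI
  rw [hΦs, hwe] at hxe
  rw [hΦt, hnet, unitDir_add_pi, hwe, neg_neg] at hye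
  have hpl : p = m + α • (-w) := by rw [smul_neg, ← sub_eq_add_neg]; exact h.left_eq
  have hsl : η s = m + (x * (α / σ)) • (-w) := by
    rw [sub_eq_iff_eq_add] at hxe
    rw [hxe]; module
  have htl : η t = m + (y * (α / σ)) • w := by
    rw [sub_eq_iff_eq_add] at hye
    rw [hye]; module
  have hmemline : ∀ z : Plane, (∃ r : ℝ, z = m + r • w) → z ∉ O → z ∈ rightRegion O p w := by
    rintro z ⟨r, rfl⟩ hz
    refine ⟨hz, ?_⟩
    rw [h.inner_rot_left, inner_add_left, real_inner_smul_left, ← hw, inner_self_rot, mul_zero,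
      add_zero]
  obtain ⟨f, hf1, hf2, hf3, hf4, hf5⟩ := exists_straight (a := a) (b := s) (p := p) (q := η s) (by
    rcases has.eq_or_lt with e | e
    · exact Or.inr ⟨e, by rw [← e, ha]⟩
    · exact Or.inl e)
  obtain ⟨g, hg1, hg2, hg3, hg4, hg5⟩ := exists_straight (a := t) (b := b) (p := η t) (q := q) (by
    rcases htb.eq_or_lt with e | e
    · exact Or.inr ⟨e, by rw [e, hb]⟩
    · exact Or.inl e)
  have hsb : s ≤ b := hst.trans htb
  have hg' : η t = g t := hg2.symm
  have hf' : f s = glue t η g s := by rw [glue_of_le η g hst, hf3]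
  refine ⟨glue s f (glue t η g), ?_, ?_, ?_, ?_, ?_⟩
  · refine continuousOn_glue has hsb hf' hf1 (continuousOn_glue hst htb hg' ?_ hg1)
    exact hη.mono (Icc_subset_Icc has htb)
  · intro r hr
    rcases le_total r s with hrs | hrs
    · rw [glue_of_le _ _ hrs]
      have hseg := hf4 r ⟨hr.1, hrs⟩
      rw [hsl, hpl] at hseg
      obtain ⟨k, hk, hkO⟩ := segment_ray_notMem h.convex h.mem hα
        (mul_pos hx (div_pos hα hσ)) (by rw [← hpl]; exact h.left_notMem)
        (by rw [← hsl]; exact hout s hsI) _ hseg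
      exact hmemline _ ⟨-k, by rw [hk]; module⟩ hkO
    rw [glue_of_ge hf' hrs]
    rcases le_total r t with hrt | hrt
    · rw [glue_of_le _ _ hrt]
      refine ⟨hout r hr, ?_⟩
      obtain ⟨z, hz, hze⟩ := hlift r hr
      rw [h.inner_rot_left, ← sub_nonpos, ← inner_sub_left, inner_rot_eq_cross, hze, hwu]
      have e : cross (-((σ / α) • unitDir (Φ a))) (z • unitDir (Φ r)) =
          -(σ / α * z * Real.sin (Φ r - Φ a)) := by
        rw [← cross_unitDir_unitDir]
        simp only [cross, PiLp.neg_apply, PiLp.smul_apply, smul_eq_mul]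
        ring
      rw [e, neg_nonpos]
      have hb := hbtw r ⟨hrs, hrt⟩
      refine mul_nonneg (by positivity) (Real.sin_nonneg_of_nonneg_of_le_pi ?_ ?_) <;> linarith
    · rw [glue_of_ge hg' hrt]
      have hseg := hg4 r ⟨hrt, hr.2⟩
      rw [htl, h.right_eq] at hseg
      obtain ⟨k, hk, hkO⟩ := segment_ray_notMem h.convex h.mem
        (mul_pos hy (div_pos hα hσ)) hβ (by rw [← htl]; exact hout t htI)
        (by have := h.right_notMem; rwa [h.right_eq] at this) _ hseg
      exact hmemline _ ⟨k, hk⟩ hkO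
  · rw [glue_of_le _ _ has, hf2]
  · rw [glue_of_ge hf' hsb, glue_of_ge hg' htb, hg3]
  · rw [eVariationOn_glue has hsb hf', eVariationOn_glue hst htb hg', hf5, hg5]
    have e1 := eVariationOn.Icc_add_Icc η (s := univ) has hsb (mem_univ s)
    have e2 := eVariationOn.Icc_add_Icc η (s := univ) hst htb (mem_univ t)
    simp only [univ_inter] at e1 e2
    rw [← e1, ← e2]
    refine add_le_add ?_ (add_le_add le_rfl ?_)
    · rw [← ha]
      exact eVariationOn.edist_le η (left_mem_Icc.2 has) (right_mem_Icc.2 has)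
    · rw [← hb]
      exact eVariationOn.edist_le η (left_mem_Icc.2 htb) (right_mem_Icc.2 htb)

end IsBlocked

/-- The nearest-point map onto a closed convex set. -/
theorem exists_nearest_point_map {D : Set Plane} (hne : D.Nonempty) (hD : IsClosed D)
    (hc : Convex ℝ D) :
    ∃ π : Plane → Plane, LipschitzWith 1 π ∧ (∀ x, π x ∈ D) ∧
      ∀ x, ∀ z ∈ D, inner ℝ (x - π x) (z - π x) ≤ 0 := by
  choose π hπ hmin using exists_norm_eq_iInf_of_complete_convex hne hD.isComplete hc
  have hvar : ∀ x, ∀ z ∈ D, inner ℝ (x - π x) (z - π x) ≤ 0 := fun x =>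
    (norm_eq_iInf_iff_real_inner_le_zero hc (hπ x)).1 (hmin x)
  refine ⟨π, LipschitzWith.of_dist_le_mul fun x y => ?_, hπ, hvar⟩
  rw [NNReal.coe_one, one_mul, dist_eq_norm, dist_eq_norm]
  have h1 := hvar x (π y) (hπ y)
  have h2 := hvar y (π x) (hπ x)
  have e : inner ℝ (π x - π y) (π x - π y) =
      inner ℝ (x - y) (π x - π y) + inner ℝ (x - π x) (π y - π x) +
        inner ℝ (y - π y) (π x - π y) := by
    simp only [inner_sub_left, inner_sub_right]
    ring
  have h3 := real_inner_le_norm (x - y) (π x - π y)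
  rw [real_inner_self_eq_norm_sq] at e
  by_contra! hlt
  nlinarith [norm_nonneg (x - y), norm_nonneg (π x - π y)]

namespace IsBlocked

variable {O : Set Plane} {p q m : Plane} {α β : ℝ}

/-- A shortest curve in the right region lies, without loss of generality, in the hull of its end
points and the part of the obstacle to the right of the line: the nearest-point map onto that hull
preserves the right region and does not increase lengths. -/
theorem exists_shortest (h : IsBlocked O p q m α β) {a b : ℝ} (hab : a < b) :
    ∃ ξ : ℝ → Plane, ContinuousOn ξ (Icc a b) ∧ eVariationOn ξ (Icc a b) ≠ ⊤ ∧
      MapsTo ξ (Icc a b) (rightRegion O p (q - p)) ∧ ξ a = p ∧ ξ b = q ∧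
      (∀ η : ℝ → Plane, ContinuousOn η (Icc a b) →
        MapsTo η (Icc a b) (rightRegion O p (q - p)) → η a = p → η b = q →
        eVariationOn ξ (Icc a b) ≤ eVariationOn η (Icc a b)) ∧
      ∀ t ∈ Icc a b, ∀ (u : Plane) (c : ℝ), inner ℝ p u ≤ c → inner ℝ q u ≤ c →
        (∀ k ∈ O, inner ℝ k (rot (q - p)) ≤ inner ℝ p (rot (q - p)) → inner ℝ k u ≤ c) →
        inner ℝ (ξ t) u ≤ c := by
  obtain ⟨f, hf1, hf2, hf3, hf4, hf5, hf6⟩ :=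
    exists_shortest_curve (isClosed_rightRegion h.isOpen p (q - p)) hab (h.rectJoined a b hab)
  set w := q - p with hw
  set S : Set Plane := {p, q} ∪ {k | k ∈ O ∧ inner ℝ k (rot w) ≤ inner ℝ p (rot w)} with hS
  have hpS : p ∈ S := Or.inl (Or.inl rfl)
  have hqS : q ∈ S := Or.inl (Or.inr rfl)
  set D := closure (convexHull ℝ S) with hDdef
  have hSD : S ⊆ D := (subset_convexHull ℝ S).trans subset_closure
  -- half-planes that contain `S` contain `D`
  have hhalf : ∀ (u : Plane) (c : ℝ), (∀ z ∈ S, inner ℝ z u ≤ c) → ∀ z ∈ D, inner ℝ z u ≤ c := by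
    intro u c hu
    have hcl : IsClosed {z : Plane | inner ℝ z u ≤ c} := isClosed_le (by fun_prop) continuous_const
    have hcv : Convex ℝ {z : Plane | inner ℝ z u ≤ c} :=
      convex_halfSpace_le ⟨fun x y => inner_add_left x y u,
        fun r x => real_inner_smul_left x u r⟩ c
    exact closure_minimal (convexHull_min hu hcv) hcl
  have hDright : ∀ z ∈ D, inner ℝ z (rot w) ≤ inner ℝ p (rot w) := by
    refine hhalf _ _ ?_
    rintro z ((rfl | rfl) | hz)
    · exact le_rfl
    · rw [h.inner_rot_left, h.inner_rot_right]
    · exact hz.2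
  obtain ⟨π, hπL, hπD, hπv⟩ := exists_nearest_point_map ⟨p, hSD hpS⟩ isClosed_closure
    (convex_convexHull ℝ S).closure
  have hfix : ∀ x ∈ D, π x = x := by
    intro x hx
    have := hπv x x hx
    exact (sub_eq_zero.1 (inner_self_eq_zero.1 (this.antisymm real_inner_self_nonneg))).symm
  have hπright : ∀ x ∈ rightRegion O p w, π x ∈ rightRegion O p w := by
    intro x hx
    refine ⟨fun hmem => ?_, hDright _ (hπD x)⟩
    -- moving the nearest point, inside the obstacle, towards `x` brings it closer
    have hev : ∀ᶠ ε : ℝ in 𝓝[>] 0, π x + ε • (x - π x) ∈ O := by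
      have hc : Tendsto (fun ε : ℝ => π x + ε • (x - π x)) (𝓝[>] 0) (𝓝 (π x)) := by
        have : Continuous fun ε : ℝ => π x + ε • (x - π x) := by fun_prop
        have := this.tendsto 0
        rw [zero_smul, add_zero] at this
        exact this.mono_left nhdsWithin_le_nhds
      exact hc (h.isOpen.mem_nhds hmem)
    obtain ⟨ε, hεO, hε0, hε1⟩ := (hev.and (Ioo_mem_nhdsGT (zero_lt_one (α := ℝ)))).exists
    have hD' : π x + ε • (x - π x) ∈ D := by
      refine hSD (Or.inr ⟨hεO, ?_⟩)
      rw [inner_add_left, real_inner_smul_left, inner_sub_left]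
      have h1 := hx.2
      have h2 := hDright _ (hπD x)
      nlinarith
    have := hπv x _ hD'
    rw [add_sub_cancel_left, real_inner_smul_right] at this
    have h0 : inner ℝ (x - π x) (x - π x) ≤ 0 := by
      by_contra! hlt
      have := mul_pos hε0 hlt
      linarith
    have := sub_eq_zero.1 (inner_self_eq_zero.1 (h0.antisymm real_inner_self_nonneg))
    rw [← this] at hmem
    exact hx.1 hmem
  have hle : eVariationOn (π ∘ f) (Icc a b) ≤ eVariationOn f (Icc a b) := by
    have := (hπL.lipschitzOnWith (s := univ)).comp_eVariationOn_le (g := f) (s := Icc a b)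
      (mapsTo_univ _ _)
    simpa using this
  refine ⟨π ∘ f, hπL.continuous.comp_continuousOn hf1, ne_top_of_le_ne_top hf2 hle,
    fun t ht => hπright _ (hf3 ht), ?_, ?_, fun η h1 h2 h3 h4 => hle.trans (hf6 η h1 h2 h3 h4), ?_⟩
  · simp only [Function.comp, hf4]
    exact hfix p (hSD hpS)
  · simp only [Function.comp, hf5]
    exact hfix q (hSD hqS)
  · intro t ht u c hp hq hk
    refine hhalf u c ?_ _ (hπD _)
    rintro z ((rfl | rfl) | hz)
    · exact hp
    · exact hq
    · exact hk z hz.1 hz.2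

end IsBlocked

/-- Counter-clockwise oriented shortest paths around a robot exist, and they are confined: such a
path is either straight, or lies in the convex hull of its end points and the part of the
obstacle to the right of the line through them. -/
theorem exists_isCcwShortestOn {K : Set Plane} (hK : IsRobot K) {p q : Plane}
    (hp : p ∉ interior K) (hq : q ∉ interior K) {a b : ℝ} (hab : a < b) :
    ∃ x : ℝ → Plane, ContinuousOn x (Icc a b) ∧ eVariationOn x (Icc a b) ≠ ⊤ ∧ x a = p ∧ x b = q ∧
      (∀ t ∈ Icc a b, x t ∉ interior K) ∧ IsCcwShortestOn K 0 x a b ∧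
      ((∀ t ∈ Icc a b, ∀ u, inner ℝ (x t) u ≤ max (inner ℝ p u) (inner ℝ q u)) ∨
        (∃ m ∈ segment ℝ p q, m ∈ interior K) ∧
        ∀ t ∈ Icc a b, ∀ (u : Plane) (c : ℝ), inner ℝ p u ≤ c → inner ℝ q u ≤ c →
          (∀ k ∈ interior K, inner ℝ k (rot (q - p)) ≤ inner ℝ p (rot (q - p)) →
            inner ℝ k u ≤ c) → inner ℝ (x t) u ≤ c) := by
  by_cases hm : ∃ m ∈ segment ℝ p q, m ∈ interior K
  · obtain ⟨m, hm1, hm2⟩ := hm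
    obtain ⟨m', α, β, h⟩ := exists_isBlocked isOpen_interior hK.convex.interior
      (hK.bounded.subset interior_subset) hK.zero_mem_interior hp hq hm1 hm2
    obtain ⟨x, h1, h2, h3, h4, h5, h6, h7⟩ := h.exists_shortest hab
    have hout : ∀ t ∈ Icc a b, x t ∉ interior K := fun t ht => (h3 ht).1
    refine ⟨x, h1, h2, h4, h5, hout, ⟨fun t ht => by rw [sub_zero]; exact hout t ht, Or.inr
      ⟨h.turnsCcwOn hab.le h1 h3 h4 h5, fun η e1 e2 e3 e4 e5 => ?_⟩⟩, Or.inr ⟨⟨m, hm1, hm2⟩, h7⟩⟩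
    obtain ⟨ζ, f1, f2, f3, f4, f5⟩ := h.exists_cut hab.le e1
      (fun t ht => by have := e4 t ht; rwa [sub_zero] at this) (e2.trans h4) (e3.trans h5) e5
    exact (h6 ζ f1 f2 f3 f4).trans f5
  · push Not at hm
    obtain ⟨x, h1, h2, h3, h4, h5⟩ := exists_straight (p := p) (q := q) (Or.inl hab)
    have hout : ∀ t ∈ Icc a b, x t ∉ interior K := fun t ht => hm _ (h4 t ht)
    refine ⟨x, h1, by rw [h5]; exact edist_ne_top _ _, h2, h3, hout,
      ⟨fun t ht => by rw [sub_zero]; exact hout t ht, Or.inl (by rw [h5, h2, h3])⟩,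
      Or.inl fun t ht u => inner_segment_le (h4 t ht)⟩

theorem eVariationOn_const_add (c : Plane) (x : ℝ → Plane) (s : Set ℝ) :
    eVariationOn (fun t => c + x t) s = eVariationOn x s := by
  simp only [eVariationOn, edist_add_left]

theorem eVariationOn_neg (x : ℝ → Plane) (s : Set ℝ) :
    eVariationOn (fun t => -x t) s = eVariationOn x s := by
  simp only [eVariationOn, edist_neg_neg]

theorem TurnsCcwOn.translate {c c' : Plane} {x y : ℝ → Plane} {a b : ℝ} (h : TurnsCcwOn c x a b)
    (hxy : ∀ t ∈ Icc a b, y t - c' = x t - c) : TurnsCcwOn c' y a b := by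
  obtain ⟨ρ, φ, h1, h2, h3⟩ := h
  refine ⟨ρ, φ, h1, fun t ht => ⟨(h2 t ht).1, ?_⟩, h3⟩
  have := hxy t ht
  rw [(h2 t ht).2, add_sub_cancel_left, sub_eq_iff_eq_add'] at this
  exact this

theorem IsCcwShortestOn.translate {K : Set Plane} {x : ℝ → Plane} {a b : ℝ}
    (h : IsCcwShortestOn K 0 x a b) (c : Plane) {y : ℝ → Plane}
    (hy : ∀ t ∈ Icc a b, y t = c + x t) (hab : a ≤ b) : IsCcwShortestOn K c y a b := by
  have hvar : eVariationOn y (Icc a b) = eVariationOn x (Icc a b) := by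
    rw [eVariationOn.congr (g := fun t => c + x t) hy]
    exact eVariationOn_const_add c x _
  have haI := left_mem_Icc.2 hab
  have hbI := right_mem_Icc.2 hab
  refine ⟨fun t ht => ?_, ?_⟩
  · have := h.1 t ht
    rw [sub_zero] at this
    rwa [hy t ht, add_sub_cancel_left]
  · rcases h.2 with h2 | ⟨h2, h3⟩
    · left
      rw [hvar, h2, hy a haI, hy b hbI, edist_add_left]
    · refine Or.inr ⟨h2.translate fun t ht => ?_, fun η e1 e2 e3 e4 e5 => ?_⟩
      · rw [hy t ht, add_sub_cancel_left, sub_zero]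
      · rw [hvar]
        have := h3 (fun t => -c + η t) (continuousOn_const.add e1) (by
          rw [e2, hy a haI, neg_add_cancel_left]) (by rw [e3, hy b hbI, neg_add_cancel_left])
          (fun t ht => by
            have := e4 t ht
            beta_reduce
            rwa [sub_zero, neg_add_eq_sub]) (e5.translate fun t _ => by
            rw [sub_zero, neg_add_eq_sub])
        rwa [eVariationOn_const_add] at this

/-- The curve of `exists_isCcwShortestOn` reflected in the origin; it describes the motion of the
second robot relative to the first one. -/
theorem exists_isCcwShortestOn_neg {K : Set Plane} (hK : IsRobot K) {p q : Plane}
    (hp : p ∉ interior K) (hq : q ∉ interior K) {a b : ℝ} (hab : a < b) :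
    ∃ x : ℝ → Plane, ContinuousOn x (Icc a b) ∧ eVariationOn x (Icc a b) ≠ ⊤ ∧ x a = p ∧ x b = q ∧
      (∀ t ∈ Icc a b, x t ∉ interior K) ∧ IsCcwShortestOn K 0 (fun t => -x t) a b ∧
      ((∀ t ∈ Icc a b, ∀ u, inner ℝ (x t) u ≤ max (inner ℝ p u) (inner ℝ q u)) ∨
        (∃ m ∈ segment ℝ p q, m ∈ interior K) ∧
        ∀ t ∈ Icc a b, ∀ (u : Plane) (c : ℝ), inner ℝ p u ≤ c → inner ℝ q u ≤ c →
          (∀ k ∈ interior K, inner ℝ k (rot (q - p)) ≤ inner ℝ p (rot (q - p)) →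
            inner ℝ k u ≤ c) → inner ℝ (x t) u ≤ c) := by
  have hn : ∀ k, -k ∈ interior K → k ∈ interior K := fun k hk => by
    simpa using hK.neg_mem_interior hk
  have hrot : rot (-q - -p) = -rot (q - p) :=
    plane_ext (by simp; ring) (by simp; ring)
  obtain ⟨x, h1, h2, h3, h4, h5, h6, h7⟩ := exists_isCcwShortestOn hK (p := -p) (q := -q)
    (fun h => hp (hn p h)) (fun h => hq (hn q h)) hab
  refine ⟨fun t => -x t, h1.neg, ?_, by simp [h3], by simp [h4],
    fun t ht h => h5 t ht (hn _ h), by simpa only [neg_neg] using h6, ?_⟩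
  · rwa [eVariationOn_neg]
  · rcases h7 with h7 | ⟨⟨m, hm, hmK⟩, h7⟩
    · left
      intro t ht u
      have := h7 t ht (-u)
      rwa [inner_neg_neg, inner_neg_neg, inner_neg_right, ← inner_neg_left] at this
    · refine Or.inr ⟨⟨-m, ?_, hK.neg_mem_interior hmK⟩, fun t ht u c hp hq hk => ?_⟩
      · obtain ⟨a, b, ha, hb, hab, rfl⟩ := hm
        exact ⟨a, b, ha, hb, hab, by module⟩
      · have := h7 t ht (-u) c (by rwa [inner_neg_neg]) (by rwa [inner_neg_neg]) fun k hkK hle => by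
          rw [inner_neg_right, ← inner_neg_left]
          refine hk _ (hK.neg_mem_interior hkK) ?_
          rw [hrot, inner_neg_right, inner_neg_neg] at hle
          rwa [inner_neg_left]
        rwa [inner_neg_right, ← inner_neg_left] at this

/-! ### Bounds for a path around an obstacle -/

theorem rot_neg (d : Plane) : rot (-d) = -rot d :=
  plane_ext (by simp) (by simp)

/-- The coordinate `(a · d) (u · v) - (a · v) (u · d)`, which is proportional to the cross product
of `a` and `u` if `d`, `v` is an orthogonal frame. -/
def frameCross (d v a u : Plane) : ℝ :=
  inner ℝ a d * inner ℝ u v - inner ℝ a v * inner ℝ u d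

/-- The directions `u` in the half-plane `u · d ≤ 0` that `a` meets when it is turned away from `v`
towards `-v`. -/
def InArc (d v a u : Plane) : Prop := inner ℝ u d ≤ 0 ∧ 0 ≤ frameCross d v a u

section Frame

variable {ε : ℝ} {d v : Plane}

/-! For `ε = 1` the frame `d`, `v` with `v = ε • rot d` is positively oriented; `ε = -1` yields the mirror
images of all statements. -/

theorem frame_orthogonal (hv : v = ε • rot d) : inner ℝ v d = 0 := by
  rw [hv, real_inner_smul_left, real_inner_comm, inner_self_rot, mul_zero]

theorem inner_mul_frame (hε : ε * ε = 1) (hv : v = ε • rot d) (x u : Plane) :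
    inner ℝ d d * inner ℝ x u = inner ℝ x d * inner ℝ u d + inner ℝ x v * inner ℝ u v := by
  rw [hv]
  simp only [plane_inner, PiLp.smul_apply, smul_eq_mul, rot_zero_apply, rot_one_apply]
  linear_combination (-(x 0 * -d 1 + x 1 * d 0) * (u 0 * -d 1 + u 1 * d 0)) * hε

theorem frame_normSq (hε : ε * ε = 1) (hv : v = ε • rot d) : inner ℝ v v = inner ℝ d d := by
  rw [hv, real_inner_smul_left, real_inner_smul_right, inner_rot_rot]
  linear_combination inner ℝ d d * hε

theorem frameCross_eq (hv : v = ε • rot d) (a u : Plane) :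
    frameCross d v a u = inner ℝ d d * (ε * cross a u) := by
  rw [hv]
  simp only [frameCross, plane_inner, PiLp.smul_apply, smul_eq_mul, rot_zero_apply, rot_one_apply,
    cross]
  ring

/-- The decomposition of `u` along `v` and `n`, in terms of the values on `w`. -/
theorem frame_decomposition (hε : ε * ε = 1) (hv : v = ε • rot d) (w n u : Plane) :
    inner ℝ d d * (inner ℝ w u * inner ℝ n d - inner ℝ w n * inner ℝ u d) =
      inner ℝ w v * frameCross d v n u := by
  have h1 := inner_mul_frame hε hv w u
  have h2 := inner_mul_frame hε hv w n
  rw [frameCross]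
  linear_combination inner ℝ n d * h1 - inner ℝ u d * h2

theorem not_inArc_self (hε : ε * ε = 1) (hv : v = ε • rot d) (hd : 0 < inner ℝ d d) {a : Plane}
    (ha : inner ℝ a d < 0) : ¬ InArc d v a v := by
  rintro ⟨-, h⟩
  rw [frameCross, frame_orthogonal hv, frame_normSq hε hv] at h
  nlinarith

end Frame

/-- The alternative for a direction `u` at a path that goes around the obstacle from a point with
outer direction `a` to a point with outer direction `n`, displaced by `w`: the position of `u`
relative to `a`, `n` and `w`. -/
theorem cone_trichotomy {ε : ℝ} (hε : ε * ε = 1) {d a n w : Plane} (had : inner ℝ a d < 0)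
    (hnd : inner ℝ n d ≤ 0) (haw : inner ℝ a w < 0) (hnw : 0 < inner ℝ n w)
    (hwv : inner ℝ w (ε • rot d) ≤ 0) (u : Plane) :
    (inner ℝ u w ≤ 0 ∧ 0 ≤ ε * cross u a) ∨ (0 ≤ inner ℝ u w ∧ 0 ≤ ε * cross n u) ∨
      (0 < ε * cross a n ∧ 0 ≤ ε * cross a u ∧ 0 ≤ ε * cross u n ∧ inner ℝ u d ≤ 0) := by
  by_contra! hcon
  obtain ⟨h1, h2, h3⟩ := hcon
  have id1 : ε * cross a n * inner ℝ w (ε • rot d) =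
      -inner ℝ a w * inner ℝ n d + inner ℝ n w * inner ℝ a d := by
    simp only [plane_inner, cross, PiLp.smul_apply, smul_eq_mul, rot_zero_apply, rot_one_apply]
    linear_combination ((a 0 * n 1 - a 1 * n 0) * (w 0 * -d 1 + w 1 * d 0)) * hε
  have id2 : ∀ z : Plane, ε * cross a n * inner ℝ u z =
      ε * cross u n * inner ℝ a z + ε * cross a u * inner ℝ n z := by
    intro z
    simp only [plane_inner, cross]
    ring
  have hpos : 0 < ε * cross a n := by
    by_contra! hle
    have := mul_nonneg_of_nonpos_of_nonpos hle hwv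
    have h5 := mul_nonneg_of_nonpos_of_nonpos haw.le hnd
    have h6 := mul_neg_of_pos_of_neg hnw had
    linarith
  have hsw1 : ε * cross a u = -(ε * cross u a) := by simp only [cross]; ring
  have hsw2 : ε * cross u n = -(ε * cross n u) := by simp only [cross]; ring
  have key : 0 ≤ ε * cross a u ∧ 0 ≤ ε * cross u n := by
    have hw := id2 w
    rcases le_total (inner ℝ u w) 0 with hu | hu
    · have ha := h1 hu
      refine ⟨by linarith, ?_⟩
      by_contra! hlt
      have e1 := mul_pos_of_neg_of_neg hlt haw
      have e2 : 0 < ε * cross a u * inner ℝ n w := mul_pos (by linarith) hnw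
      have e3 := mul_nonpos_of_nonneg_of_nonpos hpos.le hu
      linarith
    · have hn := h2 hu
      refine ⟨?_, by linarith⟩
      by_contra! hlt
      have e1 := mul_neg_of_neg_of_pos hlt hnw
      have e2 : ε * cross u n * inner ℝ a w < 0 := mul_neg_of_pos_of_neg (by linarith) haw
      have e3 := mul_nonneg hpos.le hu
      linarith
  have hd := h3 hpos key.1 key.2
  have := id2 d
  have e1 := mul_nonpos_of_nonneg_of_nonpos key.2 had.le
  have e2 := mul_nonpos_of_nonneg_of_nonpos key.1 hnd
  have e3 := mul_pos hpos hd
  linarith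

/-- A point `x` is confined to the hull of `p`, `q` and the points of the obstacle on the side of
the line through `p` and `q` chosen by `ε`; if the line segment is free, to the segment. -/
def Confined (O : Set Plane) (ε : ℝ) (p q x : Plane) : Prop :=
  (∀ u, inner ℝ x u ≤ max (inner ℝ p u) (inner ℝ q u)) ∨
    (∃ m ∈ segment ℝ p q, m ∈ O) ∧
    ∀ (u : Plane) (c : ℝ), inner ℝ p u ≤ c → inner ℝ q u ≤ c →
      (∀ k ∈ O, inner ℝ k (ε • rot (q - p)) ≤ inner ℝ p (ε • rot (q - p)) → inner ℝ k u ≤ c) →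
      inner ℝ x u ≤ c

theorem Confined.le {O : Set Plane} {ε : ℝ} {p q x : Plane} (h : Confined O ε p q x) {u : Plane}
    {c : ℝ} (hp : inner ℝ p u ≤ c) (hq : inner ℝ q u ≤ c)
    (hk : ∀ k ∈ O, inner ℝ k (ε • rot (q - p)) ≤ inner ℝ p (ε • rot (q - p)) → inner ℝ k u ≤ c) :
    inner ℝ x u ≤ c := by
  rcases h with h | ⟨-, h⟩
  · exact (h u).trans (max_le hp hq)
  · exact h u c hp hq hk

theorem Confined.symm {O : Set Plane} {ε : ℝ} {p q x : Plane} (h : Confined O ε p q x) :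
    Confined O (-ε) q p x := by
  rcases h with h | ⟨⟨m, hm, hmO⟩, h⟩
  · exact Or.inl fun u => by rw [max_comm]; exact h u
  · refine Or.inr ⟨⟨m, segment_symm ℝ p q ▸ hm, hmO⟩, fun u c h1 h2 h3 => h u c h2 h1 ?_⟩
    intro k hk hle
    refine h3 k hk ?_
    have e : (-ε) • rot (p - q) = ε • rot (q - p) := by
      rw [← neg_sub q p, rot_neg, smul_neg, neg_smul, neg_neg]
    have e2 : inner ℝ q (rot (q - p)) = inner ℝ p (rot (q - p)) := by
      rw [← sub_eq_zero, ← inner_sub_left, inner_self_rot]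
    rw [real_inner_smul_right, real_inner_smul_right] at hle
    rwa [e, real_inner_smul_right, real_inner_smul_right, e2]

/-- One half of the data of the intermediate position: the first robot, relative to the second one,
goes from `p` to `y` and could go on to `r`; `d` is the displacement of the second robot, `v` is
orthogonal to `d`, and `a`, `n` are outer normals at `p` and `y`. The other half is of the same form,
with `d` reversed. -/
structure HalfData (O : Set Plane) (ε : ℝ) (d v p r y a n : Plane) : Prop where
  eps : ε * ε = 1
  v_eq : v = ε • rot d
  d_pos : 0 < inner ℝ d d
  a_lt : ∀ k ∈ O, inner ℝ k a < inner ℝ p a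
  a_d : inner ℝ a d < 0
  n_lt : ∀ k ∈ O, inner ℝ k n < inner ℝ y n
  n_p : inner ℝ p n ≤ inner ℝ y n
  n_r : inner ℝ r n ≤ inner ℝ y n
  n_d : inner ℝ n d ≤ 0
  y_p : inner ℝ y v ≤ inner ℝ p v
  y_r : inner ℝ y v ≤ inner ℝ r v
  exists_above : ∃ m ∈ O, inner ℝ y v ≤ inner ℝ m v
  y_a : inner ℝ y a ≤ max (inner ℝ p a) (inner ℝ r a)

namespace HalfData

variable {O : Set Plane} {ε : ℝ} {d v p r y a n : Plane}

/-- A direction `u` outside the arc lies between `v` and `a`, and `y` exceeds neither in the direction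
`v` nor in the direction `a` the farther one of `p` and `r`. -/
theorem inner_le_of_not_inArc (h : HalfData O ε d v p r y a n) {u : Plane}
    (hu : inner ℝ u d ≤ 0) (hI : ¬ InArc d v a u) :
    inner ℝ y u ≤ max (inner ℝ p u) (inner ℝ r u) := by
  have hX : frameCross d v a u < 0 := by
    by_contra! hle
    exact hI ⟨hu, hle⟩
  have key : ∀ z : Plane, inner ℝ y v ≤ inner ℝ z v → inner ℝ y a ≤ inner ℝ z a →
      inner ℝ y u ≤ inner ℝ z u := by
    intro z hz1 hz2
    have id := frame_decomposition h.eps h.v_eq (y - z) a u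
    simp only [inner_sub_left] at id
    have e1 : 0 ≤ (inner ℝ y v - inner ℝ z v) * frameCross d v a u :=
      mul_nonneg_of_nonpos_of_nonpos (by linarith) hX.le
    have e2 : 0 ≤ (inner ℝ y a - inner ℝ z a) * inner ℝ u d :=
      mul_nonneg_of_nonpos_of_nonpos (by linarith) hu
    have e3 := nonneg_of_mul_nonneg_right (id ▸ e1) h.d_pos
    by_contra! hlt
    have := mul_neg_of_pos_of_neg (sub_pos.2 hlt) h.a_d
    linarith
  rcases le_max_iff.1 h.y_a with h1 | h1
  · exact (key p h.y_p h1).trans (le_max_left _ _)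
  · exact (key r h.y_r h1).trans (le_max_right _ _)

/-- If in the direction `u` the obstacle reaches farther than `y` at a point that is not higher
than `y`, then the points `p` and `r` do not. -/
theorem inner_le_of_lt (h : HalfData O ε d v p r y a n) {u k : Plane} (hk : k ∈ O)
    (hkv : inner ℝ k v ≤ inner ℝ y v) (hku : inner ℝ y u < inner ℝ k u) (hu : inner ℝ u d ≤ 0) :
    inner ℝ p u ≤ inner ℝ y u ∧ inner ℝ r u ≤ inner ℝ y u := by
  have hkn := h.n_lt k hk
  have hd := h.d_pos
  -- `n` is not parallel to `v`, since the obstacle has points on both sides of the height of `y`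
  have hnd : inner ℝ n d < 0 := by
    refine h.n_d.lt_of_ne fun h0 => ?_
    obtain ⟨m, hm, hmv⟩ := h.exists_above
    have hmn := h.n_lt m hm
    have id : ∀ x : Plane, inner ℝ d d * inner ℝ x n = inner ℝ x v * inner ℝ n v := by
      intro x
      rw [inner_mul_frame h.eps h.v_eq, h0, mul_zero, zero_add]
    have e1 := mul_lt_mul_of_pos_left hkn hd
    have e2 := mul_lt_mul_of_pos_left hmn hd
    rw [id, id] at e1 e2
    rcases le_total (inner ℝ n v) 0 with h1 | h1 <;> nlinarith
  have key : ∀ z : Plane, inner ℝ z n ≤ inner ℝ y n → inner ℝ y v ≤ inner ℝ z v →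
      inner ℝ z u ≤ inner ℝ y u := by
    intro z hzn hzv
    by_contra! hlt
    have id1 := frame_decomposition h.eps h.v_eq (z - y) n u
    have id2 := frame_decomposition h.eps h.v_eq (k - y) n u
    simp only [inner_sub_left] at id1 id2
    have e1 := mul_neg_of_pos_of_neg (sub_pos.2 hlt) hnd
    have e2 : 0 ≤ (inner ℝ z n - inner ℝ y n) * inner ℝ u d :=
      mul_nonneg_of_nonpos_of_nonpos (by linarith) hu
    have e3 := mul_neg_of_pos_of_neg (sub_pos.2 hku) hnd
    have e4 : 0 ≤ (inner ℝ k n - inner ℝ y n) * inner ℝ u d :=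
      mul_nonneg_of_nonpos_of_nonpos (by linarith) hu
    have f1 := mul_neg_of_pos_of_neg hd (by linarith : (inner ℝ z u - inner ℝ y u) * inner ℝ n d -
      (inner ℝ z n - inner ℝ y n) * inner ℝ u d < 0)
    have f2 := mul_neg_of_pos_of_neg hd (by linarith : (inner ℝ k u - inner ℝ y u) * inner ℝ n d -
      (inner ℝ k n - inner ℝ y n) * inner ℝ u d < 0)
    rw [id1] at f1
    rw [id2] at f2
    rcases le_total (frameCross d v n u) 0 with h1 | h1 <;> nlinarith
  exact ⟨key p h.n_p h.y_p, key r h.n_r h.y_r⟩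

/-- A direction in which the obstacle reaches farther than `y`, at a point not higher than `y`, lies
in the arc: otherwise it would lie between `v` and `a`, and `p` would be farther than `y`. -/
theorem inArc_of_lt (h : HalfData O ε d v p r y a n) {u k : Plane} (hk : k ∈ O)
    (hkv : inner ℝ k v ≤ inner ℝ y v) (hku : inner ℝ y u < inner ℝ k u) (hu : inner ℝ u d ≤ 0) :
    InArc d v a u := by
  refine ⟨hu, ?_⟩
  by_contra! hX
  have hd := h.d_pos
  have hpu := (h.inner_le_of_lt hk hkv hku hu).1
  have id1 := frame_decomposition h.eps h.v_eq (k - y) a u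
  have id2 := frame_decomposition h.eps h.v_eq (p - y) a u
  simp only [inner_sub_left] at id1 id2
  have e1 : 0 ≤ (inner ℝ k v - inner ℝ y v) * frameCross d v a u :=
    mul_nonneg_of_nonpos_of_nonpos (by linarith) hX.le
  have e2 := nonneg_of_mul_nonneg_right (id1 ▸ e1) hd
  have e3 := mul_neg_of_pos_of_neg (sub_pos.2 hku) h.a_d
  have e4 : (inner ℝ k a - inner ℝ y a) * inner ℝ u d < 0 := by linarith
  have hud : inner ℝ u d < 0 := hu.lt_of_ne fun h0 => by rw [h0, mul_zero] at e4; exact e4.false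
  have hka : 0 < inner ℝ k a - inner ℝ y a := by
    by_contra! hle
    have := mul_nonneg_of_nonpos_of_nonpos hle hu
    linarith
  have hpa : 0 < inner ℝ p a - inner ℝ y a := by linarith [h.a_lt k hk]
  have e5 := mul_neg_of_pos_of_neg hpa hud
  have e6 : (inner ℝ p v - inner ℝ y v) * frameCross d v a u ≤ 0 :=
    mul_nonpos_of_nonneg_of_nonpos (by linarith [h.y_p]) hX.le
  have e7 := nonpos_of_mul_nonpos_right (id2 ▸ e6) hd
  have e8 : 0 ≤ (inner ℝ p u - inner ℝ y u) * inner ℝ a d :=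
    mul_nonneg_of_nonpos_of_nonpos (by linarith) h.a_d.le
  linarith

/-- The path from `p` to `y` reaches farther than its end points only in directions of the arc
for which `y` is at least as far as the part of the obstacle not higher than `y`. -/
theorem confined_dichotomy (h : HalfData O ε d v p r y a n) {x : Plane} (hx : Confined O ε p y x)
    (u : Plane) : inner ℝ x u ≤ max (inner ℝ p u) (inner ℝ y u) ∨
      (InArc d v a u ∧ ∀ k ∈ O, inner ℝ k v ≤ inner ℝ y v → inner ℝ k u ≤ inner ℝ y u) := by
  rcases hx with hx | ⟨⟨m, hm, hmO⟩, hx⟩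
  · exact Or.inl (hx u)
  have hd := h.d_pos
  have haw : inner ℝ a (y - p) < 0 := by
    have h1 := inner_segment_le (u := -a) hm
    simp only [inner_neg_right] at h1
    have h2 := h.a_lt m hmO
    rw [inner_sub_right, real_inner_comm, real_inner_comm p a]
    rcases le_max_iff.1 h1 with h3 | h3 <;> linarith
  have hnw : 0 < inner ℝ n (y - p) := by
    have h1 := inner_segment_le (u := -n) hm
    simp only [inner_neg_right] at h1
    have h2 := h.n_lt m hmO
    rw [inner_sub_right, real_inner_comm, real_inner_comm p n]
    rcases le_max_iff.1 h1 with h3 | h3 <;> linarith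
  have hwv : inner ℝ (y - p) (ε • rot d) ≤ 0 := by
    rw [← h.v_eq, inner_sub_left]
    linarith [h.y_p]
  set w := y - p with hw
  -- decomposition of `u` along the right normal and `b`
  have id : ∀ b z : Plane, inner ℝ z u * inner ℝ b w =
      inner ℝ z b * inner ℝ u w + inner ℝ z (ε • rot w) * (ε * cross b u) := by
    intro b z
    simp only [plane_inner, cross, PiLp.smul_apply, smul_eq_mul, rot_zero_apply, rot_one_apply]
    linear_combination (-(z 0 * w 1 - z 1 * w 0) * (u 0 * b 1 - u 1 * b 0)) * h.eps
  have hyw : inner ℝ y (ε • rot w) = inner ℝ p (ε • rot w) := by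
    rw [← sub_eq_zero, ← inner_sub_left, ← hw, real_inner_smul_right, inner_self_rot, mul_zero]
  rcases cone_trichotomy h.eps h.a_d h.n_d haw hnw hwv u with ⟨h1, h2⟩ | ⟨h1, h2⟩ | ⟨-, h1, h2, h3⟩
  · left
    refine hx u _ (le_max_left _ _) (le_max_right _ _) fun k hk hkw => le_max_of_le_left ?_
    have e := id a (k - p)
    simp only [inner_sub_left] at e
    have e1 : 0 ≤ (inner ℝ k a - inner ℝ p a) * inner ℝ u w :=
      mul_nonneg_of_nonpos_of_nonpos (by linarith [h.a_lt k hk]) h1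
    have e2 : 0 ≤ (inner ℝ k (ε • rot w) - inner ℝ p (ε • rot w)) * (ε * cross a u) := by
      refine mul_nonneg_of_nonpos_of_nonpos (by linarith) ?_
      have : ε * cross a u = -(ε * cross u a) := by simp only [cross]; ring
      linarith
    by_contra! hlt
    have := mul_neg_of_pos_of_neg (sub_pos.2 hlt) haw
    linarith
  · left
    refine hx u _ (le_max_left _ _) (le_max_right _ _) fun k hk hkw => le_max_of_le_right ?_
    have e := id n (k - y)
    simp only [inner_sub_left] at e
    have e1 : (inner ℝ k n - inner ℝ y n) * inner ℝ u w ≤ 0 :=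
      mul_nonpos_of_nonpos_of_nonneg (by linarith [h.n_lt k hk]) h1
    have e2 : (inner ℝ k (ε • rot w) - inner ℝ y (ε • rot w)) * (ε * cross n u) ≤ 0 :=
      mul_nonpos_of_nonpos_of_nonneg (by linarith) h2
    by_contra! hlt
    have := mul_pos (sub_pos.2 hlt) hnw
    linarith
  · refine Or.inr ⟨⟨h3, ?_⟩, fun k hk hkv => ?_⟩
    · rw [frameCross_eq h.v_eq]
      exact mul_nonneg hd.le h1
    · have hkn := h.n_lt k hk
      rcases h.n_d.lt_or_eq with hnd | hnd
      · have e := frame_decomposition h.eps h.v_eq (k - y) n u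
        simp only [inner_sub_left] at e
        have hX : frameCross d v n u ≤ 0 := by
          rw [frameCross_eq h.v_eq]
          have : ε * cross n u = -(ε * cross u n) := by simp only [cross]; ring
          nlinarith
        have e1 : 0 ≤ (inner ℝ k v - inner ℝ y v) * frameCross d v n u :=
          mul_nonneg_of_nonpos_of_nonpos (by linarith) hX
        have e2 := nonneg_of_mul_nonneg_right (e ▸ e1) hd
        have e3 : 0 ≤ (inner ℝ k n - inner ℝ y n) * inner ℝ u d :=
          mul_nonneg_of_nonpos_of_nonpos (by linarith) h3
        by_contra! hlt
        have := mul_neg_of_pos_of_neg (sub_pos.2 hlt) hnd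
        linarith
      · -- then `n` points along `-v`, and the obstacle lies above `y`
        have id' : ∀ x : Plane, inner ℝ d d * inner ℝ x n = inner ℝ x v * inner ℝ n v := by
          intro x
          rw [inner_mul_frame h.eps h.v_eq, hnd, mul_zero, zero_add]
        have e1 := mul_pos hd hnw
        rw [real_inner_comm w n, id'] at e1
        rw [← h.v_eq] at hwv
        have e2 : inner ℝ n v < 0 := by
          by_contra! hle
          have := mul_nonpos_of_nonpos_of_nonneg hwv hle
          linarith
        have e3 := mul_lt_mul_of_pos_left hkn hd
        rw [id', id'] at e3
        nlinarith

end HalfData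

/-! ### The intermediate position -/

theorem inner_le_of_mem_closure_convexHull {S : Set Plane} {u : Plane} {c : ℝ}
    (h : ∀ z ∈ S, inner ℝ z u ≤ c) {x : Plane} (hx : x ∈ closure (convexHull ℝ S)) :
    inner ℝ x u ≤ c := by
  have hcl : IsClosed {z : Plane | inner ℝ z u ≤ c} := isClosed_le (by fun_prop) continuous_const
  have hcv : Convex ℝ {z : Plane | inner ℝ z u ≤ c} :=
    convex_halfSpace_le ⟨fun x y => inner_add_left x y u, fun r x => real_inner_smul_left x u r⟩ c
  exact closure_minimal (convexHull_min h hcv) hcl hx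

/-- The end points of a lowest chord with displacement `d` of a convex set lie on its boundary:
otherwise the chord could be moved down, by moving the other end point inside the set. -/
theorem notMem_interior_of_lowest_chord {C : Set Plane} (hC : Convex ℝ C) {d v y : Plane}
    (hvd : inner ℝ d v = 0) (hv : 0 < inner ℝ v v) (hy' : y + d ∈ C)
    (hmin : ∀ z ∈ C, z + d ∈ C → inner ℝ y v ≤ inner ℝ z v) : y ∉ interior C := by
  intro hint
  have hev : ∀ z : Plane, ∃ ε : ℝ, 0 < ε ∧ ε < 1 ∧ y + ε • z ∈ interior C := by
    intro z
    have hc : Tendsto (fun ε : ℝ => y + ε • z) (𝓝[>] 0) (𝓝 y) := by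
      have : Continuous fun ε : ℝ => y + ε • z := by fun_prop
      have := this.tendsto 0
      rw [zero_smul, add_zero] at this
      exact this.mono_left nhdsWithin_le_nhds
    obtain ⟨ε, h1, h2⟩ := ((hc.eventually (isOpen_interior.mem_nhds hint)).and
      (Ioo_mem_nhdsGT (zero_lt_one (α := ℝ)))).exists
    exact ⟨ε, h2.1, h2.2, h1⟩
  by_cases hz : ∃ z ∈ C, inner ℝ z v < inner ℝ (y + d) v
  · obtain ⟨z, hz, hlt⟩ := hz
    obtain ⟨ε, h0, h1, h2⟩ := hev (z - (y + d))
    have h3 := hmin _ (interior_subset h2) (by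
      have := hC hy' hz (sub_nonneg.2 h1.le) h0.le (by ring)
      convert this using 1
      module)
    rw [inner_add_left, real_inner_smul_left, inner_sub_left] at h3
    nlinarith
  · push Not at hz
    obtain ⟨ε, h0, h1, h2⟩ := hev (-v)
    have h3 := hz _ (interior_subset h2)
    rw [inner_add_left, inner_add_left, hvd, real_inner_smul_left, inner_neg_left] at h3
    nlinarith

/-- The position `y`, the displaced position `y + d`, and outer normals `n` at `y` and `n'` at
`y + d`: the lowest chord in the hull of the obstacle and the four corners of a parallelogram. -/
theorem exists_lowest_chord {O : Set Plane} (hO : IsOpen O) (hb : Bornology.IsBounded O)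
    (hne : O.Nonempty) (p r d v : Plane) (hvd : inner ℝ d v = 0) (hv : 0 < inner ℝ v v) :
    ∃ y n n' : Plane, (∀ k ∈ O, inner ℝ k n < inner ℝ y n) ∧
      inner ℝ p n ≤ inner ℝ y n ∧ inner ℝ r n ≤ inner ℝ y n ∧ inner ℝ n d ≤ 0 ∧
      (∀ k ∈ O, inner ℝ k n' < inner ℝ (y + d) n') ∧
      inner ℝ (p + d) n' ≤ inner ℝ (y + d) n' ∧ inner ℝ (r + d) n' ≤ inner ℝ (y + d) n' ∧
      0 ≤ inner ℝ n' d ∧ inner ℝ y v ≤ inner ℝ p v ∧ inner ℝ y v ≤ inner ℝ r v ∧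
      ∀ u c, (∀ k ∈ O, inner ℝ k u ≤ c) → inner ℝ p u ≤ c → inner ℝ r u ≤ c →
        inner ℝ (p + d) u ≤ c → inner ℝ (r + d) u ≤ c →
        inner ℝ y u ≤ c ∧ inner ℝ (y + d) u ≤ c := by
  set S : Set Plane := O ∪ {p, r, p + d, r + d} with hS
  set C := closure (convexHull ℝ S) with hCdef
  have hSC : S ⊆ C := (subset_convexHull ℝ S).trans subset_closure
  have hC : Convex ℝ C := (convex_convexHull ℝ S).closure
  have hpC : p ∈ C := hSC (Or.inr (by simp))
  have hrC : r ∈ C := hSC (Or.inr (by simp))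
  have hpC' : p + d ∈ C := hSC (Or.inr (by simp))
  have hrC' : r + d ∈ C := hSC (Or.inr (by simp))
  have hOC : O ⊆ interior C := interior_maximal (subset_union_left.trans hSC) hO
  have hcomp : IsCompact C := by
    refine Metric.isCompact_of_isClosed_isBounded isClosed_closure (Bornology.IsBounded.closure ?_)
    rw [isBounded_convexHull]
    exact hb.union (Set.toFinite _).isBounded
  have hF : IsCompact (C ∩ {z | z + d ∈ C}) :=
    hcomp.inter_right (isClosed_closure.preimage (continuous_id.add continuous_const))
  obtain ⟨y, ⟨hy, hy'⟩, hmin⟩ := hF.exists_isMinOn ⟨p, hpC, hpC'⟩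
    (f := fun z : Plane => inner ℝ z v) (by fun_prop)
  have hmin' : ∀ z ∈ C, z + d ∈ C → inner ℝ y v ≤ inner ℝ z v := fun z h1 h2 => hmin ⟨h1, h2⟩
  have hne' : (interior C).Nonempty := hne.mono hOC
  have hcl : C ⊆ closure (interior C) := by
    rw [hC.closure_interior_eq_closure_of_nonempty_interior hne']
    exact subset_closure
  -- a supporting half-plane at a boundary point
  have hsupp : ∀ x ∉ interior C, ∃ n : Plane, (∀ k ∈ O, inner ℝ k n < inner ℝ x n) ∧
      ∀ z ∈ C, inner ℝ z n ≤ inner ℝ x n := by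
    intro x hx
    obtain ⟨n, hn0, hn⟩ := exists_separating isOpen_interior hC.interior hne' hx
    refine ⟨n, fun k hk => inner_lt_of_mem_interior hn0 (fun z hz => hn z hz)
      (by rw [interior_interior]; exact hOC hk), fun z hz => ?_⟩
    exact closure_minimal (fun z hz => hn z hz)
      (isClosed_le (f := fun z : Plane => inner ℝ z n) (by fun_prop) continuous_const) (hcl hz)
  obtain ⟨n, hn1, hn2⟩ := hsupp y (notMem_interior_of_lowest_chord hC hvd hv hy' hmin')
  obtain ⟨n', hn1', hn2'⟩ := hsupp (y + d) (notMem_interior_of_lowest_chord hC (d := -d)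
    (by rw [inner_neg_left, hvd, neg_zero]) hv (by rwa [add_neg_cancel_right]) fun z h1 h2 => by
      have := hmin' _ h2 (by rwa [neg_add_cancel_right])
      rw [inner_add_left, inner_neg_left, hvd] at this
      rw [inner_add_left, hvd]
      linarith)
  refine ⟨y, n, n', hn1, hn2 p hpC, hn2 r hrC, ?_, hn1', hn2' _ hpC', hn2' _ hrC', ?_,
    hmin' p hpC hpC', hmin' r hrC hrC', ?_⟩
  · have := hn2 _ hy'
    rw [inner_add_left, real_inner_comm n d] at this
    linarith
  · have := hn2' _ hy
    rw [inner_add_left, real_inner_comm n' d] at this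
    linarith
  · intro u c h1 h2 h3 h4 h5
    have : ∀ z ∈ S, inner ℝ z u ≤ c := by
      rintro z (hz | rfl | rfl | rfl | rfl)
      exacts [h1 z hz, h2, h3, h4, h5]
    exact ⟨inner_le_of_mem_closure_convexHull this hy, inner_le_of_mem_closure_convexHull this hy'⟩

/-! ### Relative motions in three steps -/

/-- The sum of the advances of the first path and of the middle path in a direction `u` is bounded
by those of the corner points, unless `u` lies in the arc. -/
theorem HalfData.add_sub_le {O : Set Plane} {ε : ℝ} {d v p r y a n : Plane}
    (h : HalfData O ε d v p r y a n) {x₁ x₂ u : Plane} {c : ℝ} (hx₁ : Confined O ε p y x₁)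
    (hp : inner ℝ p u ≤ c) (hpd : inner ℝ p u + inner ℝ d u ≤ c) (hy : inner ℝ y u ≤ c)
    (hyd : inner ℝ y u + inner ℝ d u ≤ c) (hI : InArc d v a u → ∀ k ∈ O, inner ℝ k u ≤ c)
    (hx₂ : ∀ c', inner ℝ y u ≤ c' → inner ℝ y u + inner ℝ d u ≤ c' →
      (∀ k ∈ O, inner ℝ k v ≤ inner ℝ y v → inner ℝ k u ≤ c') → inner ℝ x₂ u ≤ c')
    (hfar : ∀ k ∈ O, inner ℝ k v ≤ inner ℝ y v → inner ℝ y u < inner ℝ k u →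
      inner ℝ y u + inner ℝ d u < inner ℝ k u → inner ℝ p u ≤ inner ℝ y u ∧ inner ℝ x₂ u ≤ c) :
    inner ℝ (x₁ + x₂ - y) u ≤ c := by
  rw [inner_sub_left, inner_add_left]
  rcases h.confined_dichotomy hx₁ u with h1 | ⟨h1, h2⟩
  · by_cases hk : ∃ k ∈ O, inner ℝ k v ≤ inner ℝ y v ∧ inner ℝ y u < inner ℝ k u ∧
        inner ℝ y u + inner ℝ d u < inner ℝ k u
    · obtain ⟨k, hkO, hkv, h3, h4⟩ := hk
      obtain ⟨h5, h6⟩ := hfar k hkO hkv h3 h4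
      rw [max_eq_right h5] at h1
      linarith
    · push Not at hk
      have h3 := hx₂ (max (inner ℝ y u) (inner ℝ y u + inner ℝ d u)) (le_max_left _ _)
        (le_max_right _ _) fun k hkO hkv => by
          by_contra! hlt
          exact absurd (hk k hkO hkv ((le_max_left _ _).trans_lt hlt))
            (not_le.2 ((le_max_right _ _).trans_lt hlt))
      rcases le_max_iff.1 h1 with h1 | h1 <;> rcases le_max_iff.1 h3 with h3 | h3 <;> linarith
  · have h3 : inner ℝ x₁ u ≤ c := hx₁.le hp hy fun k hk _ => hI h1 k hk
    have h4 := hx₂ (inner ℝ y u) le_rfl (by rw [real_inner_comm u d]; linarith [h1.1]) h2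
    linarith

/-- A relative motion in three steps around `K`, from `p` over `y` and `y + d` to `q`. In the second
step it is the other robot that moves, which reflects the path. The bounds express that the path goes
beyond its corner points only in the directions between `a` and `b`. -/
structure IsThreeStep (K : Set Plane) (p q d a b y : Plane) (x₁ x₂ x₃ : ℝ → Plane) : Prop where
  continuousOn₁ : ContinuousOn x₁ (Icc 0 (1 / 3))
  continuousOn₂ : ContinuousOn x₂ (Icc (1 / 3) (2 / 3))
  continuousOn₃ : ContinuousOn x₃ (Icc (2 / 3) 1)
  variation₁ : eVariationOn x₁ (Icc 0 (1 / 3)) ≠ ⊤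
  variation₂ : eVariationOn x₂ (Icc (1 / 3) (2 / 3)) ≠ ⊤
  variation₃ : eVariationOn x₃ (Icc (2 / 3) 1) ≠ ⊤
  start₁ : x₁ 0 = p
  finish₁ : x₁ (1 / 3) = y
  start₂ : x₂ (1 / 3) = y
  finish₂ : x₂ (2 / 3) = y + d
  start₃ : x₃ (2 / 3) = y + d
  finish₃ : x₃ 1 = q
  avoids₁ : ∀ t ∈ Icc (0 : ℝ) (1 / 3), x₁ t ∉ interior K
  avoids₂ : ∀ t ∈ Icc (1 / 3 : ℝ) (2 / 3), x₂ t ∉ interior K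
  avoids₃ : ∀ t ∈ Icc (2 / 3 : ℝ) 1, x₃ t ∉ interior K
  shortest₁ : IsCcwShortestOn K 0 x₁ 0 (1 / 3)
  shortest₂ : IsCcwShortestOn K 0 (fun t => -x₂ t) (1 / 3) (2 / 3)
  shortest₃ : IsCcwShortestOn K 0 x₃ (2 / 3) 1
  bound : ∀ (u : Plane) (c : ℝ), inner ℝ p u ≤ c → inner ℝ (p + d) u ≤ c →
    inner ℝ (q - d) u ≤ c → inner ℝ q u ≤ c →
    (InArc d (rot d) a u ∨ InArc (-d) (rot d) b u → ∀ k ∈ interior K, inner ℝ k u ≤ c) →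
    ∀ s ∈ Icc (1 / 3 : ℝ) (2 / 3),
      (∀ t ∈ Icc (0 : ℝ) (1 / 3), inner ℝ (x₁ t + x₂ s - y) u ≤ c) ∧
      ∀ t ∈ Icc (2 / 3 : ℝ) 1, inner ℝ (x₃ t + x₂ s - (y + d)) u ≤ c
  bound₁ : ∀ u, ¬ InArc d (rot d) a u → ∀ t ∈ Icc (0 : ℝ) (1 / 3),
    inner ℝ (x₁ t) u ≤ max (inner ℝ p u) (inner ℝ y u)
  bound₂ : ∀ t ∈ Icc (1 / 3 : ℝ) (2 / 3), inner ℝ (x₂ t) (rot d) ≤ inner ℝ y (rot d)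
  bound₃ : ∀ u, ¬ InArc (-d) (rot d) b u → ∀ t ∈ Icc (2 / 3 : ℝ) 1,
    inner ℝ (x₃ t) u ≤ max (inner ℝ q u) (inner ℝ (y + d) u)
  y_left : inner ℝ y (rot d) ≤ inner ℝ p (rot d)
  y_right : inner ℝ y (rot d) ≤ inner ℝ q (rot d)
  y_a : inner ℝ y a ≤ max (inner ℝ p a) (inner ℝ (q - d) a)
  y_b : inner ℝ (y + d) b ≤ max (inner ℝ q b) (inner ℝ (p + d) b)

theorem exists_isThreeStep {K : Set Plane} (hK : IsRobot K) {p q d a b : Plane}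
    (hp : p ∉ interior K) (hq : q ∉ interior K) (ha : ∀ k ∈ interior K, inner ℝ k a < inner ℝ p a)
    (had : inner ℝ a d < 0) (hb : ∀ k ∈ interior K, inner ℝ k b < inner ℝ q b)
    (hbd : 0 < inner ℝ b d)
    (hm : ∃ m ∈ interior K, inner ℝ m (rot d) = inner ℝ p (rot d) ∨
      inner ℝ m (rot d) = inner ℝ q (rot d)) :
    ∃ y x₁ x₂ x₃, IsThreeStep K p q d a b y x₁ x₂ x₃ := by
  have hd : 0 < inner ℝ d d := by
    refine real_inner_self_pos.2 fun h0 => ?_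
    rw [h0, inner_zero_right] at had
    exact had.false
  have hdv : inner ℝ d (rot d) = 0 := inner_self_rot d
  have hrv : inner ℝ (q - d) (rot d) = inner ℝ q (rot d) := by rw [inner_sub_left, hdv, sub_zero]
  obtain ⟨y, n, n', hn, hnp, hnr, hnd, hn', hnp', hnr', hnd', hyp, hyr, hhalf⟩ :=
    exists_lowest_chord isOpen_interior (hK.bounded.subset interior_subset)
      ⟨0, hK.zero_mem_interior⟩ p (q - d) d (rot d) hdv (by rwa [inner_rot_rot])
  rw [sub_add_cancel] at hnr' hhalf
  have hya : inner ℝ y a ≤ max (inner ℝ p a) (inner ℝ (q - d) a) := by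
    rw [real_inner_comm] at had
    refine (hhalf a _ (fun k hk => le_max_of_le_left (ha k hk).le) (le_max_left _ _)
      (le_max_right _ _) (le_max_of_le_left ?_) (le_max_of_le_right ?_)).1
    · rw [inner_add_left]; linarith
    · rw [inner_sub_left]; linarith
  have hyb : inner ℝ (y + d) b ≤ max (inner ℝ q b) (inner ℝ (p + d) b) := by
    rw [real_inner_comm] at hbd
    refine (hhalf b _ (fun k hk => le_max_of_le_left (hb k hk).le) (le_max_of_le_right ?_)
      (le_max_of_le_left ?_) (le_max_right _ _) (le_max_left _ _)).2
    · rw [inner_add_left]; linarith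
    · rw [inner_sub_left]; linarith
  have hyv : inner ℝ (y + d) (rot d) = inner ℝ y (rot d) := by rw [inner_add_left, hdv, add_zero]
  obtain ⟨m, hmK, hm⟩ := hm
  have hmv : inner ℝ y (rot d) ≤ inner ℝ m (rot d) := by
    rcases hm with h | h
    · rw [h]; exact hyp
    · rw [h, ← hrv]; exact hyr
  have h₁ : HalfData (interior K) 1 d (rot d) p (q - d) y a n :=
    ⟨by ring, by rw [one_smul], hd, ha, had, hn, hnp, hnr, hnd, hyp, hyr, ⟨m, hmK, hmv⟩, hya⟩
  have h₂ : HalfData (interior K) (-1) (-d) (rot d) q (p + d) (y + d) b n' :=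
    ⟨by ring, by rw [rot_neg, smul_neg, neg_smul, neg_neg, one_smul], by rwa [inner_neg_neg], hb,
      by rwa [inner_neg_right, neg_lt_zero], hn', hnr', hnp', by rwa [inner_neg_right, neg_nonpos],
      by rw [hyv, ← hrv]; exact hyr, by rw [hyv, inner_add_left, hdv, add_zero]; exact hyp,
      ⟨m, hmK, by rwa [hyv]⟩, hyb⟩
  have hy : y ∉ interior K := fun h => (hn y h).false
  have hy' : y + d ∉ interior K := fun h => (hn' _ h).false
  obtain ⟨x₁, a1, a2, a3, a4, a5, a6, a7⟩ := exists_isCcwShortestOn hK hp hy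
    (show (0 : ℝ) < 1 / 3 by norm_num)
  obtain ⟨x₂, b1, b2, b3, b4, b5, b6, b7⟩ := exists_isCcwShortestOn_neg hK hy hy'
    (show (1 / 3 : ℝ) < 2 / 3 by norm_num)
  obtain ⟨x₃, c1, c2, c3, c4, c5, c6, c7⟩ := exists_isCcwShortestOn hK hy' hq
    (show (2 / 3 : ℝ) < 1 by norm_num)
  have hconf₁ : ∀ t ∈ Icc (0 : ℝ) (1 / 3), Confined (interior K) 1 p y (x₁ t) := by
    intro t ht
    rcases a7 with h | ⟨h, h'⟩
    · exact Or.inl (h t ht)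
    · exact Or.inr ⟨h, by rw [one_smul]; exact h' t ht⟩
  have hconf₂ : ∀ t ∈ Icc (1 / 3 : ℝ) (2 / 3), ∀ (u : Plane) (c : ℝ), inner ℝ y u ≤ c →
      inner ℝ (y + d) u ≤ c → (∀ k ∈ interior K, inner ℝ k (rot d) ≤ inner ℝ y (rot d) →
        inner ℝ k u ≤ c) → inner ℝ (x₂ t) u ≤ c := by
    intro t ht u c e1 e2 e3
    rw [add_sub_cancel_left] at b7
    rcases b7 with h | ⟨-, h'⟩
    · exact (h t ht u).trans (max_le e1 e2)
    · exact h' t ht u c e1 e2 e3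
  have hconf₃ : ∀ t ∈ Icc (2 / 3 : ℝ) 1, Confined (interior K) (-1) q (y + d) (x₃ t) := by
    intro t ht
    refine Confined.symm ?_
    rcases c7 with h | ⟨h, h'⟩
    · exact Or.inl (h t ht)
    · exact Or.inr ⟨h, by rw [one_smul]; exact h' t ht⟩
  refine ⟨y, x₁, x₂, x₃, ⟨a1, b1, c1, a2, b2, c2, a3, a4, b3, b4, c3, c4, a5, b5, c5, a6, b6, c6,
    ?_, ?_, ?_, ?_, hyp, by rw [← hrv]; exact hyr, hya, hyb⟩⟩
  · intro u c hpc hpdc hqdc hqc hI s hs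
    have hcd : inner ℝ u d = inner ℝ d u := real_inner_comm _ _
    have hpdc' := hpdc
    have hqdc' := hqdc
    rw [inner_add_left] at hpdc'
    rw [inner_sub_left] at hqdc'
    -- the corner points of the path
    have hyc : inner ℝ y u ≤ c ∧ inner ℝ (y + d) u ≤ c := by
      by_cases hu : InArc d (rot d) a u ∨ InArc (-d) (rot d) b u
      · exact hhalf u c (hI hu) hpc hqdc hpdc hqc
      · push Not at hu
        rw [inner_add_left]
        rcases le_total (inner ℝ u d) 0 with h0 | h0
        · have := (h₁.inner_le_of_not_inArc h0 hu.1).trans (max_le hpc hqdc)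
          constructor <;> linarith
        · have := (h₂.inner_le_of_not_inArc (by rw [inner_neg_right]; linarith) hu.2).trans
            (max_le hqc hpdc)
          rw [inner_add_left] at this
          constructor <;> linarith
    have hycd := hyc.2
    rw [inner_add_left] at hycd
    -- directions in which the obstacle goes beyond the middle path
    have hfar : ∀ k ∈ interior K, inner ℝ k (rot d) ≤ inner ℝ y (rot d) →
        inner ℝ y u < inner ℝ k u → inner ℝ (y + d) u < inner ℝ k u →
        inner ℝ p u ≤ inner ℝ y u ∧ inner ℝ q u ≤ inner ℝ (y + d) u ∧ inner ℝ (x₂ s) u ≤ c := by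
      intro k hk hkv hk1 hk2
      rcases le_total (inner ℝ u d) 0 with h0 | h0
      · obtain ⟨f1, f2⟩ := h₁.inner_le_of_lt hk hkv hk1 h0
        refine ⟨f1, ?_, hconf₂ s hs u c hyc.1 hyc.2 fun k' hk' _ =>
          hI (Or.inl (h₁.inArc_of_lt hk hkv hk1 h0)) k' hk'⟩
        rw [inner_sub_left] at f2
        rw [inner_add_left]
        linarith
      · have h0' : inner ℝ u (-d) ≤ 0 := by rw [inner_neg_right]; linarith
        rw [← hyv] at hkv
        obtain ⟨f1, f2⟩ := h₂.inner_le_of_lt hk hkv hk2 h0'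
        refine ⟨?_, f1, hconf₂ s hs u c hyc.1 hyc.2 fun k' hk' _ =>
          hI (Or.inr (h₂.inArc_of_lt hk hkv hk2 h0')) k' hk'⟩
        rw [inner_add_left, inner_add_left] at f2
        linarith
    constructor
    · intro t ht
      refine h₁.add_sub_le (hconf₁ t ht) hpc hpdc' hyc.1 hycd (fun h => hI (Or.inl h)) ?_ ?_
      · intro c' e1 e2 e3
        exact hconf₂ s hs u c' e1 (by rwa [inner_add_left]) e3
      · intro k hk hkv hk1 hk2
        have := hfar k hk hkv hk1 (by rwa [inner_add_left])
        exact ⟨this.1, this.2.2⟩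
    · intro t ht
      have hback : inner ℝ (y + d) u + inner ℝ (-d) u = inner ℝ y u := by
        rw [inner_add_left, inner_neg_left]; ring
      refine h₂.add_sub_le (hconf₃ t ht) hqc ?_ hyc.2 (by rw [hback]; exact hyc.1)
        (fun h => hI (Or.inr h)) ?_ ?_
      · rw [inner_neg_left]; linarith
      · intro c' e1 e2 e3
        rw [hback] at e2
        exact hconf₂ s hs u c' e2 e1 (by rwa [hyv] at e3)
      · intro k hk hkv hk1 hk2
        rw [hback] at hk2
        rw [hyv] at hkv
        exact (hfar k hk hkv hk2 hk1).2
  · intro u hu t ht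
    rcases h₁.confined_dichotomy (hconf₁ t ht) u with h | h
    · exact h
    · exact absurd h.1 hu
  · intro t ht
    exact hconf₂ t ht _ _ le_rfl hyv.le fun k _ hk => hk
  · intro u hu t ht
    rcases h₂.confined_dichotomy (hconf₃ t ht) u with h | h
    · exact h
    · exact absurd h.1 hu

/-! ### From the relative motion to the co-motion -/

/-- The absolute motions of the two robots that realize a relative motion in three steps. -/
theorem IsThreeStep.exists_coMotion {A B : Set Plane} (hA : IsRobot A) (hB : IsRobot B)
    {A₀ A₁ B₀ B₁ a b y : Plane} {x₁ x₂ x₃ : ℝ → Plane}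
    (h : IsThreeStep (A + B) (A₀ - B₀) (A₁ - B₁) (B₀ - B₁) a b y x₁ x₂ x₃) :
    ∃ ξA ξB : ℝ → Plane, IsMotion ξA A₀ A₁ ∧ IsMotion ξB B₀ B₁ ∧ IsCollisionFree A B ξA ξB ∧
      IsStandardForm A B ξA ξB ∧
      (∀ t ∈ Icc (0 : ℝ) (1 / 3), ξA t - ξB t = x₁ t) ∧
      (∀ t ∈ Icc (1 / 3 : ℝ) (2 / 3), ξA t - ξB t = x₂ t) ∧
      (∀ t ∈ Icc (2 / 3 : ℝ) 1, ξA t - ξB t = x₃ t) ∧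
      ∀ t ∈ Icc (0 : ℝ) 1, ∀ s ∈ Icc (0 : ℝ) 1, ∃ s' ∈ Icc (1 / 3 : ℝ) (2 / 3),
        (∃ t' ∈ Icc (0 : ℝ) (1 / 3), ξA t - ξB s = x₁ t' + x₂ s' - y) ∨
        ∃ t' ∈ Icc (2 / 3 : ℝ) 1, ξA t - ξB s = x₃ t' + x₂ s' - (y + (B₀ - B₁)) := by
  have n1 : (0 : ℝ) ≤ 1 / 3 := by norm_num
  have n2 : (1 / 3 : ℝ) ≤ 2 / 3 := by norm_num
  have n3 : (2 / 3 : ℝ) ≤ 1 := by norm_num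
  have n4 : (1 / 3 : ℝ) ≤ 1 := by norm_num
  have hK := hA.add hB
  set fA₁ : ℝ → Plane := fun t => B₀ + x₁ t with hfA₁
  set fA₂ : ℝ → Plane := fun _ => B₀ + y with hfA₂
  set fA₃ : ℝ → Plane := fun t => B₁ + x₃ t with hfA₃
  set fB₁ : ℝ → Plane := fun _ => B₀ with hfB₁
  set fB₂ : ℝ → Plane := fun t => B₀ + y + -x₂ t with hfB₂
  set fB₃ : ℝ → Plane := fun _ => B₁ with hfB₃
  have eA₂ : fA₂ (2 / 3) = fA₃ (2 / 3) := by
    simp only [hfA₂, hfA₃, h.start₃]; abel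
  have eA₁ : fA₁ (1 / 3) = glue (2 / 3) fA₂ fA₃ (1 / 3) := by
    rw [glue_of_le _ _ n2]; simp only [hfA₁, hfA₂, h.finish₁]
  have eB₂ : fB₂ (2 / 3) = fB₃ (2 / 3) := by
    simp only [hfB₂, hfB₃, h.finish₂]; abel
  have eB₁ : fB₁ (1 / 3) = glue (2 / 3) fB₂ fB₃ (1 / 3) := by
    rw [glue_of_le _ _ n2]; simp only [hfB₁, hfB₂, h.start₂]; abel
  set ξA := glue (1 / 3) fA₁ (glue (2 / 3) fA₂ fA₃) with hξA
  set ξB := glue (1 / 3) fB₁ (glue (2 / 3) fB₂ fB₃) with hξB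
  have vA₁ : ∀ t ∈ Icc (0 : ℝ) (1 / 3), ξA t = B₀ + x₁ t := fun t ht => glue_of_le _ _ ht.2
  have vA₂ : ∀ t ∈ Icc (1 / 3 : ℝ) (2 / 3), ξA t = B₀ + y := fun t ht => by
    rw [hξA, glue_of_ge eA₁ ht.1, glue_of_le _ _ ht.2]
  have vA₃ : ∀ t ∈ Icc (2 / 3 : ℝ) 1, ξA t = B₁ + x₃ t := fun t ht => by
    rw [hξA, glue_of_ge eA₁ (n2.trans ht.1), glue_of_ge eA₂ ht.1]
  have vB₁ : ∀ t ∈ Icc (0 : ℝ) (1 / 3), ξB t = B₀ := fun t ht => glue_of_le _ _ ht.2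
  have vB₂ : ∀ t ∈ Icc (1 / 3 : ℝ) (2 / 3), ξB t = B₀ + y + -x₂ t := fun t ht => by
    rw [hξB, glue_of_ge eB₁ ht.1, glue_of_le _ _ ht.2]
  have vB₃ : ∀ t ∈ Icc (2 / 3 : ℝ) 1, ξB t = B₁ := fun t ht => by
    rw [hξB, glue_of_ge eB₁ (n2.trans ht.1), glue_of_ge eB₂ ht.1]
  have m0 : (0 : ℝ) ∈ Icc (0 : ℝ) (1 / 3) := left_mem_Icc.2 n1
  have m1 : (1 : ℝ) ∈ Icc (2 / 3 : ℝ) 1 := right_mem_Icc.2 n3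
  have m13 : (1 / 3 : ℝ) ∈ Icc (1 / 3 : ℝ) (2 / 3) := left_mem_Icc.2 n2
  have m23 : (2 / 3 : ℝ) ∈ Icc (1 / 3 : ℝ) (2 / 3) := right_mem_Icc.2 n2
  have hconst : ∀ (c : Plane) (s : Set ℝ), eVariationOn (fun _ => c) s = 0 := fun c s =>
    eVariationOn.constant_on (by rintro _ ⟨_, _, rfl⟩ _ ⟨_, _, rfl⟩; rfl)
  have d₁ : ∀ t ∈ Icc (0 : ℝ) (1 / 3), ξA t - ξB t = x₁ t := fun t ht => by
    rw [vA₁ t ht, vB₁ t ht]; abel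
  have d₂ : ∀ t ∈ Icc (1 / 3 : ℝ) (2 / 3), ξA t - ξB t = x₂ t := fun t ht => by
    rw [vA₂ t ht, vB₂ t ht]; abel
  have d₃ : ∀ t ∈ Icc (2 / 3 : ℝ) 1, ξA t - ξB t = x₃ t := fun t ht => by
    rw [vA₃ t ht, vB₃ t ht]; abel
  refine ⟨ξA, ξB, ⟨?_, ?_, ?_, ?_⟩, ⟨?_, ?_, ?_, ?_⟩, ?_, ?_, d₁, d₂, d₃, ?_⟩
  · exact continuousOn_glue n1 n4 eA₁ (continuousOn_const.add h.continuousOn₁)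
      (continuousOn_glue n2 n3 eA₂ continuousOn_const (continuousOn_const.add h.continuousOn₃))
  · rw [hξA, eVariationOn_glue n1 n4 eA₁, eVariationOn_glue n2 n3 eA₂]
    simp only [hfA₁, hfA₂, hfA₃]
    rw [eVariationOn_const_add B₀ x₁, eVariationOn_const_add B₁ x₃, hconst]
    exact ENNReal.add_ne_top.2 ⟨h.variation₁, ENNReal.add_ne_top.2 ⟨ENNReal.zero_ne_top,
      h.variation₃⟩⟩
  · rw [vA₁ 0 m0, h.start₁]; abel
  · rw [vA₃ 1 m1, h.finish₃]; abel
  · exact continuousOn_glue n1 n4 eB₁ continuousOn_const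
      (continuousOn_glue n2 n3 eB₂ (continuousOn_const.add h.continuousOn₂.neg) continuousOn_const)
  · rw [hξB, eVariationOn_glue n1 n4 eB₁, eVariationOn_glue n2 n3 eB₂]
    simp only [hfB₁, hfB₂, hfB₃]
    rw [eVariationOn_const_add, eVariationOn_neg, hconst, hconst]
    exact ENNReal.add_ne_top.2 ⟨ENNReal.zero_ne_top, ENNReal.add_ne_top.2 ⟨h.variation₂,
      ENNReal.zero_ne_top⟩⟩
  · rw [vB₁ 0 m0]
  · rw [vB₃ 1 m1]
  · intro t ht
    rw [isViable_iff hA hB]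
    rcases le_total t (1 / 3) with h1 | h1
    · rw [d₁ t ⟨ht.1, h1⟩]; exact h.avoids₁ t ⟨ht.1, h1⟩
    rcases le_total t (2 / 3) with h2 | h2
    · rw [d₂ t ⟨h1, h2⟩]; exact h.avoids₂ t ⟨h1, h2⟩
    · rw [d₃ t ⟨h2, ht.2⟩]; exact h.avoids₃ t ⟨h2, ht.2⟩
  · refine ⟨1 / 3, 2 / 3, n1, n2, n3, fun t ht => ?_, fun t ht => ?_, fun t ht => ?_, ?_, ?_, ?_⟩
    · rw [vB₁ t ht, vB₁ 0 m0]
    · rw [vA₂ t ht, vA₂ _ m13]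
    · rw [vB₃ t ht, vB₃ 1 m1]
    · rw [vB₁ 0 m0]; exact h.shortest₁.translate B₀ vA₁ n1
    · rw [vA₂ _ m13]; exact h.shortest₂.translate (B₀ + y) vB₂ n2
    · rw [vB₃ 1 m1]; exact h.shortest₃.translate B₁ vA₃ n3
  · intro t ht s hs
    have hs' : ∃ s' ∈ Icc (1 / 3 : ℝ) (2 / 3), ξB s = B₀ + y + -x₂ s' := by
      rcases le_total s (1 / 3) with h1 | h1
      · refine ⟨1 / 3, m13, ?_⟩
        rw [vB₁ s ⟨hs.1, h1⟩, h.start₂]; abel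
      rcases le_total s (2 / 3) with h2 | h2
      · exact ⟨s, ⟨h1, h2⟩, vB₂ s ⟨h1, h2⟩⟩
      · refine ⟨2 / 3, m23, ?_⟩
        rw [vB₃ s ⟨h2, hs.2⟩, h.finish₂]; abel
    obtain ⟨s', hs', e⟩ := hs'
    refine ⟨s', hs', ?_⟩
    rcases le_total t (2 / 3) with h2 | h2
    · left
      rcases le_total t (1 / 3) with h1 | h1
      · refine ⟨t, ⟨ht.1, h1⟩, ?_⟩
        rw [e, vA₁ t ⟨ht.1, h1⟩]; abel
      · refine ⟨1 / 3, right_mem_Icc.2 n1, ?_⟩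
        rw [e, vA₂ t ⟨h1, h2⟩, h.finish₁]; abel
    · right
      refine ⟨t, ⟨h2, ht.2⟩, ?_⟩
      rw [e, vA₃ t ⟨h2, ht.2⟩]; abel

theorem reach_trace_le {ξ : ℝ → Plane} {θ c : ℝ}
    (h : ∀ t ∈ Icc (0 : ℝ) 1, inner ℝ (ξ t) (unitDir θ) ≤ c) : reach (trace ξ) θ ≤ c := by
  refine reach_le (S := trace ξ) ⟨ξ 0, 0, left_mem_Icc.2 zero_le_one, rfl⟩ ?_
  rintro _ ⟨t, ht, rfl⟩
  exact h t ht

theorem IsMotion.isCompact_trace {ξ : ℝ → Plane} {p q : Plane} (h : IsMotion ξ p q) :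
    IsCompact (trace ξ) :=
  isCompact_Icc.image_of_continuousOn h.continuousOn

theorem IsMotion.reach_hullBoundary {ξ : ℝ → Plane} {p q : Plane} (h : IsMotion ξ p q) (θ : ℝ) :
    reach (hullBoundary ξ) θ = reach (trace ξ) θ :=
  reach_frontier_convexHull h.isCompact_trace ⟨ξ 0, 0, left_mem_Icc.2 zero_le_one, rfl⟩ θ

/-- For a net counter-clockwise co-motion it is enough to bound the reach sum from above: each
orientation in the range is attained in a configuration that is separated in this direction. -/
theorem isCcwTight_of_le {A B : Set Plane} (hA : IsRobot A) (hB : IsRobot B)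
    {A₀ A₁ B₀ B₁ : Plane} {θ₀ θ₁ : ℝ} {ξA ξB : ℝ → Plane} (hξA : IsMotion ξA A₀ A₁)
    (hξB : IsMotion ξB B₀ B₁) (hfree : IsCollisionFree A B ξA ξB)
    (hnet : IsNetCcw A B ξA ξB θ₀ θ₁)
    (hle : ∀ θ c, segmentReach A₀ A₁ B₀ B₁ θ ≤ c → (θ ∈ ccwRange θ₀ θ₁ → reach (A + B) θ ≤ c) →
      ∀ t ∈ Icc (0 : ℝ) 1, ∀ s ∈ Icc (0 : ℝ) 1, inner ℝ (ξA t - ξB s) (unitDir θ) ≤ c) :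
    IsCcwTight A B A₀ A₁ B₀ B₁ θ₀ θ₁ ξA ξB := by
  intro θ
  rw [hξA.reach_hullBoundary, hξB.reach_hullBoundary]
  have hAle : ∀ t ∈ Icc (0 : ℝ) 1, inner ℝ (ξA t) (unitDir θ) ≤ reach (trace ξA) θ := fun t ht =>
    inner_le_reach hξA.isCompact_trace.isBounded ⟨t, ht, rfl⟩ θ
  have hBle : ∀ t ∈ Icc (0 : ℝ) 1,
      -inner ℝ (ξB t) (unitDir θ) ≤ reach (trace ξB) (Real.pi + θ) := fun t ht => by
    have := inner_le_reach hξB.isCompact_trace.isBounded ⟨t, ht, rfl⟩ (Real.pi + θ)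
    rwa [unitDir_pi_add, inner_neg_right] at this
  have h0 : (0 : ℝ) ∈ Icc (0 : ℝ) 1 := left_mem_Icc.2 zero_le_one
  have h1 : (1 : ℝ) ∈ Icc (0 : ℝ) 1 := right_mem_Icc.2 zero_le_one
  have hseg : segmentReach A₀ A₁ B₀ B₁ θ ≤
      reach (trace ξA) θ + reach (trace ξB) (Real.pi + θ) := by
    rw [segmentReach, reach_segment, reach_segment, unitDir_pi_add, inner_neg_right,
      inner_neg_right, ← hξA.start, ← hξA.finish, ← hξB.start, ← hξB.finish]
    exact add_le_add (max_le (hAle 0 h0) (hAle 1 h1)) (max_le (hBle 0 h0) (hBle 1 h1))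
  have hup : ∀ c, segmentReach A₀ A₁ B₀ B₁ θ ≤ c → (θ ∈ ccwRange θ₀ θ₁ → reach (A + B) θ ≤ c) →
      reach (trace ξA) θ + reach (trace ξB) (Real.pi + θ) ≤ c := by
    intro c hc1 hc2
    have : reach (trace ξA) θ ≤ c - reach (trace ξB) (Real.pi + θ) := by
      refine reach_trace_le fun t ht => ?_
      have : reach (trace ξB) (Real.pi + θ) ≤ c - inner ℝ (ξA t) (unitDir θ) := by
        refine reach_trace_le fun s hs => ?_
        have := hle θ c hc1 hc2 t ht s hs
        rw [inner_sub_left] at this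
        rw [unitDir_pi_add, inner_neg_right]
        linarith
      linarith
    linarith
  split_ifs with hr
  · refine le_antisymm (hup _ (le_max_left _ _) fun _ => le_max_right _ _) (max_le hseg ?_)
    obtain ⟨t, ht, hor⟩ := hnet θ hr
    have := ((isOrientation_iff hA hB _ _ θ).1 hor).reach_le (hA.add hB)
      ((isViable_iff hA hB _ _).1 (hfree t ht))
    rw [inner_sub_left] at this
    linarith [hAle t ht, hBle t ht]
  · exact le_antisymm (hup _ le_rfl fun h => absurd h hr) hseg

/-- The co-motion of a relative motion in three steps is as wanted, if the relative motion sweeps the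
range of orientations and the obstacle does not go beyond the corner points in the remaining
directions between `a` and `b`. -/
theorem IsThreeStep.exists_tight {A B : Set Plane} (hA : IsRobot A) (hB : IsRobot B)
    {A₀ A₁ B₀ B₁ a b y : Plane} {x₁ x₂ x₃ : ℝ → Plane} {θ₀ θ₁ : ℝ}
    (h : IsThreeStep (A + B) (A₀ - B₀) (A₁ - B₁) (B₀ - B₁) a b y x₁ x₂ x₃)
    (hnet : ∀ θ ∈ ccwRange θ₀ θ₁,
      (∃ t ∈ Icc (0 : ℝ) (1 / 3), IsDirection (A + B) (x₁ t) θ) ∨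
      (∃ t ∈ Icc (1 / 3 : ℝ) (2 / 3), IsDirection (A + B) (x₂ t) θ) ∨
      ∃ t ∈ Icc (2 / 3 : ℝ) 1, IsDirection (A + B) (x₃ t) θ)
    (harc : ∀ θ, InArc (B₀ - B₁) (rot (B₀ - B₁)) a (unitDir θ) ∨
      InArc (-(B₀ - B₁)) (rot (B₀ - B₁)) b (unitDir θ) → θ ∈ ccwRange θ₀ θ₁ ∨
      reach (A + B) θ ≤ inner ℝ (A₀ - B₀) (unitDir θ) ∨
      reach (A + B) θ ≤ inner ℝ (A₁ - B₁) (unitDir θ)) :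
    ∃ ξA ξB : ℝ → Plane, IsTightCcwCoMotion A B A₀ A₁ B₀ B₁ θ₀ θ₁ ξA ξB ∧
      IsStandardForm A B ξA ξB := by
  obtain ⟨ξA, ξB, hξA, hξB, hfree, hstd, d₁, d₂, d₃, hdiff⟩ := h.exists_coMotion hA hB
  have hnet' : IsNetCcw A B ξA ξB θ₀ θ₁ := by
    intro θ hθ
    rcases hnet θ hθ with ⟨t, ht, hd⟩ | ⟨t, ht, hd⟩ | ⟨t, ht, hd⟩
    · exact ⟨t, ⟨ht.1, ht.2.trans (by norm_num)⟩, by rwa [isOrientation_iff hA hB, d₁ t ht]⟩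
    · exact ⟨t, ⟨le_trans (by norm_num) ht.1, ht.2.trans (by norm_num)⟩, by
        rwa [isOrientation_iff hA hB, d₂ t ht]⟩
    · exact ⟨t, ⟨le_trans (by norm_num) ht.1, ht.2⟩, by rwa [isOrientation_iff hA hB, d₃ t ht]⟩
  refine ⟨ξA, ξB, ⟨hξA, hξB, hfree, hnet', isCcwTight_of_le hA hB hξA hξB hfree hnet' ?_⟩, hstd⟩
  intro θ c hs hr t ht s hs'
  rw [segmentReach, reach_segment, reach_segment, unitDir_pi_add, inner_neg_right,
    inner_neg_right] at hs
  have a0 := le_max_left (inner ℝ A₀ (unitDir θ)) (inner ℝ A₁ (unitDir θ))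
  have a1 := le_max_right (inner ℝ A₀ (unitDir θ)) (inner ℝ A₁ (unitDir θ))
  have b0 := le_max_left (-inner ℝ B₀ (unitDir θ)) (-inner ℝ B₁ (unitDir θ))
  have b1 := le_max_right (-inner ℝ B₀ (unitDir θ)) (-inner ℝ B₁ (unitDir θ))
  have c1 : inner ℝ (A₀ - B₀) (unitDir θ) ≤ c := by rw [inner_sub_left]; linarith
  have c4 : inner ℝ (A₁ - B₁) (unitDir θ) ≤ c := by rw [inner_sub_left]; linarith
  have hb := h.bound (unitDir θ) c c1
    (by rw [sub_add_sub_cancel, inner_sub_left]; linarith)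
    (by rw [show A₁ - B₁ - (B₀ - B₁) = A₁ - B₀ by abel, inner_sub_left]; linarith) c4
    (fun hI k hk => by
      refine (inner_lt_reach (hA.add hB) hk θ).le.trans ?_
      rcases harc θ hI with h1 | h1 | h1
      · exact hr h1
      · exact h1.trans c1
      · exact h1.trans c4)
  obtain ⟨s', hs'', ⟨t', ht', e⟩ | ⟨t', ht', e⟩⟩ := hdiff t ht s hs'
  · rw [e]; exact (hb s' hs'').1 t' ht'
  · rw [e]; exact (hb s' hs'').2 t' ht'

/-! ### Orientations swept by the relative motion -/

theorem exists_unitDir_eq_mem_Ico (θ c : ℝ) :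
    ∃ θ', c ≤ θ' ∧ θ' < c + 2 * Real.pi ∧ unitDir θ' = unitDir θ := by
  obtain ⟨θ', h1, h2, n, rfl⟩ := exists_add_int_mul_two_pi_mem_Ico θ c
  exact ⟨_, h1, h2, unitDir_add_two_pi_mul_int θ n⟩

theorem mem_ccwRange_iff {θ₀ θ₁ θ₀' θ₁' : ℝ} (h₀ : unitDir θ₀' = unitDir θ₀)
    (h₁ : unitDir θ₁' = unitDir θ₁) (hle : θ₀' ≤ θ₁') (hlt : θ₁' < θ₀' + 2 * Real.pi) (θ : ℝ) :
    θ ∈ ccwRange θ₀ θ₁ ↔ ∃ θ', unitDir θ' = unitDir θ ∧ θ₀' ≤ θ' ∧ θ' ≤ θ₁' := by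
  obtain ⟨n₀, rfl⟩ := unitDir_eq_iff h₀
  obtain ⟨n₁, rfl⟩ := unitDir_eq_iff h₁
  have key : ∀ φ φ' : ℝ, unitDir φ' = unitDir φ → θ₀ + n₀ * (2 * Real.pi) ≤ φ' →
      φ' < θ₀ + n₀ * (2 * Real.pi) + 2 * Real.pi →
      toIcoMod Real.two_pi_pos 0 (φ - θ₀) = φ' - (θ₀ + n₀ * (2 * Real.pi)) := by
    intro φ φ' h h1 h2
    obtain ⟨n, rfl⟩ := unitDir_eq_iff h
    rw [toIcoMod_eq_iff]
    refine ⟨⟨by linarith, by linarith⟩, n₀ - n, ?_⟩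
    rw [zsmul_eq_mul]
    push_cast
    ring
  rw [ccwRange, mem_ofPred_eq, key θ₁ _ h₁ hle hlt]
  constructor
  · intro h
    obtain ⟨θ', h1, h2, h3⟩ := exists_unitDir_eq_mem_Ico θ (θ₀ + n₀ * (2 * Real.pi))
    rw [key θ θ' h3 h1 h2] at h
    exact ⟨θ', h3, h1, by linarith⟩
  · rintro ⟨θ', h1, h2, h3⟩
    rw [key θ θ' h1 h2 (by linarith)]
    linarith

/-- A direction of a point outside the robot avoids the slits that the point does not cross. -/
theorem IsDirection.exists_mem_Ioo {K : Set Plane} (hK : IsRobot K) {x : Plane}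
    (hx : x ∉ interior K) {θ σ : ℝ} (h : IsDirection K x θ)
    (hσ : inner ℝ x (unitDir σ) < reach K σ) :
    ∃ θ', σ < θ' ∧ θ' < σ + 2 * Real.pi ∧ unitDir θ' = unitDir θ := by
  obtain ⟨θ', h1, h2, h3⟩ := exists_unitDir_eq_mem_Ico θ σ
  refine ⟨θ', h1.lt_of_ne ?_, h2, h3⟩
  rintro rfl
  exact absurd ((h.congr h3.symm).reach_le hK hx) (not_le.2 hσ)

theorem exists_isDirection_mem_Ioo {K : Set Plane} (hK : IsRobot K) {x : Plane}
    (hx : x ∉ interior K) {σ : ℝ} (hσ : inner ℝ x (unitDir σ) < reach K σ) :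
    ∃ θ, σ < θ ∧ θ < σ + 2 * Real.pi ∧ IsDirection K x θ := by
  obtain ⟨θ, -, -, h⟩ := exists_isDirection_mem_Ico hK.bounded hK.nonempty x σ
  obtain ⟨θ', h1, h2, h3⟩ := h.exists_mem_Ioo hK hx hσ
  exact ⟨θ', h1, h2, h.congr h3.symm⟩

section Arc

variable {d : Plane} {r σ : ℝ}

/-- The angle of the normal of a nonzero vector. -/
theorem exists_rot_eq_smul_unitDir (hd : d ≠ 0) :
    ∃ r σ : ℝ, 0 < r ∧ rot d = r • unitDir σ ∧ ∀ θ, inner ℝ (unitDir θ) d = -(r * Real.sin (θ - σ)) := by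
  obtain ⟨r, δ, hr, -, -, rfl⟩ := exists_unitDir_mem_Ico d hd 0
  refine ⟨r, δ + Real.pi / 2, hr, ?_, fun θ => ?_⟩
  · rw [← rot_unitDir]
    exact plane_ext (by simp) (by simp)
  · rw [real_inner_smul_right, inner_unitDir_unitDir, ← sub_sub, Real.sin_sub_pi_div_two,
      ← Real.cos_neg, neg_sub]
    ring

theorem mem_Ioo_of_inner_neg (hr : 0 < r)
    (hin : ∀ θ, inner ℝ (unitDir θ) d = -(r * Real.sin (θ - σ))) {θ : ℝ} (h1 : σ ≤ θ)
    (h2 : θ < σ + 2 * Real.pi) (h : inner ℝ (unitDir θ) d < 0) : σ < θ ∧ θ < σ + Real.pi := by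
  rw [hin, neg_lt_zero] at h
  have hs : 0 < Real.sin (θ - σ) := pos_of_mul_pos_right h hr.le
  refine ⟨h1.lt_of_ne ?_, ?_⟩
  · rintro rfl
    rw [sub_self, Real.sin_zero] at hs
    exact hs.false
  · by_contra! hle
    have := Real.sin_nonneg_of_nonneg_of_le_pi (x := θ - σ - Real.pi) (by linarith) (by linarith)
    rw [Real.sin_sub_pi] at this
    linarith

theorem mem_Ioo_of_inner_pos (hr : 0 < r)
    (hin : ∀ θ, inner ℝ (unitDir θ) d = -(r * Real.sin (θ - σ))) {θ : ℝ} (h1 : σ ≤ θ)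
    (h2 : θ < σ + 2 * Real.pi) (h : 0 < inner ℝ (unitDir θ) d) :
    σ + Real.pi < θ ∧ θ < σ + 2 * Real.pi := by
  rw [hin, neg_pos] at h
  refine ⟨?_, h2⟩
  by_contra! hle
  have := Real.sin_nonneg_of_nonneg_of_le_pi (x := θ - σ) (by linarith) (by linarith)
  have := mul_nonneg hr.le this
  linarith

/-- In angles, the arc from `a` to `b` is an interval. -/
theorem exists_mem_Icc_of_inArc (hr : 0 < r) (hrot : rot d = r • unitDir σ)
    (hin : ∀ θ, inner ℝ (unitDir θ) d = -(r * Real.sin (θ - σ))) {α β θ : ℝ}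
    (hα : σ < α ∧ α < σ + Real.pi) (hβ : σ + Real.pi < β ∧ β < σ + 2 * Real.pi)
    (h : InArc d (rot d) (unitDir α) (unitDir θ) ∨ InArc (-d) (rot d) (unitDir β) (unitDir θ)) :
    ∃ θ', unitDir θ' = unitDir θ ∧ α ≤ θ' ∧ θ' ≤ β := by
  have hd : 0 < inner ℝ d d := by
    rw [← inner_rot_rot, hrot]
    refine real_inner_self_pos.2 (smul_ne_zero hr.ne' (unitDir_ne_zero σ))
  have hcr : ∀ φ ψ, frameCross d (rot d) (unitDir φ) (unitDir ψ) =
      inner ℝ d d * Real.sin (ψ - φ) := fun φ ψ => by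
    rw [frameCross_eq (ε := 1) (one_smul ℝ _).symm, one_mul, cross_unitDir_unitDir]
  obtain ⟨θ', h1, h2, h3⟩ := exists_unitDir_eq_mem_Ico θ σ
  rw [← h3] at h
  refine ⟨θ', h3, ?_⟩
  rcases h with ⟨h4, h5⟩ | ⟨h4, h5⟩
  · rw [hcr] at h5
    have h5 := nonneg_of_mul_nonneg_right h5 hd
    rw [hin, neg_nonpos] at h4
    have h4 := nonneg_of_mul_nonneg_right h4 hr
    constructor
    · by_contra! hlt
      have := Real.sin_neg_of_neg_of_neg_pi_lt (x := θ' - α) (by linarith) (by linarith)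
      linarith
    · by_contra! hlt
      have := Real.sin_neg_of_neg_of_neg_pi_lt (x := θ' - σ - 2 * Real.pi) (by linarith)
        (by linarith)
      rw [Real.sin_sub_two_pi] at this
      linarith
  · have e : frameCross (-d) (rot d) (unitDir β) (unitDir θ') =
        -frameCross d (rot d) (unitDir β) (unitDir θ') := by
      simp only [frameCross, inner_neg_right]
      ring
    rw [e, hcr, neg_nonneg] at h5
    have h5 := nonpos_of_mul_nonpos_right h5 hd
    rw [inner_neg_right, hin, neg_neg] at h4
    have h4 := nonpos_of_mul_nonpos_right h4 hr
    have h6 : σ + Real.pi ≤ θ' := by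
      by_contra! hlt
      rcases h1.eq_or_lt with h | h
      · rw [← h] at h5
        have := Real.sin_pos_of_pos_of_lt_pi (x := σ - β + 2 * Real.pi) (by linarith) (by linarith)
        rw [Real.sin_add_two_pi] at this
        linarith
      · have := Real.sin_pos_of_pos_of_lt_pi (x := θ' - σ) (by linarith) (by linarith)
        linarith
    refine ⟨by linarith, ?_⟩
    by_contra! hlt
    have := Real.sin_pos_of_pos_of_lt_pi (x := θ' - β) (by linarith) (by linarith)
    linarith

end Arc

/-- A segment outside a robot is separated from it. -/
theorem exists_separating_segment {K : Set Plane} (hK : IsRobot K) {p q : Plane}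
    (h : ∀ z ∈ segment ℝ p q, z ∉ interior K) :
    ∃ θ, reach K θ ≤ inner ℝ p (unitDir θ) ∧ reach K θ ≤ inner ℝ q (unitDir θ) := by
  obtain ⟨f, c, hf1, hf2⟩ := geometric_hahn_banach_open hK.convex.interior isOpen_interior
    (convex_segment p q) (Set.disjoint_left.2 fun z hz hz' => h z hz' hz)
  set n := (InnerProductSpace.toDual ℝ Plane).symm f with hn
  have hfi : ∀ y, f y = inner ℝ y n := by
    intro y
    rw [real_inner_comm, InnerProductSpace.toDual_symm_apply]
  have h0 := hf1 0 hK.zero_mem_interior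
  have hp := hf2 p (left_mem_segment ℝ p q)
  have hq := hf2 q (right_mem_segment ℝ p q)
  rw [map_zero] at h0
  have hn0 : n ≠ 0 := by
    intro h
    rw [hfi, h, inner_zero_right] at hp
    linarith
  obtain ⟨r, θ, hr, -, -, e⟩ := exists_unitDir_mem_Ico n hn0 0
  have key : ∀ z, c ≤ f z → reach K θ ≤ inner ℝ z (unitDir θ) := by
    intro z hz
    refine reach_le_of_forall_interior hK fun k hk => ?_
    have := (hf1 k hk).le.trans hz
    rw [hfi, hfi, e, real_inner_smul_right, real_inner_smul_right] at this
    exact le_of_mul_le_mul_left this hr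
  exact ⟨θ, key p hp, key q hq⟩

namespace IsThreeStep

variable {K : Set Plane} {p q d a b y : Plane} {x₁ x₂ x₃ : ℝ → Plane} {r σ : ℝ}

theorem inner_unitDir_le (hr : 0 < r) (hrot : rot d = r • unitDir σ) {x z : Plane}
    (h : inner ℝ x (rot d) ≤ inner ℝ z (rot d)) : inner ℝ x (unitDir σ) ≤ inner ℝ z (unitDir σ) := by
  rw [hrot, real_inner_smul_right, real_inner_smul_right] at h
  exact le_of_mul_le_mul_left h hr

theorem low₁ (h : IsThreeStep K p q d a b y x₁ x₂ x₃) (hr : 0 < r)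
    (hrot : rot d = r • unitDir σ) (had : inner ℝ a d < 0) (t : ℝ) (ht : t ∈ Icc (0 : ℝ) (1 / 3)) :
    inner ℝ (x₁ t) (unitDir σ) ≤ inner ℝ p (unitDir σ) := by
  refine inner_unitDir_le hr hrot ?_
  have hd : 0 < inner ℝ d d := by
    refine real_inner_self_pos.2 fun h0 => ?_
    rw [h0, inner_zero_right] at had
    exact had.false
  have := h.bound₁ _ (not_inArc_self (ε := 1) (one_mul 1) (one_smul ℝ _).symm hd had) t ht
  rwa [max_eq_left h.y_left] at this

theorem low₃ (h : IsThreeStep K p q d a b y x₁ x₂ x₃) (hr : 0 < r)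
    (hrot : rot d = r • unitDir σ) (hbd : 0 < inner ℝ b d) (t : ℝ) (ht : t ∈ Icc (2 / 3 : ℝ) 1) :
    inner ℝ (x₃ t) (unitDir σ) ≤ inner ℝ q (unitDir σ) := by
  refine inner_unitDir_le hr hrot ?_
  have hd : 0 < inner ℝ d d := by
    refine real_inner_self_pos.2 fun h0 => ?_
    rw [h0, inner_zero_right] at hbd
    exact hbd.false
  have := h.bound₃ _ (not_inArc_self (ε := -1) (d := -d) (by ring)
    (by rw [rot_neg, smul_neg, neg_smul, neg_neg, one_smul]) (by rwa [inner_neg_neg])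
    (by rwa [inner_neg_right, neg_lt_zero])) t ht
  rwa [inner_add_left, inner_self_rot, add_zero, max_eq_left h.y_right] at this

theorem low₂ (h : IsThreeStep K p q d a b y x₁ x₂ x₃) (hr : 0 < r)
    (hrot : rot d = r • unitDir σ) (t : ℝ) (ht : t ∈ Icc (1 / 3 : ℝ) (2 / 3)) :
    inner ℝ (x₂ t) (unitDir σ) ≤ inner ℝ p (unitDir σ) ∧
      inner ℝ (x₂ t) (unitDir σ) ≤ inner ℝ q (unitDir σ) :=
  ⟨inner_unitDir_le hr hrot ((h.bound₂ t ht).trans h.y_left),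
    inner_unitDir_le hr hrot ((h.bound₂ t ht).trans h.y_right)⟩

theorem notMem_mid (h : IsThreeStep K p q d a b y x₁ x₂ x₃) : y ∉ interior K := by
  have := h.avoids₂ (1 / 3) (left_mem_Icc.2 (by norm_num))
  rwa [h.start₂] at this

theorem notMem_mid' (h : IsThreeStep K p q d a b y x₁ x₂ x₃) : y + d ∉ interior K := by
  have := h.avoids₂ (2 / 3) (right_mem_Icc.2 (by norm_num))
  rwa [h.finish₂] at this

/-- The orientations swept during the first two steps. -/
theorem sweep_left (h : IsThreeStep K p q d a b y x₁ x₂ x₃) (hK : IsRobot K) (hr : 0 < r)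
    (hrot : rot d = r • unitDir σ) (had : inner ℝ a d < 0)
    (hσ : inner ℝ p (unitDir σ) < reach K σ) {α β θ : ℝ} (hα : IsDirection K p α)
    (hα' : σ < α ∧ α < σ + 2 * Real.pi) (hβ : IsDirection K (y + d) β)
    (hβ' : σ < β ∧ β < σ + 2 * Real.pi) (hθ : θ ∈ uIcc α β) :
    (∃ t ∈ Icc (0 : ℝ) (1 / 3), IsDirection K (x₁ t) θ) ∨
      ∃ t ∈ Icc (1 / 3 : ℝ) (2 / 3), IsDirection K (x₂ t) θ := by
  have hyσ : inner ℝ y (unitDir σ) < reach K σ :=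
    (inner_unitDir_le hr hrot h.y_left).trans_lt hσ
  obtain ⟨γ, hγ1, hγ2, hγ⟩ := exists_isDirection_mem_Ioo hK h.notMem_mid hyσ
  rcases uIcc_subset_uIcc_union_uIcc (b := γ) hθ with hθ | hθ
  · exact Or.inl (exists_isDirection_of_mem_uIcc hK (by norm_num) h.continuousOn₁ h.avoids₁
      (fun t ht => (h.low₁ hr hrot had t ht).trans_lt hσ) (by rwa [h.start₁])
      (by rwa [h.finish₁]) hα' ⟨hγ1, hγ2⟩ hθ)
  · exact Or.inr (exists_isDirection_of_mem_uIcc hK (by norm_num) h.continuousOn₂ h.avoids₂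
      (fun t ht => (h.low₂ hr hrot t ht).1.trans_lt hσ) (by rwa [h.start₂])
      (by rwa [h.finish₂]) ⟨hγ1, hγ2⟩ hβ' hθ)

/-- The orientations swept during the last two steps. -/
theorem sweep_right (h : IsThreeStep K p q d a b y x₁ x₂ x₃) (hK : IsRobot K) (hr : 0 < r)
    (hrot : rot d = r • unitDir σ) (hbd : 0 < inner ℝ b d)
    (hσ : inner ℝ q (unitDir σ) < reach K σ) {α β θ : ℝ} (hα : IsDirection K y α)
    (hα' : σ < α ∧ α < σ + 2 * Real.pi) (hβ : IsDirection K q β)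
    (hβ' : σ < β ∧ β < σ + 2 * Real.pi) (hθ : θ ∈ uIcc α β) :
    (∃ t ∈ Icc (1 / 3 : ℝ) (2 / 3), IsDirection K (x₂ t) θ) ∨
      ∃ t ∈ Icc (2 / 3 : ℝ) 1, IsDirection K (x₃ t) θ := by
  have hyσ : inner ℝ (y + d) (unitDir σ) < reach K σ := by
    refine (inner_unitDir_le hr hrot ?_).trans_lt hσ
    rw [inner_add_left, inner_self_rot, add_zero]
    exact h.y_right
  obtain ⟨γ, hγ1, hγ2, hγ⟩ := exists_isDirection_mem_Ioo hK h.notMem_mid' hyσ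
  rcases uIcc_subset_uIcc_union_uIcc (b := γ) hθ with hθ | hθ
  · exact Or.inl (exists_isDirection_of_mem_uIcc hK (by norm_num) h.continuousOn₂ h.avoids₂
      (fun t ht => (h.low₂ hr hrot t ht).2.trans_lt hσ) (by rwa [h.start₂])
      (by rwa [h.finish₂]) hα' ⟨hγ1, hγ2⟩ hθ)
  · exact Or.inr (exists_isDirection_of_mem_uIcc hK (by norm_num) h.continuousOn₃ h.avoids₃
      (fun t ht => (h.low₃ hr hrot hbd t ht).trans_lt hσ) (by rwa [h.start₃])
      (by rwa [h.finish₃]) ⟨hγ1, hγ2⟩ hβ' hθ)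

end IsThreeStep

/-! ### The three cases -/

/-- There is a relative motion in three steps that sweeps the range of orientations, and bounds that
are sharp enough for tightness. -/
def HasTightThreeStep (K : Set Plane) (p q d : Plane) (θ₀ θ₁ : ℝ) : Prop :=
  ∃ (a b y : Plane) (x₁ x₂ x₃ : ℝ → Plane), IsThreeStep K p q d a b y x₁ x₂ x₃ ∧
    (∀ θ ∈ ccwRange θ₀ θ₁, (∃ t ∈ Icc (0 : ℝ) (1 / 3), IsDirection K (x₁ t) θ) ∨
      (∃ t ∈ Icc (1 / 3 : ℝ) (2 / 3), IsDirection K (x₂ t) θ) ∨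
      ∃ t ∈ Icc (2 / 3 : ℝ) 1, IsDirection K (x₃ t) θ) ∧
    ∀ θ, InArc d (rot d) a (unitDir θ) ∨ InArc (-d) (rot d) b (unitDir θ) →
      θ ∈ ccwRange θ₀ θ₁ ∨ reach K θ ≤ inner ℝ p (unitDir θ) ∨ reach K θ ≤ inner ℝ q (unitDir θ)

section Cases

variable {K : Set Plane} {p q d e : Plane} {θ₀ θ₁ : ℝ}

/-- If a displacement along `d` takes `x` into the robot, it decreases the separation. -/
theorem inner_neg_of_add_smul_mem (hK : IsRobot K) {x v : Plane} {θ t : ℝ}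
    (hx : reach K θ ≤ inner ℝ x (unitDir θ)) (ht : 0 ≤ t) (h : x + t • v ∈ interior K) :
    inner ℝ (unitDir θ) v < 0 := by
  have h1 := inner_lt_reach hK h θ
  rw [inner_add_left, real_inner_smul_left, real_inner_comm (unitDir θ) v] at h1
  by_contra! hle
  have h2 := mul_nonneg ht hle
  linarith

theorem ne_zero_of_inner_unitDir_neg {θ : ℝ} {v : Plane} (h : inner ℝ (unitDir θ) v < 0) :
    v ≠ 0 := by
  rintro rfl
  rw [inner_zero_right] at h
  exact h.false

/-- The case that the first robot is hit at both of its positions by the straight motion of the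
second one. -/
theorem hasTightThreeStep_of_hit_hit (hK : IsRobot K) (hp : p ∉ interior K) (hq : q ∉ interior K)
    (h₀ : IsDirection K p θ₀) (h₁ : IsDirection K q θ₁) {t₀ t₁ : ℝ} (ht₀ : 0 ≤ t₀) (ht₁ : 0 ≤ t₁)
    (hp' : p + t₀ • d ∈ interior K) (hq' : q - t₁ • d ∈ interior K) :
    HasTightThreeStep K p q d θ₀ θ₁ := by
  have hpr := h₀.reach_le hK hp
  have hqr := h₁.reach_le hK hq
  have had := inner_neg_of_add_smul_mem hK hpr ht₀ hp'
  have hbd : 0 < inner ℝ (unitDir θ₁) d := by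
    have := inner_neg_of_add_smul_mem hK (v := -d) hqr ht₁ (by rwa [smul_neg, ← sub_eq_add_neg])
    rwa [inner_neg_right, neg_lt_zero] at this
  obtain ⟨y, x₁, x₂, x₃, h⟩ := exists_isThreeStep hK hp hq
    (fun k hk => (inner_lt_reach hK hk θ₀).trans_le hpr) had
    (fun k hk => (inner_lt_reach hK hk θ₁).trans_le hqr) hbd
    ⟨_, hp', Or.inl (by rw [inner_add_left, real_inner_smul_left, inner_self_rot, mul_zero,
      add_zero])⟩
  obtain ⟨r, σ, hr, hrot, hin⟩ := exists_rot_eq_smul_unitDir (ne_zero_of_inner_unitDir_neg had)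
  have hdσ : inner ℝ d (unitDir σ) = 0 := by
    rw [real_inner_comm, hin, sub_self, Real.sin_zero, mul_zero, neg_zero]
  have hpσ : inner ℝ p (unitDir σ) < reach K σ := by
    have := inner_lt_reach hK hp' σ
    rwa [inner_add_left, real_inner_smul_left, hdσ, mul_zero, add_zero] at this
  have hqσ : inner ℝ q (unitDir σ) < reach K σ := by
    have := inner_lt_reach hK hq' σ
    rwa [inner_sub_left, real_inner_smul_left, hdσ, mul_zero, sub_zero] at this
  obtain ⟨α, hα1, hα2, hα⟩ := exists_unitDir_eq_mem_Ico θ₀ σ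
  obtain ⟨β, hβ1, hβ2, hβ⟩ := exists_unitDir_eq_mem_Ico θ₁ σ
  rw [← hα] at had
  rw [← hβ] at hbd
  have hα' := mem_Ioo_of_inner_neg hr hin hα1 hα2 had
  have hβ' := mem_Ioo_of_inner_pos hr hin hβ1 hβ2 hbd
  have hrange := mem_ccwRange_iff hα hβ (by linarith) (by linarith)
  refine ⟨_, _, y, x₁, x₂, x₃, h, fun θ hθ => ?_, fun θ hθ => ?_⟩
  · obtain ⟨θ', h1, h2, h3⟩ := (hrange θ).1 hθ
    have hy'σ : inner ℝ (y + d) (unitDir σ) < reach K σ := by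
      rw [inner_add_left, hdσ, add_zero]
      exact (IsThreeStep.inner_unitDir_le hr hrot h.y_left).trans_lt hpσ
    obtain ⟨γ, hγ1, hγ2, hγ⟩ := exists_isDirection_mem_Ioo hK h.notMem_mid' hy'σ
    have hmem : θ' ∈ uIcc α β := by rw [uIcc_of_le (by linarith)]; exact ⟨h2, h3⟩
    rcases uIcc_subset_uIcc_union_uIcc (b := γ) hmem with hm | hm
    · rcases h.sweep_left hK hr hrot (hα ▸ had) hpσ (h₀.congr hα.symm)
        ⟨hα'.1, by linarith⟩ hγ ⟨hγ1, hγ2⟩ hm with ⟨t, ht, hd⟩ | ⟨t, ht, hd⟩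
      · exact Or.inl ⟨t, ht, hd.congr h1⟩
      · exact Or.inr (Or.inl ⟨t, ht, hd.congr h1⟩)
    · obtain ⟨t, ht, hd⟩ := exists_isDirection_of_mem_uIcc hK (by norm_num) h.continuousOn₃
        h.avoids₃ (fun t ht => (h.low₃ hr hrot (hβ ▸ hbd) t ht).trans_lt hqσ)
        (by rwa [h.start₃]) (by rw [h.finish₃]; exact h₁.congr hβ.symm) ⟨hγ1, hγ2⟩
        ⟨by linarith, hβ'.2⟩ hm
      exact Or.inr (Or.inr ⟨t, ht, hd.congr h1⟩)
  · left
    rw [← hα, ← hβ] at hθ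
    exact (hrange θ).2 (exists_mem_Icc_of_inArc hr hrot hin hα' hβ' hθ)

/-- The case that at the initial positions each robot is hit by the straight motion of the other
one, while the final position of the second robot is not. -/
theorem hasTightThreeStep_of_free_right (hK : IsRobot K) (hp : p ∉ interior K)
    (hq : q ∉ interior K) (hpq : q = p + d + e) (h₀ : IsDirection K p θ₀) (h₁ : IsDirection K q θ₁)
    {t₀ s₀ : ℝ} (ht₀ : 0 ≤ t₀) (ht₀' : t₀ ≤ 1) (hs₀ : 0 ≤ s₀) (hs₀' : s₀ ≤ 1)
    (hp' : p + t₀ • d ∈ interior K) (hp'' : p + s₀ • e ∈ interior K)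
    (hfree : ∀ z ∈ segment ℝ (p + d) q, z ∉ interior K) : HasTightThreeStep K p q d θ₀ θ₁ := by
  have hπ := Real.pi_pos
  have hpr := h₀.reach_le hK hp
  have hqr := h₁.reach_le hK hq
  have had := inner_neg_of_add_smul_mem hK hpr ht₀ hp'
  have hae := inner_neg_of_add_smul_mem hK hpr hs₀ hp''
  obtain ⟨ν, hν1, hν2⟩ := exists_separating_segment hK hfree
  have hbd : 0 < inner ℝ (unitDir ν) d := by
    have h1 := (inner_lt_reach hK hp' ν).trans_le hν1
    rw [inner_add_left, inner_add_left, real_inner_smul_left, real_inner_comm (unitDir ν) d] at h1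
    by_contra! hle
    nlinarith
  obtain ⟨y, x₁, x₂, x₃, h⟩ := exists_isThreeStep hK hp hq
    (fun k hk => (inner_lt_reach hK hk θ₀).trans_le hpr) had
    (fun k hk => (inner_lt_reach hK hk ν).trans_le hν2) hbd
    ⟨_, hp', Or.inl (by rw [inner_add_left, real_inner_smul_left, inner_self_rot, mul_zero,
      add_zero])⟩
  obtain ⟨r, σ, hr, hrot, hin⟩ := exists_rot_eq_smul_unitDir (ne_zero_of_inner_unitDir_neg had)
  have hdσ : inner ℝ d (unitDir σ) = 0 := by
    rw [real_inner_comm, hin, sub_self, Real.sin_zero, mul_zero, neg_zero]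
  have hpσ : inner ℝ p (unitDir σ) < reach K σ := by
    have := inner_lt_reach hK hp' σ
    rwa [inner_add_left, real_inner_smul_left, hdσ, mul_zero, add_zero] at this
  obtain ⟨α, hα1, hα2, hα⟩ := exists_unitDir_eq_mem_Ico θ₀ σ
  obtain ⟨β, hβ1, hβ2, hβ⟩ := exists_unitDir_eq_mem_Ico ν σ
  have h₀' := h₀.congr hα.symm
  have had' := had
  have hbd' := hbd
  rw [← hα] at had' hae
  rw [← hβ] at hbd'
  have hα' := mem_Ioo_of_inner_neg hr hin hα1 hα2 had'
  have hβ' := mem_Ioo_of_inner_pos hr hin hβ1 hβ2 hbd'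
  -- the position `y + d` and the final position lie below the initial supporting line
  have had'' := had'
  rw [real_inner_comm] at had'' hae
  have hpd : inner ℝ (p + d) (unitDir α) ≤ inner ℝ (p + t₀ • d) (unitDir α) := by
    rw [inner_add_left, inner_add_left, real_inner_smul_left]
    nlinarith
  have hpα := inner_lt_reach hK hp' α
  have hqα : inner ℝ q (unitDir α) < reach K α := by
    rw [hpq, inner_add_left]
    linarith
  have hyα : inner ℝ (y + d) (unitDir α) ≤ inner ℝ (p + d) (unitDir α) := by
    have h1 := h.y_a
    rw [show q - d = p + e by rw [hpq]; abel, ← hα, inner_add_left p e,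
      max_eq_left (by linarith)] at h1
    rw [inner_add_left, inner_add_left]
    linarith
  have hyα' : inner ℝ (y + d) (unitDir α) < reach K α := by linarith
  have hyσ : inner ℝ (y + d) (unitDir σ) ≤ inner ℝ p (unitDir σ) := by
    rw [inner_add_left, hdσ, add_zero]
    exact IsThreeStep.inner_unitDir_le hr hrot h.y_left
  obtain ⟨γ, hγ1, hγ2, hγ⟩ := exists_isDirection_mem_Ioo hK h.notMem_mid' (hyσ.trans_lt hpσ)
  have hαγ : α < γ := by
    by_contra! hle
    rcases hle.eq_or_lt with rfl | hlt
    · exact absurd (hγ.reach_le hK h.notMem_mid') (not_le.2 hyα')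
    have id := sin_mul_inner (y + d - (p + t₀ • d)) σ γ α
    have s0 : 0 < Real.sin (α - σ) := Real.sin_pos_of_pos_of_lt_pi (by linarith) (by linarith)
    have s1 : 0 < Real.sin (α - γ) := Real.sin_pos_of_pos_of_lt_pi (by linarith) (by linarith)
    have s2 : 0 < Real.sin (γ - σ) := Real.sin_pos_of_pos_of_lt_pi (by linarith) (by linarith)
    have e1 : inner ℝ (y + d - (p + t₀ • d)) (unitDir σ) ≤ 0 := by
      rw [inner_sub_left, inner_add_left p, real_inner_smul_left, hdσ]
      linarith
    have e2 : inner ℝ (y + d - (p + t₀ • d)) (unitDir α) ≤ 0 := by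
      rw [inner_sub_left]
      linarith
    have e3 : 0 < inner ℝ (y + d - (p + t₀ • d)) (unitDir γ) := by
      rw [inner_sub_left]
      have := inner_lt_reach hK hp' γ
      have := hγ.reach_le hK h.notMem_mid'
      linarith
    have := mul_pos s0 e3
    have := mul_nonpos_of_nonneg_of_nonpos s1.le e1
    have := mul_nonpos_of_nonneg_of_nonpos s2.le e2
    linarith
  obtain ⟨ψ, hψ1, hψ2, hψ⟩ := h₁.exists_mem_Ioo hK hq hqα
  have h₁' := h₁.congr hψ.symm
  have hrange := mem_ccwRange_iff hα hψ hψ1.le hψ2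
  refine ⟨_, _, y, x₁, x₂, x₃, h, fun θ hθ => ?_, fun θ hθ => ?_⟩
  · obtain ⟨θ', h1, h2, h3⟩ := (hrange θ).1 hθ
    rcases le_total θ' γ with hm | hm
    · rcases h.sweep_left hK hr hrot had hpσ h₀' ⟨hα'.1, by linarith⟩ hγ ⟨hγ1, hγ2⟩
        (by rw [uIcc_of_le hαγ.le]; exact ⟨h2, hm⟩) with ⟨t, ht, hd⟩ | ⟨t, ht, hd⟩
      · exact Or.inl ⟨t, ht, hd.congr h1⟩
      · exact Or.inr (Or.inl ⟨t, ht, hd.congr h1⟩)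
    · obtain ⟨t, ht, hd⟩ := exists_isDirection_of_mem_uIcc hK (by norm_num) h.continuousOn₃
        h.avoids₃ (σ := α) (fun t ht => (h.bound₃ (unitDir α) (fun hI => by
            have := hI.1
            rw [inner_neg_right] at this
            linarith) t ht).trans_lt (max_lt hqα hyα'))
        (by rwa [h.start₃]) (by rwa [h.finish₃]) ⟨hαγ, by linarith⟩ ⟨hψ1, hψ2⟩
        (by rw [uIcc_of_le (hm.trans h3)]; exact ⟨hm, h3⟩)
      exact Or.inr (Or.inr ⟨t, ht, hd.congr h1⟩)
  · rw [← hα, ← hβ] at hθ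
    obtain ⟨θ', h1, h2, h3⟩ := exists_mem_Icc_of_inArc hr hrot hin hα' hβ' hθ
    rcases le_total θ' ψ with hm | hm
    · exact Or.inl ((hrange θ).2 ⟨θ', h1, h2, hm⟩)
    refine Or.inr (Or.inr ?_)
    rw [← h1, ← reach_congr_angle K h1]
    have hqψ := h₁'.reach_le hK hq
    have hqβ : reach K β ≤ inner ℝ q (unitDir β) := by rwa [reach_congr_angle K hβ, hβ]
    refine reach_le_inner_of_between hK hm h3 ?_ hqψ hqβ
    -- otherwise `q` would be separated in the direction `σ` as well, where `p` is not
    by_contra! hle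
    have hlt : ψ + Real.pi < β := by
      refine hle.lt_of_ne fun h => ?_
      rw [← h, unitDir_add_pi, inner_neg_right] at hqβ
      have := reach_pos hK (ψ + Real.pi)
      have := reach_pos hK ψ
      linarith
    have hqσ := reach_le_inner_of_between hK (α := β) (β := σ + 2 * Real.pi)
      (γ := ψ + 2 * Real.pi) hβ'.2.le (by linarith) (by linarith) hqβ
      (by rwa [reach_congr_angle K (unitDir_add_two_pi ψ), unitDir_add_two_pi])
    rw [reach_congr_angle K (unitDir_add_two_pi σ), unitDir_add_two_pi] at hqσ
    have heσ : 0 < inner ℝ e (unitDir σ) := by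
      rw [hpq, inner_add_left, inner_add_left, hdσ] at hqσ
      linarith
    have hdψ : inner ℝ d (unitDir ψ) < 0 := by
      rw [real_inner_comm, hin, neg_lt_zero]
      exact mul_pos hr (Real.sin_pos_of_pos_of_lt_pi (by linarith) (by linarith))
    have heψ : 0 < inner ℝ e (unitDir ψ) := by
      have h5 := (inner_lt_reach hK hp'' ψ).trans_le hqψ
      rw [hpq, inner_add_left, inner_add_left, inner_add_left, real_inner_smul_left] at h5
      by_contra! hle
      nlinarith
    have id := sin_mul_inner e σ α ψ
    have s0 : 0 < Real.sin (ψ - σ) := Real.sin_pos_of_pos_of_lt_pi (by linarith) (by linarith)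
    have s1 : 0 < Real.sin (ψ - α) := Real.sin_pos_of_pos_of_lt_pi (by linarith) (by linarith)
    have s2 : 0 < Real.sin (α - σ) := Real.sin_pos_of_pos_of_lt_pi (by linarith) (by linarith)
    have := mul_pos s1 heσ
    have := mul_pos s2 heψ
    have := mul_neg_of_pos_of_neg s0 hae
    linarith

/-- The case that at the final positions each robot is hit by the straight motion of the other one,
while the initial position of the second robot is not. -/
theorem hasTightThreeStep_of_free_left (hK : IsRobot K) (hp : p ∉ interior K)
    (hq : q ∉ interior K) (hpq : q = p + d + e) (h₀ : IsDirection K p θ₀) (h₁ : IsDirection K q θ₁)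
    {t₁ s₁ : ℝ} (ht₁ : 0 ≤ t₁) (ht₁' : t₁ ≤ 1) (hs₁ : 0 ≤ s₁) (hs₁' : s₁ ≤ 1)
    (hq' : q - t₁ • d ∈ interior K) (hq'' : q - s₁ • e ∈ interior K)
    (hfree : ∀ z ∈ segment ℝ p (p + e), z ∉ interior K) : HasTightThreeStep K p q d θ₀ θ₁ := by
  have hπ := Real.pi_pos
  have hpr := h₀.reach_le hK hp
  have hqr := h₁.reach_le hK hq
  have hbd : 0 < inner ℝ (unitDir θ₁) d := by
    have := inner_neg_of_add_smul_mem hK (v := -d) hqr ht₁ (by rwa [smul_neg, ← sub_eq_add_neg])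
    rwa [inner_neg_right, neg_lt_zero] at this
  have hbe : 0 < inner ℝ (unitDir θ₁) e := by
    have := inner_neg_of_add_smul_mem hK (v := -e) hqr hs₁ (by rwa [smul_neg, ← sub_eq_add_neg])
    rwa [inner_neg_right, neg_lt_zero] at this
  obtain ⟨ν, hν1, hν2⟩ := exists_separating_segment hK hfree
  have had : inner ℝ (unitDir ν) d < 0 := by
    have h1 := (inner_lt_reach hK hq' ν).trans_le hν2
    rw [hpq, inner_sub_left, inner_add_left, inner_add_left, inner_add_left, real_inner_smul_left,
      real_inner_comm (unitDir ν) d] at h1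
    by_contra! hle
    nlinarith
  obtain ⟨y, x₁, x₂, x₃, h⟩ := exists_isThreeStep hK hp hq
    (fun k hk => (inner_lt_reach hK hk ν).trans_le hν1) had
    (fun k hk => (inner_lt_reach hK hk θ₁).trans_le hqr) hbd
    ⟨_, hq', Or.inr (by rw [inner_sub_left, real_inner_smul_left, inner_self_rot, mul_zero,
      sub_zero])⟩
  obtain ⟨r, σ, hr, hrot, hin⟩ := exists_rot_eq_smul_unitDir (ne_zero_of_inner_unitDir_neg had)
  have hdσ : inner ℝ d (unitDir σ) = 0 := by
    rw [real_inner_comm, hin, sub_self, Real.sin_zero, mul_zero, neg_zero]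
  have hqσ : inner ℝ q (unitDir σ) < reach K σ := by
    have := inner_lt_reach hK hq' σ
    rwa [inner_sub_left, real_inner_smul_left, hdσ, mul_zero, sub_zero] at this
  obtain ⟨α, hα1, hα2, hα⟩ := exists_unitDir_eq_mem_Ico ν σ
  obtain ⟨β, hβ1, hβ2, hβ⟩ := exists_unitDir_eq_mem_Ico θ₁ σ
  have h₁' := h₁.congr hβ.symm
  have had' := had
  have hbd' := hbd
  rw [← hα] at had'
  rw [← hβ] at hbd' hbe
  have hα' := mem_Ioo_of_inner_neg hr hin hα1 hα2 had'
  have hβ' := mem_Ioo_of_inner_pos hr hin hβ1 hβ2 hbd'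
  -- the initial position and the position `y` lie below the final supporting line
  have hbd'' := hbd'
  rw [real_inner_comm] at hbd'' hbe
  have hqd : inner ℝ (q - d) (unitDir β) ≤ inner ℝ (q - t₁ • d) (unitDir β) := by
    rw [inner_sub_left, inner_sub_left, real_inner_smul_left]
    nlinarith
  have hqβ := inner_lt_reach hK hq' β
  have hp_eq : p = q - d - e := by rw [hpq]; abel
  have hpβ : inner ℝ p (unitDir β) < reach K β := by
    rw [hp_eq, inner_sub_left]
    linarith
  have hyβ : inner ℝ y (unitDir β) ≤ inner ℝ (q - d) (unitDir β) := by
    have h1 := h.y_b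
    rw [show p + d = q - e by rw [hpq]; abel, ← hβ, inner_sub_left q e,
      max_eq_left (by linarith), inner_add_left] at h1
    rw [inner_sub_left]
    linarith
  have hyβ' : inner ℝ y (unitDir β) < reach K β := by linarith
  have hyσ : inner ℝ y (unitDir σ) ≤ inner ℝ q (unitDir σ) :=
    IsThreeStep.inner_unitDir_le hr hrot h.y_right
  obtain ⟨γ, hγ1, hγ2, hγ⟩ := exists_isDirection_mem_Ioo hK h.notMem_mid (hyσ.trans_lt hqσ)
  have hγβ : γ < β := by
    by_contra! hle
    rcases hle.eq_or_lt with rfl | hlt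
    · exact absurd (hγ.reach_le hK h.notMem_mid) (not_le.2 hyβ')
    have id := sin_mul_inner (y - (q - t₁ • d)) β γ (σ + 2 * Real.pi)
    rw [unitDir_add_two_pi] at id
    have s0 : 0 < Real.sin (σ + 2 * Real.pi - β) :=
      Real.sin_pos_of_pos_of_lt_pi (by linarith) (by linarith)
    have s1 : 0 < Real.sin (σ + 2 * Real.pi - γ) :=
      Real.sin_pos_of_pos_of_lt_pi (by linarith) (by linarith)
    have s2 : 0 < Real.sin (γ - β) := Real.sin_pos_of_pos_of_lt_pi (by linarith) (by linarith)
    have e1 : inner ℝ (y - (q - t₁ • d)) (unitDir σ) ≤ 0 := by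
      rw [inner_sub_left, inner_sub_left q, real_inner_smul_left, hdσ]
      linarith
    have e2 : inner ℝ (y - (q - t₁ • d)) (unitDir β) ≤ 0 := by
      rw [inner_sub_left]
      linarith
    have e3 : 0 < inner ℝ (y - (q - t₁ • d)) (unitDir γ) := by
      rw [inner_sub_left]
      have := inner_lt_reach hK hq' γ
      have := hγ.reach_le hK h.notMem_mid
      linarith
    have := mul_pos s0 e3
    have := mul_nonpos_of_nonneg_of_nonpos s1.le e2
    have := mul_nonpos_of_nonneg_of_nonpos s2.le e1
    linarith
  -- the slit that starts in the final orientation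
  have hβper : unitDir (β - 2 * Real.pi) = unitDir β := by
    rw [← unitDir_add_two_pi, sub_add_cancel]
  have hβreach : reach K (β - 2 * Real.pi) = reach K β := reach_congr_angle K hβper
  obtain ⟨ψ, hψ1, hψ2, hψ⟩ := h₀.exists_mem_Ioo hK hp (σ := β - 2 * Real.pi)
    (by rwa [hβper, hβreach])
  have h₀' := h₀.congr hψ.symm
  have hrange := mem_ccwRange_iff hψ hβ (by linarith) (by linarith)
  refine ⟨_, _, y, x₁, x₂, x₃, h, fun θ hθ => ?_, fun θ hθ => ?_⟩
  · obtain ⟨θ', h1, h2, h3⟩ := (hrange θ).1 hθ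
    rcases le_total γ θ' with hm | hm
    · rcases h.sweep_right hK hr hrot hbd hqσ hγ ⟨hγ1, hγ2⟩ h₁' ⟨by linarith, hβ'.2⟩
        (by rw [uIcc_of_le hγβ.le]; exact ⟨hm, h3⟩) with ⟨t, ht, hd⟩ | ⟨t, ht, hd⟩
      · exact Or.inr (Or.inl ⟨t, ht, hd.congr h1⟩)
      · exact Or.inr (Or.inr ⟨t, ht, hd.congr h1⟩)
    · obtain ⟨t, ht, hd⟩ := exists_isDirection_of_mem_uIcc hK (by norm_num) h.continuousOn₁
        h.avoids₁ (σ := β - 2 * Real.pi) (fun t ht => by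
          rw [hβper, hβreach]
          exact (h.bound₁ (unitDir β) (fun hI => by
            have := hI.1
            linarith) t ht).trans_lt (max_lt hpβ hyβ'))
        (by rwa [h.start₁]) (by rwa [h.finish₁]) ⟨hψ1, by linarith⟩ ⟨by linarith, by linarith⟩
        (by rw [uIcc_of_le (h2.trans hm)]; exact ⟨h2, hm⟩)
      exact Or.inl ⟨t, ht, hd.congr h1⟩
  · rw [← hα, ← hβ] at hθ
    obtain ⟨θ', h1, h2, h3⟩ := exists_mem_Icc_of_inArc hr hrot hin hα' hβ' hθ
    rcases le_total ψ θ' with hm | hm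
    · exact Or.inl ((hrange θ).2 ⟨θ', h1, hm, h3⟩)
    refine Or.inr (Or.inl ?_)
    rw [← h1, ← reach_congr_angle K h1]
    have hpψ := h₀'.reach_le hK hp
    have hpα : reach K α ≤ inner ℝ p (unitDir α) := by rwa [reach_congr_angle K hα, hα]
    refine reach_le_inner_of_between hK h2 hm ?_ hpα hpψ
    -- otherwise `p` would be separated in the direction `σ` as well, where `q` is not
    by_contra! hle
    have hlt : α + Real.pi < ψ := by
      refine hle.lt_of_ne fun h => ?_
      rw [← h, unitDir_add_pi, inner_neg_right] at hpψ
      have := reach_pos hK (α + Real.pi)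
      have := reach_pos hK α
      linarith
    have hψper : unitDir (ψ - 2 * Real.pi) = unitDir ψ := by
      rw [← unitDir_add_two_pi, sub_add_cancel]
    have hpσ := reach_le_inner_of_between hK (α := ψ - 2 * Real.pi) (β := σ) (γ := α)
      (by linarith) hα'.1.le (by linarith) (by rwa [reach_congr_angle K hψper, hψper]) hpα
    have heσ : inner ℝ e (unitDir σ) < 0 := by
      rw [hp_eq, inner_sub_left, inner_sub_left, hdσ] at hpσ
      linarith
    have hdψ : 0 < inner ℝ d (unitDir ψ) := by
      rw [real_inner_comm, hin, neg_pos]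
      refine mul_neg_of_pos_of_neg hr ?_
      rw [← Real.sin_sub_two_pi]
      exact Real.sin_neg_of_neg_of_neg_pi_lt (by linarith) (by linarith)
    have heψ : inner ℝ e (unitDir ψ) < 0 := by
      have h5 := (inner_lt_reach hK hq'' ψ).trans_le hpψ
      rw [hp_eq, inner_sub_left, inner_sub_left, inner_sub_left, real_inner_smul_left] at h5
      by_contra! hle
      nlinarith
    have id := sin_mul_inner e ψ β (σ + 2 * Real.pi)
    rw [unitDir_add_two_pi] at id
    have s0 : 0 < Real.sin (σ + 2 * Real.pi - ψ) :=
      Real.sin_pos_of_pos_of_lt_pi (by linarith) (by linarith)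
    have s1 : 0 < Real.sin (σ + 2 * Real.pi - β) :=
      Real.sin_pos_of_pos_of_lt_pi (by linarith) (by linarith)
    have s2 : 0 ≤ Real.sin (β - ψ) :=
      Real.sin_nonneg_of_nonneg_of_le_pi (by linarith) (by linarith)
    have := mul_pos s0 hbe
    have := mul_neg_of_pos_of_neg s1 heψ
    have := mul_nonpos_of_nonneg_of_nonpos s2 heσ.le
    linarith

end Cases

theorem HasTightThreeStep.exists_tight {A B : Set Plane} (hA : IsRobot A) (hB : IsRobot B)
    {A₀ A₁ B₀ B₁ : Plane} {θ₀ θ₁ : ℝ}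
    (h : HasTightThreeStep (A + B) (A₀ - B₀) (A₁ - B₁) (B₀ - B₁) θ₀ θ₁) :
    ∃ ξA ξB : ℝ → Plane, IsTightCcwCoMotion A B A₀ A₁ B₀ B₁ θ₀ θ₁ ξA ξB ∧
      IsStandardForm A B ξA ξB := by
  obtain ⟨a, b, y, x₁, x₂, x₃, h, h1, h2⟩ := h
  exact h.exists_tight hA hB h1 h2

/-! ### Exchanging the robots -/

theorem IsViable.symm {A B : Set Plane} {a b : Plane} (h : IsViable A B a b) :
    IsViable B A b a :=
  Disjoint.symm h

theorem reach_add_pi {K : Set Plane} (hK : IsRobot K) (θ : ℝ) :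
    reach K (θ + Real.pi) = reach K θ := by
  have key : ∀ φ, reach K (φ + Real.pi) ≤ reach K φ := fun φ => by
    refine reach_le hK.nonempty fun x hx => ?_
    rw [unitDir_add_pi, inner_neg_right, ← inner_neg_left]
    exact inner_le_reach hK.bounded (hK.symmetric x hx) φ
  refine le_antisymm (key θ) ?_
  have := key (θ + Real.pi)
  rwa [reach_congr_angle K (φ := θ) (by rw [unitDir_add_pi, unitDir_add_pi, neg_neg])] at this

theorem IsDirection.neg {K : Set Plane} (hK : IsRobot K) {x : Plane} {θ : ℝ}
    (h : IsDirection K x θ) : IsDirection K (-x) (θ + Real.pi) := by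
  intro φ
  have := h (φ + Real.pi)
  rw [reach_add_pi hK, unitDir_add_pi, inner_neg_right] at this
  rwa [reach_add_pi hK, unitDir_add_pi, inner_neg_neg, inner_neg_left]

theorem isDirection_neg_iff {K : Set Plane} (hK : IsRobot K) {x : Plane} {θ : ℝ} :
    IsDirection K (-x) (θ + Real.pi) ↔ IsDirection K x θ := by
  refine ⟨fun h => ?_, fun h => h.neg hK⟩
  have := h.neg hK
  rw [neg_neg] at this
  exact this.congr (by rw [unitDir_add_pi, unitDir_add_pi, neg_neg])

theorem isOrientation_swap {A B : Set Plane} (hA : IsRobot A) (hB : IsRobot B) {a b : Plane}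
    {θ : ℝ} : IsOrientation B A b a (θ + Real.pi) ↔ IsOrientation A B a b θ := by
  rw [isOrientation_iff hA hB, isOrientation_iff hB hA, add_comm B A, ← neg_sub a b,
    isDirection_neg_iff (hA.add hB)]

theorem mem_ccwRange_add_pi {θ₀ θ₁ θ : ℝ} :
    θ + Real.pi ∈ ccwRange (θ₀ + Real.pi) (θ₁ + Real.pi) ↔ θ ∈ ccwRange θ₀ θ₁ := by
  simp only [ccwRange, mem_ofPred_eq, add_sub_add_right_eq_sub]

/-- Exchanging the robots reflects relative positions in the origin, which turns all directions by
`π`. -/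
theorem IsTightCcwCoMotion.swap {A B : Set Plane} (hA : IsRobot A) (hB : IsRobot B)
    {A₀ A₁ B₀ B₁ : Plane} {θ₀ θ₁ : ℝ} {ξA ξB : ℝ → Plane}
    (h : IsTightCcwCoMotion B A B₀ B₁ A₀ A₁ (θ₀ + Real.pi) (θ₁ + Real.pi) ξB ξA) :
    IsTightCcwCoMotion A B A₀ A₁ B₀ B₁ θ₀ θ₁ ξA ξB where
  motionA := h.motionB
  motionB := h.motionA
  collisionFree t ht := (h.collisionFree t ht).symm
  netCcw θ hθ := by
    obtain ⟨t, ht, hor⟩ := h.netCcw (θ + Real.pi) (mem_ccwRange_add_pi.2 hθ)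
    exact ⟨t, ht, (isOrientation_swap hA hB).1 hor⟩
  tight θ := by
    have hback : ∀ S : Set Plane, reach S (Real.pi + (θ + Real.pi)) = reach S θ := fun S =>
      reach_congr_angle S (by rw [unitDir_pi_add, unitDir_add_pi, neg_neg])
    have hs : segmentReach B₀ B₁ A₀ A₁ (θ + Real.pi) = segmentReach A₀ A₁ B₀ B₁ θ := by
      rw [segmentReach, segmentReach, hback, add_comm, add_comm θ]
    have := h.tight (θ + Real.pi)
    rw [hback, hs, add_comm B A, reach_add_pi (hA.add hB), add_comm, add_comm θ] at this
    rw [this]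
    by_cases hr : θ ∈ ccwRange θ₀ θ₁
    · rw [if_pos hr, if_pos (by rw [add_comm Real.pi θ]; exact mem_ccwRange_add_pi.2 hr)]
    · rw [if_neg hr, if_neg fun h => hr (mem_ccwRange_add_pi.1 (by rw [add_comm θ]; exact h))]

/-! ### Corridors and the final case distinction -/

section Corridor

variable {K : Set Plane} {P Q X : Plane}

/-- Membership in the corridor in terms of the position of `X` relative to a point moving from `P`
to `Q`. -/
theorem mem_openCorridor_iff_start (hK : IsRobot K) :
    X ∈ openCorridor K P Q ↔ ∃ t : ℝ, 0 ≤ t ∧ t ≤ 1 ∧ X - P + t • (P - Q) ∈ interior K := by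
  rw [mem_openCorridor_iff hK]
  constructor
  · rintro ⟨_, ⟨s, t, hs, ht, hst, rfl⟩, h⟩
    refine ⟨t, ht, by linarith, ?_⟩
    have hs' : s = 1 - t := by linarith
    subst hs'
    convert h using 1
    module
  · rintro ⟨t, h0, h1, h⟩
    refine ⟨_, ⟨1 - t, t, by linarith, h0, by ring, rfl⟩, ?_⟩
    convert h using 1
    module

theorem openCorridor_symm (K : Set Plane) (P Q : Plane) :
    openCorridor K P Q = openCorridor K Q P := by
  rw [openCorridor, openCorridor, segment_symm]

theorem mem_openCorridor_iff_neg (hK : IsRobot K) :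
    X ∈ openCorridor K P Q ↔ ∃ t : ℝ, 0 ≤ t ∧ t ≤ 1 ∧ P - X + t • (Q - P) ∈ interior K := by
  rw [mem_openCorridor_iff_start hK]
  have e : ∀ t : ℝ, P - X + t • (Q - P) = -(X - P + t • (P - Q)) := fun t => by module
  have hn : ∀ k, k ∈ interior K ↔ -k ∈ interior K := fun k =>
    ⟨hK.neg_mem_interior, fun h => by simpa using hK.neg_mem_interior h⟩
  simp only [e, ← hn]

end Corridor

/-- The case of the statement in which both positions of the first robot lie in the corridor of the
second one. -/
theorem exists_tight_of_mem_mem {A B : Set Plane} (hA : IsRobot A) (hB : IsRobot B)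
    {A₀ A₁ B₀ B₁ : Plane} (hv₀ : IsViable A B A₀ B₀) (hv₁ : IsViable A B A₁ B₁) {θ₀ θ₁ : ℝ}
    (hθ₀ : IsOrientation A B A₀ B₀ θ₀) (hθ₁ : IsOrientation A B A₁ B₁ θ₁)
    (h₀ : A₀ ∈ openCorridor (A + B) B₀ B₁) (h₁ : A₁ ∈ openCorridor (A + B) B₀ B₁) :
    ∃ ξA ξB : ℝ → Plane, IsTightCcwCoMotion A B A₀ A₁ B₀ B₁ θ₀ θ₁ ξA ξB ∧
      IsStandardForm A B ξA ξB := by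
  have hK := hA.add hB
  rw [isViable_iff hA hB] at hv₀ hv₁
  rw [isOrientation_iff hA hB] at hθ₀ hθ₁
  obtain ⟨t₀, h1, -, h2⟩ := (mem_openCorridor_iff_start hK).1 h₀
  rw [openCorridor_symm] at h₁
  obtain ⟨t₁, h3, -, h4⟩ := (mem_openCorridor_iff_start hK).1 h₁
  refine (hasTightThreeStep_of_hit_hit hK hv₀ hv₁ hθ₀ hθ₁ h1 h3 h2 ?_).exists_tight hA hB
  rwa [sub_eq_add_neg, ← smul_neg, neg_sub]

end

theorem mainTheorem3 (A B : Set Plane) (hA : IsRobot A) (hB : IsRobot B)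
    (A₀ A₁ B₀ B₁ : Plane)
    (hviable₀ : IsViable A B A₀ B₀) (hviable₁ : IsViable A B A₁ B₁)
    (θ₀ θ₁ : ℝ) (hθ₀ : IsOrientation A B A₀ B₀ θ₀) (hθ₁ : IsOrientation A B A₁ B₁ θ₁)
    (hstraight : ¬ StraightLineFeasible A B A₀ A₁ B₀ B₁) :
    (∃ ξA ξB : ℝ → Plane, IsTightCcwCoMotion A B A₀ A₁ B₀ B₁ θ₀ θ₁ ξA ξB ∧
      (IsStandardForm A B ξA ξB ∨ IsStandardForm B A ξB ξA)) ∧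
    ((A₀ ∈ openCorridor (A + B) B₀ B₁ ∧ A₁ ∈ openCorridor (A + B) B₀ B₁) ∨
        ¬ (B₀ ∈ openCorridor (A + B) A₀ A₁ ∧ B₁ ∈ openCorridor (A + B) A₀ A₁) →
      ∃ ξA ξB : ℝ → Plane, IsTightCcwCoMotion A B A₀ A₁ B₀ B₁ θ₀ θ₁ ξA ξB ∧
        IsStandardForm A B ξA ξB) := by
  have hK := hA.add hB
  have hpq : A₁ - B₁ = A₀ - B₀ + (B₀ - B₁) + (A₁ - A₀) := by abel
  rw [StraightLineFeasible] at hstraight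
  have hfirst : (A₀ ∈ openCorridor (A + B) B₀ B₁ ∧ A₁ ∈ openCorridor (A + B) B₀ B₁) ∨
        ¬ (B₀ ∈ openCorridor (A + B) A₀ A₁ ∧ B₁ ∈ openCorridor (A + B) A₀ A₁) →
      ∃ ξA ξB : ℝ → Plane, IsTightCcwCoMotion A B A₀ A₁ B₀ B₁ θ₀ θ₁ ξA ξB ∧
        IsStandardForm A B ξA ξB := by
    intro hcase
    by_cases ha : A₀ ∈ openCorridor (A + B) B₀ B₁ ∧ A₁ ∈ openCorridor (A + B) B₀ B₁
    · exact exists_tight_of_mem_mem hA hB hviable₀ hviable₁ hθ₀ hθ₁ ha.1 ha.2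
    have hv₀ := (isViable_iff hA hB _ _).1 hviable₀
    have hv₁ := (isViable_iff hA hB _ _).1 hviable₁
    have hd₀ := (isOrientation_iff hA hB _ _ _).1 hθ₀
    have hd₁ := (isOrientation_iff hA hB _ _ _).1 hθ₁
    by_cases hb₁ : B₁ ∈ openCorridor (A + B) A₀ A₁
    · -- the straight motion of the first robot hits the second one at its final position only
      have hb₀ : B₀ ∉ openCorridor (A + B) A₀ A₁ := by tauto
      have ha₁ : A₁ ∈ openCorridor (A + B) B₀ B₁ := by tauto
      rw [openCorridor_symm] at hb₁ ha₁
      obtain ⟨t, h1, h2, h3⟩ := (mem_openCorridor_iff_start hK).1 ha₁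
      obtain ⟨s, h4, h5, h6⟩ := (mem_openCorridor_iff_neg hK).1 hb₁
      refine (hasTightThreeStep_of_free_left hK hv₀ hv₁ hpq hd₀ hd₁ h1 h2 h4 h5
        (by rwa [sub_eq_add_neg, ← smul_neg, neg_sub]) (by rwa [sub_eq_add_neg, ← smul_neg, neg_sub])
        ?_).exists_tight hA hB
      rintro _ ⟨a, b, ha, hb, hab, rfl⟩ hmem
      refine hb₀ ((mem_openCorridor_iff_neg hK).2 ⟨b, hb, by linarith, ?_⟩)
      have ha' : a = 1 - b := by linarith
      subst ha'
      convert hmem using 1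
      module
    · -- the straight motion of the first robot does not hit the second one at its final position
      have ha₀ : A₀ ∈ openCorridor (A + B) B₀ B₁ := by tauto
      have hb₀ : B₀ ∈ openCorridor (A + B) A₀ A₁ := by tauto
      obtain ⟨t, h1, h2, h3⟩ := (mem_openCorridor_iff_start hK).1 ha₀
      obtain ⟨s, h4, h5, h6⟩ := (mem_openCorridor_iff_neg hK).1 hb₀
      refine (hasTightThreeStep_of_free_right hK hv₀ hv₁ hpq hd₀ hd₁ h1 h2 h4 h5 h3 h6
        ?_).exists_tight hA hB
      rintro _ ⟨a, b, ha, hb, hab, rfl⟩ hmem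
      refine hb₁ ((mem_openCorridor_iff_neg hK).2 ⟨b, hb, by linarith, ?_⟩)
      have ha' : a = 1 - b := by linarith
      subst ha'
      convert hmem using 1
      module
  refine ⟨?_, hfirst⟩
  -- with both positions of the second robot in the corridor, the exchanged robots are in the first case
  by_cases hb : B₀ ∈ openCorridor (A + B) A₀ A₁ ∧ B₁ ∈ openCorridor (A + B) A₀ A₁
  · rw [add_comm A B] at hb
    obtain ⟨ξB, ξA, h1, h2⟩ := exists_tight_of_mem_mem hB hA hviable₀.symm hviable₁.symm
      ((isOrientation_swap hA hB).2 hθ₀) ((isOrientation_swap hA hB).2 hθ₁) hb.1 hb.2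
    exact ⟨ξA, ξB, h1.swap hA hB, Or.inr h2⟩
  · obtain ⟨ξA, ξB, h1, h2⟩ := hfirst (Or.inr hb)
    exact ⟨ξA, ξB, h1, Or.inl h2⟩
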